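/- Let $\Phi$ be a reduced irreducible crystallographic finite root system with simple roots $\alpha_i$ $(i\in I)$, coroots $\alpha^\vee$, highest root $\theta$, weight lattice $X$, Weyl group $W$ with length function $\ell$ and reflections $r_\alpha$. Let $I_{\mathrm{af}}=I\sqcup\{0\}$ and let $\lambda\in X$ be a dominant integral weight. *Affine data.* Let $X_{\mathrm{af}}=X\oplus\mathbb Z\Lambda_0\oplus\mathbb Z\delta$ be the weight lattice of the associated untwisted affine root datum, with $\alpha_0=\delta-\theta$, $\alpha_0^\vee=c-\theta^\vee$ (where $\langle c,\mu+k\Lambda_0+n\delta\rangle=k$ and $\theta^\vee$, $\alpha_i^\vee$ for $i\in I$ are extended by $0$ on $\Lambda_0,\delta$), let $W_{\mathrm{af}}$ be the affine Weyl group generated by the simple reflections $r_i$, $i\in I_{\mathrm{af}}$, and let $\mathrm{cl}:\mathbb R\otimes X_{\mathrm{af}}\to \mathbb R\otimes X$ be the projection with kernel $\mathbb R\Lambda_0\oplus\mathbb R\delta$. *Quantum LS paths.* Let $W_J$ be the stabilizer of $\lambda$ in $W$, $J=\{i\in I:\langle\alpha_i^\vee,\lambda\rangle=0\}$, $\Phi_J\supset\Phi_J^+$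 the corresponding roots and positive roots, $W^J$ the set of minimum-length representatives of $W/W_J$, and $\lfloor v\rfloor\in W^J$ the representative of $vW_J$. The parabolic quantum Bruhat graph $\mathrm{QB}(W^J)$ has vertex set $W^J$ and edges $w\xrightarrow{\gamma}\lfloor wr_\gamma\rfloor$ for $\gamma\in\Phi^+\setminus\Phi_J^+$ such that either $\ell(wr_\gamma)=\ell(w)+1$ or $\ell(\lfloor wr_\gamma\rfloor)=\ell(w)+1-\langle\gamma^\vee,2\rho-2\rho_J\rangle$, where $2\rho$ and $2\rho_J$ are the sums of the elements of $\Phi^+$ and of $\Phi_J^+$. A quantum LS path of shape $\lambda$ is a pair of sequences $x_1,\dots,x_s\in W^J$ with $x_u\neq x_{u+1}$ and rationals $0=\sigma_0<\sigma_1<\cdots<\sigma_s=1$ such that for $1\le u\le s-1$ there is a directed path from $x_{u+1}$ to $x_u$ in $\mathrm{QB}(W^J)$, all of whose labels $\gamma$ satisfy $\sigma_u\langle\gamma^\vee,\lambda\rangle\in\mathbb Z$. It defines the path $\eta:[0,1]\to\mathbb R\otimes X$ starting at $0$ that is linear with direction $x_u\lambda$ on $[\sigma_{u-1},\sigma_u]$.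 Let $\mathrm{QLS}(\lambda)$ be the set of these paths. *Projected level-zero LS paths.* On the orbit $X^0_{\mathrm{af}}(\lambda)=W_{\mathrm{af}}\lambda\subset X_{\mathrm{af}}$ consider the order that is the transitive closure of the relations $\mu<r_\beta(\mu)$ for positive affine real roots $\beta$ with $\langle\beta^\vee,\mu\rangle>0$; a cover $\mu\lessdot r_\beta(\mu)$ is labeled by $\beta$. An LS path of shape $\lambda$ is a pair of sequences $\nu_1>\cdots>\nu_s$ in $X^0_{\mathrm{af}}(\lambda)$ and rationals $0=\sigma_0<\cdots<\sigma_s=1$ such that for $1\le u\le s-1$ there is a chain of covers $\nu_u=\xi_0\gtrdot\xi_1\gtrdot\cdots\gtrdot\xi_n=\nu_{u+1}$ whose labels $\gamma_k$ satisfy $\sigma_u\langle\gamma_k^\vee,\xi_{k-1}\rangle\in\mathbb Z$ for all $k$. It defines the path $\pi:[0,1]\to\mathbb R\otimes X_{\mathrm{af}}$ starting at $0$ with direction $\nu_u$ on $[\sigma_{u-1},\sigma_u]$. Let $\mathbb B(\lambda)_{\mathrm{cl}}$ be the set of the paths $\mathrm{cl}\circ\pi$. *Root operators.* For a path $\eta:[0,1]\to\mathbb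 R\otimes X$ and $i\in I_{\mathrm{af}}$ put $H(t)=\langle\alpha_i^\vee,\eta(t)\rangle$, $m=m_i^\eta=\min_t H(t)$, $\tilde\alpha_i=\mathrm{cl}(\alpha_i)$ (so $\tilde\alpha_0=-\theta$), and $s_i=r_i$ for $i\in I$, $s_0=r_\theta$. If $m\le-1$, let $t_1=\min\{t: H(t)=m\}$, $t_0=\max\{t\le t_1: H(t)=m+1\}$, and let $e_i\eta$ be $\eta(t)$ on $[0,t_0]$, $\eta(t_0)+s_i(\eta(t)-\eta(t_0))$ on $[t_0,t_1]$ and $\eta(t)+\tilde\alpha_i$ on $[t_1,1]$; otherwise $e_i\eta=\mathbf 0$. If $H(1)-m\ge1$, let $t_0=\max\{t:H(t)=m\}$, $t_1=\min\{t\ge t_0:H(t)=m+1\}$, and let $f_i\eta$ be given on these three intervals by $\eta(t)$, $\eta(t_0)+s_i(\eta(t)-\eta(t_0))$ and $\eta(t)-\tilde\alpha_i$; otherwise $f_i\eta=\mathbf 0$. Put $\mathrm{wt}(\eta)=\eta(1)$. **Proposition.** A quantum LS path of shape $\lambda$ is determined, as a pair of sequences, by the path it defines. With the root operators $e_i,f_i$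 $(i\in I_{\mathrm{af}})$ and $\mathrm{wt}$, both $\mathrm{QLS}(\lambda)$ and $\mathbb B(\lambda)_{\mathrm{cl}}$ are (seminormal) affine crystals with weight lattice $X$: the sets are stable under the operators up to $\mathbf 0$, weights lie in $X$, $\mathrm{wt}(e_i\eta)=\mathrm{wt}(\eta)+\tilde\alpha_i$ and $\mathrm{wt}(f_i\eta)=\mathrm{wt}(\eta)-\tilde\alpha_i$ whenever these are not $\mathbf 0$, $f_i\eta=\eta'$ if and only if $e_i\eta'=\eta$, the maxima $\varepsilon_i(\eta)=\max\{n\ge 0:e_i^n\eta\ne\mathbf 0\}$ and $\varphi_i(\eta)=\max\{n\ge 0:f_i^n\eta\neq\mathbf 0\}$ exist and satisfy $\varphi_i(\eta)=\varepsilon_i(\eta)+\langle\alpha_i^\vee,\mathrm{wt}(\eta)\rangle$, and $m_i^\eta=-\varepsilon_i(\eta)\in\mathbb Z_{\le0}$. Moreover $$\mathrm{QLS}(\lambda)=\mathbb B(\lambda)_{\mathrm{cl}}$$ as sets of paths, and the identity map is an isomorphism of affine crystals: a bijection commuting with $e_i$, $f_i$ and preserving $\mathrm{wt}$, $\varepsilon_i$,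 $\varphi_i$ for all $i\in I_{\mathrm{af}}$. -/

import Mathlib

noncomputable section

namespace LevelZeroLS

/-- The least number of factors from `S` in an expression of `g`. -/
def wordLength {G : Type*} [Group G] (S : Set G) (g : G) : ℕ :=
  sInf {n | ∃ l : List G, l.length = n ∧ (∀ s ∈ l, s ∈ S) ∧ l.prod = g}

/-- Paths `[0,1] → V`. -/
abbrev Path (V : Type*) := unitInterval → V

/-- The piecewise linear path from `0` whose direction on `[σ_u, σ_{u+1}]` is `ν_u`
(the `u`-th summand is `0` for `t ≤ σ_u`, `(t - σ_u) ν_u` for `σ_u ≤ t ≤ σ_{u+1}` and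
`(σ_{u+1} - σ_u) ν_u` for `σ_{u+1} ≤ t`). -/
def piecewiseLinear {V : Type*} [AddCommGroup V] [Module ℝ V] {s : ℕ}
    (ν : Fin (s + 1) → V) (σ : Fin (s + 2) → ℚ) : Path V :=
  fun t => ∑ u : Fin (s + 1),
    (min (t : ℝ) (σ u.succ : ℝ) - min (t : ℝ) (σ u.castSucc : ℝ)) • ν u

section

variable {ι M N : Type*} [AddCommGroup M] [Module ℝ M] [AddCommGroup N] [Module ℝ N]
  {P : RootPairing ι ℝ M N} (b : P.Base)

/-! ### The finite root datum: here `M` is `ℝ ⊗ X`. -/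

/-- The weight lattice `X`. -/
def weightLattice : AddSubgroup M where
  carrier := {x | ∀ i ∈ b.support, ∃ n : ℤ, P.coroot' i x = n}
  zero_mem' := fun i _ => ⟨0, by simp⟩
  add_mem' := by
    intro x y hx hy i hi
    obtain ⟨m, hm⟩ := hx i hi
    obtain ⟨n, hn⟩ := hy i hi
    exact ⟨m + n, by rw [map_add, hm, hn]; push_cast; rfl⟩
  neg_mem' := by
    intro x hx i hi
    obtain ⟨m, hm⟩ := hx i hi
    exact ⟨-m, by rw [map_neg, hm]; push_cast; rfl⟩

/-- Dominant integral weights. -/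
def IsDominantIntegral (lam : M) : Prop :=
  ∀ i ∈ b.support, ∃ n : ℕ, P.coroot' i lam = n

/-- `θ` indexes the highest root: every root is obtained from it by subtracting simple roots. -/
def IsHighestRoot (θ : ι) : Prop :=
  ∀ i, P.root θ - P.root i ∈ AddSubmonoid.closure (P.root '' (b.support : Set ι))

/-- The length function of the finite Weyl group. -/
def weylLength (w : P.weylGroup) : ℕ :=
  wordLength {s | ∃ i ∈ b.support, s = RootPairing.weylGroup.ofIdx P i} w

/-- The stabilizer `W_J` of `lam` in the Weyl group. -/
def stabJ (P : RootPairing ι ℝ M N) (lam : M) : Subgroup P.weylGroup :=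
  MulAction.stabilizer P.weylGroup lam

/-- The minimum-length representatives `W^J` of the cosets in `W / W_J`. -/
def minReps (lam : M) : Set P.weylGroup :=
  {w | ∀ z ∈ stabJ P lam, weylLength b w ≤ weylLength b (w * z)}

/-- `v = ⌊w⌋`: `v` is the minimum-length representative of the coset `w W_J`. -/
def IsFloor (lam : M) (w v : P.weylGroup) : Prop :=
  v ∈ minReps b lam ∧ w⁻¹ * v ∈ stabJ P lam

/-- `Φ_J`: the roots in the span of the simple roots `α_j` with `⟨α_j^∨, lam⟩ = 0`. -/
def rootsJ (lam : M) : Set ι :=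
  {i | P.root i ∈ AddSubgroup.closure (P.root '' {j | j ∈ b.support ∧ P.coroot' j lam = 0})}

open Classical in
/-- `2ρ - 2ρ_J`, the difference of the sum over `Φ⁺` and the sum over `Φ_J⁺`. -/
def twoRhoSub [Fintype ι] (lam : M) : M :=
  (∑ i : ι with b.IsPos i, P.root i) - ∑ i : ι with b.IsPos i ∧ i ∈ rootsJ b lam, P.root i

/-- The edges `w → ⌊w r_γ⌋ = v` of the parabolic quantum Bruhat graph, with label `γ` in
`Φ⁺ \ Φ_J⁺`; the two alternatives are the Bruhat edges and the quantum edges. -/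
structure QBEdge [Fintype ι] (lam : M) (w : P.weylGroup) (γ : ι) (v : P.weylGroup) : Prop where
  source_mem : w ∈ minReps b lam
  label_pos : b.IsPos γ
  label_not_mem : γ ∉ rootsJ b lam
  target : IsFloor b lam (w * RootPairing.weylGroup.ofIdx P γ) v
  bruhat_or_quantum :
    weylLength b (w * RootPairing.weylGroup.ofIdx P γ) = weylLength b w + 1 ∨
    (weylLength b v : ℝ) = weylLength b w + 1 - P.coroot' γ (twoRhoSub b lam)

/-- There is a directed `σ`-path from `y` to `x`. -/
def HasDirectedPath [Fintype ι] (lam : M) (σ : ℚ) (y x : P.weylGroup) : Prop :=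
  Relation.ReflTransGen
    (fun w v => ∃ γ, QBEdge b lam w γ v ∧ ∃ n : ℤ, (σ : ℝ) * P.coroot' γ lam = n) y x

/-- Quantum LS paths of shape `lam`, as pairs of sequences `x_0, …, x_s` and
`0 = σ_0 < σ_1 < ⋯ < σ_{s+1} = 1`. -/
structure QLSPair [Fintype ι] (lam : M) where
  s : ℕ
  x : Fin (s + 1) → P.weylGroup
  σ : Fin (s + 2) → ℚ
  x_mem : ∀ u, x u ∈ minReps b lam
  x_ne : ∀ u : Fin s, x u.castSucc ≠ x u.succ
  σ_strictMono : StrictMono σ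
  σ_zero : σ 0 = 0
  σ_last : σ (Fin.last (s + 1)) = 1
  directedPath : ∀ u : Fin s, HasDirectedPath b lam (σ u.succ.castSucc) (x u.succ) (x u.castSucc)

/-- The path `[0,1] → ℝ ⊗ X` of a quantum LS path. -/
def QLSPair.toPath [Fintype ι] {b : P.Base} {lam : M} (η : QLSPair b lam) : Path M :=
  piecewiseLinear (fun u => η.x u • lam) η.σ

/-- `QLS(lam)`, as a set of paths. -/
def QLS [Fintype ι] (lam : M) : Set (Path M) := Set.range (QLSPair.toPath (b := b) (lam := lam))

/-! ### The untwisted affine root datum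

`ℝ ⊗ X_af = (ℝ ⊗ X) ⊕ ℝ Λ_0 ⊕ ℝ δ`, where a triple `(μ, k, n)` stands for `μ + k Λ_0 + n δ`.
So `ℝ ⊗ X` sits inside the level-zero part, `Λ_i = ω_i + ⟨c, Λ_i⟩ Λ_0` for `i ∈ I`, and `cl` is the
first projection. The affine nodes are `Option I`, with `none` for the node `0`. -/

/-- `ℝ ⊗ X_af`. -/
abbrev AffSpace (M : Type*) := M × ℝ × ℝ

/-- The affine nodes `I_af`. -/
abbrev AffNode {P : RootPairing ι ℝ M N} (b : P.Base) := Option b.support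

variable (θ : ι)

/-- The affine simple roots: `α_0 = δ - θ`, and `α_i` for `i ∈ I`. -/
def affSimpleRoot : AffNode b → AffSpace M
  | none => (-P.root θ, 0, 1)
  | some i => (P.root i, 0, 0)

/-- The affine simple coroots: `α_0^∨ = c - θ^∨`, and `α_i^∨` for `i ∈ I`. -/
def affSimpleCoroot : AffNode b → Module.Dual ℝ (AffSpace M)
  | none => LinearMap.fst ℝ ℝ ℝ ∘ₗ LinearMap.snd ℝ M (ℝ × ℝ) -
      P.coroot' θ ∘ₗ LinearMap.fst ℝ M (ℝ × ℝ)
  | some i => P.coroot' i ∘ₗ LinearMap.fst ℝ M (ℝ × ℝ)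

lemma affSimpleCoroot_affSimpleRoot (i : AffNode b) :
    affSimpleCoroot b θ i (affSimpleRoot b θ i) = 2 := by
  cases i <;> simp [affSimpleCoroot, affSimpleRoot]

/-- The affine simple reflections. -/
def affSimpleRefl (i : AffNode b) : AffSpace M ≃ₗ[ℝ] AffSpace M :=
  Module.reflection (affSimpleCoroot_affSimpleRoot b θ i)

/-- The affine Weyl group. -/
def affWeylGroup : Subgroup (AffSpace M ≃ₗ[ℝ] AffSpace M) :=
  Subgroup.closure (Set.range (affSimpleRefl b θ))

/-- `β = w α_i` is a positive affine real root and `βv = w α_i^∨` is its coroot. -/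
def IsPosAffRoot (β : AffSpace M) (βv : Module.Dual ℝ (AffSpace M)) : Prop :=
  (∃ w ∈ affWeylGroup b θ, ∃ i : AffNode b,
    β = w (affSimpleRoot b θ i) ∧ ∀ μ, βv μ = affSimpleCoroot b θ i (w⁻¹ μ)) ∧
  β ∈ AddSubmonoid.closure (Set.range (affSimpleRoot b θ))

/-- The orbit `X_af^0(lam) = W_af lam`. -/
def orbit (lam : M) : Set (AffSpace M) :=
  {μ | ∃ w ∈ affWeylGroup b θ, μ = w (lam, 0, 0)}

/-- The relations `μ < ν = r_β(μ)` with `⟨μ, β^∨⟩ > 0` generating the level-zero weight poset,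
where `β` is a positive affine real root with coroot `βv`. -/
structure ReflLT (lam : M) (β : AffSpace M) (βv : Module.Dual ℝ (AffSpace M))
    (μ ν : AffSpace M) : Prop where
  left_mem : μ ∈ orbit b θ lam
  right_mem : ν ∈ orbit b θ lam
  root : IsPosAffRoot b θ β βv
  eq_refl : ν = μ - βv μ • β
  pos : 0 < βv μ

/-- The order `μ < ν` of the level-zero weight poset. -/
def WeightLT (lam : M) : AffSpace M → AffSpace M → Prop :=
  Relation.TransGen (fun μ ν => ∃ β βv, ReflLT b θ lam β βv μ ν)

/-- `μ ⋖ ν` is a cover of the level-zero weight poset with label `β`. -/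
def LabeledCover (lam : M) (β : AffSpace M) (βv : Module.Dual ℝ (AffSpace M))
    (μ ν : AffSpace M) : Prop :=
  ReflLT b θ lam β βv μ ν ∧ ¬ ∃ κ, WeightLT b θ lam μ κ ∧ WeightLT b θ lam κ ν

/-- There is a `σ`-chain for `(μ, ν)`. -/
def HasChain (lam : M) (σ : ℚ) (μ ν : AffSpace M) : Prop :=
  Relation.TransGen
    (fun ξ ξ' => ∃ γ γv, LabeledCover b θ lam γ γv ξ' ξ ∧ ∃ n : ℤ, (σ : ℝ) * γv ξ = n) μ ν

/-- LS paths of shape `lam`, as pairs of sequences `ν_0 > ⋯ > ν_s` and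
`0 = σ_0 < σ_1 < ⋯ < σ_{s+1} = 1`. -/
structure LSPair (lam : M) where
  s : ℕ
  ν : Fin (s + 1) → AffSpace M
  σ : Fin (s + 2) → ℚ
  ν_mem : ∀ u, ν u ∈ orbit b θ lam
  ν_gt : ∀ u : Fin s, WeightLT b θ lam (ν u.succ) (ν u.castSucc)
  σ_strictMono : StrictMono σ
  σ_zero : σ 0 = 0
  σ_last : σ (Fin.last (s + 1)) = 1
  chain : ∀ u : Fin s, HasChain b θ lam (σ u.succ.castSucc) (ν u.castSucc) (ν u.succ)

/-- The path `[0,1] → ℝ ⊗ X_af` of an LS path. -/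
def LSPair.toPath {b : P.Base} {θ : ι} {lam : M} (π : LSPair b θ lam) : Path (AffSpace M) :=
  piecewiseLinear π.ν π.σ

/-- `𝔹(lam)_cl`, the set of the paths `cl(π)` for the LS paths `π` of shape `lam`. -/
def LScl (lam : M) : Set (Path M) :=
  {η | ∃ π : LSPair b θ lam, ∀ t, η t = (π.toPath t).1}

/-! ### Root operators on paths in `ℝ ⊗ X` -/

/-- `α̃_i = cl(α_i)`, which is `α_i` for `i ∈ I` and `-θ` for `i = 0`. -/
def clRoot (i : AffNode b) : M := (affSimpleRoot b θ i).1

/-- `⟨α_i^∨, μ⟩` for `μ ∈ ℝ ⊗ X` and `i ∈ I_af`; for `i = 0` it is `-⟨θ^∨, μ⟩`. -/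
def clPairing (i : AffNode b) (μ : M) : ℝ := affSimpleCoroot b θ i (μ, 0, 0)

/-- `s_i`, which is `r_i` for `i ∈ I` and `r_θ` for `i = 0`. -/
def clRefl (i : AffNode b) (μ : M) : M := μ - clPairing b θ i μ • clRoot b θ i

/-- `H_i^η(t) = ⟨α_i^∨, η(t)⟩`. -/
def height (i : AffNode b) (η : Path M) (t : unitInterval) : ℝ := clPairing b θ i (η t)

/-- `m_i^η`, the minimum of `H_i^η`. -/
def minHeight (i : AffNode b) (η : Path M) : ℝ := sInf (Set.range (height b θ i η))

open Classical in
/-- The root operator `e_i`, with `none` for `𝟎`. -/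
def rootE (i : AffNode b) (η : Path M) : Option (Path M) :=
  let H := height b θ i η
  let m := minHeight b θ i η
  let t₁ : unitInterval := sInf {t | H t = m}
  let t₀ : unitInterval := sSup {t | t ≤ t₁ ∧ H t = m + 1}
  if m ≤ -1 then
    some fun t =>
      if t ≤ t₀ then η t
      else if t ≤ t₁ then η t₀ + clRefl b θ i (η t - η t₀)
      else η t + clRoot b θ i
  else none

open Classical in
/-- The root operator `f_i`, with `none` for `𝟎`. -/
def rootF (i : AffNode b) (η : Path M) : Option (Path M) :=
  let H := height b θ i η
  let m := minHeight b θ i η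
  let t₀ : unitInterval := sSup {t | H t = m}
  let t₁ : unitInterval := sInf {t | t₀ ≤ t ∧ H t = m + 1}
  if 1 ≤ H 1 - m then
    some fun t =>
      if t ≤ t₀ then η t
      else if t ≤ t₁ then η t₀ + clRefl b θ i (η t - η t₀)
      else η t - clRoot b θ i
  else none

/-! ### Affine crystals with weights in `X` -/

/-- The `n`-fold composite of a partial map. -/
def iterOpt {B : Type*} (g : B → Option B) : ℕ → B → Option B
  | 0, x => some x
  | n + 1, x => (iterOpt g n x).bind g

/-- (Seminormal) affine crystals with weight lattice `X`; the value `none` stands for `𝟎`. -/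
structure AffineCrystal (B : Type*) where
  wt : B → M
  e : AffNode b → B → Option B
  f : AffNode b → B → Option B
  ε : AffNode b → B → ℕ
  φ : AffNode b → B → ℕ
  wt_mem : ∀ x, wt x ∈ weightLattice b
  wt_e : ∀ i x y, e i x = some y → wt y = wt x + clRoot b θ i
  wt_f : ∀ i x y, f i x = some y → wt y = wt x - clRoot b θ i
  f_eq_iff : ∀ i x y, f i x = some y ↔ e i y = some x
  ε_isGreatest : ∀ i x, IsGreatest {n | (iterOpt (e i) n x).isSome} (ε i x)
  φ_isGreatest : ∀ i x, IsGreatest {n | (iterOpt (f i) n x).isSome} (φ i x)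
  φ_eq : ∀ i x, (φ i x : ℝ) = ε i x + clPairing b θ i (wt x)

/-- The crystal structure on a set `S` of paths is the one given by the root operators (in
particular, `S ∪ {𝟎}` is stable under them) and `wt(η) = η(1)`, and the minima `m_i^η` are the
integers `-ε_i(η)`. -/
structure AffineCrystal.IsPathCrystal {b : P.Base} {θ : ι} {S : Set (Path M)}
    (C : AffineCrystal b θ S) : Prop where
  wt_eq : ∀ η : S, C.wt η = (η : Path M) 1
  e_eq : ∀ i (η : S), (C.e i η).map Subtype.val = rootE b θ i (η : Path M)
  f_eq : ∀ i (η : S), (C.f i η).map Subtype.val = rootF b θ i (η : Path M)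
  minHeight_eq : ∀ i (η : S), minHeight b θ i (η : Path M) = -(C.ε i η : ℝ)

/-- Isomorphisms of affine crystals. -/
structure AffineCrystal.Iso {b : P.Base} {θ : ι} {B B' : Type*}
    (C : AffineCrystal b θ B) (C' : AffineCrystal b θ B') extends B ≃ B' where
  wt_eq : ∀ x, C'.wt (toEquiv x) = C.wt x
  e_eq : ∀ i x, C'.e i (toEquiv x) = (C.e i x).map toEquiv
  f_eq : ∀ i x, C'.f i (toEquiv x) = (C.f i x).map toEquiv
  ε_eq : ∀ i x, C'.ε i (toEquiv x) = C.ε i x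
  φ_eq : ∀ i x, C'.φ i (toEquiv x) = C.φ i x

end

end LevelZeroLS

end

/-! Both sets are identified with a single set, `repPaths`: piecewise linear paths with rational
nodes and directions in the finite orbit `W lam`, where consecutive directions are joined by chains
of edges of a graph on weights (`Edge`, `Up`) subject to the integrality condition. The crystal
structure is then constructed once, on this set.

The bridge is a length function on weights. For a weight `μ`, let `weightLength` count the negative
roots whose coroots are positive on `μ`, and let `rootSum` be the sum of all roots whose coroots are
positive on `μ`. For a positive affine root `α_a + k δ` with `⟨α_a^∨, μ⟩ > 0`, the number
`reflLength` is the increment of the semi-infinite length under the reflection. Conjugation by an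
affine simple reflection changes it by a difference of two signs (`reflLength_reflection`).
Induction on the height of the affine root, down to the simple roots, therefore shows that it is at
least one (`one_le_reflLength`) and, together with diamond lemmas for the order, that it equals one
exactly for covers (`noBetween_affRefl_iff`). On the finite side, a minimal representative `w` has
length `weightLength` of `w lam`, and `rootSum` of `lam` is `2ρ - 2ρ_J`. So increment one is the
Bruhat condition when `k = 0` and the quantum condition when `k = 1`, and no other `k` occurs
(`QBEdge.edge`, `Edge.exists_qbEdge`). A chain of edges lifts to a chain of covers above any
prescribed bottom point of the affine orbit, so a path is lifted direction by direction, beginning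
with the last one.

For the root operators, an edge that is not the reflection in `α_i` cannot lower the sign of
`⟨α_i^∨, ·⟩`, and `r_i` carries it to an edge when the sign does not change (`Edge.cases`). At a
node where `H_i` is not integral, a decreasing `H_i` thus goes on decreasing. Hence minima are
integers, and `H_i` is strictly monotone on the stretch where an operator acts. After refining the
nodes so that integers are crossed only at nodes, `e_i` and `f_i` reflect the directions between two
nodes, and the chains joining directions are repaired by adding or deleting an `r_i`-edge.

A quantum LS path has distinct consecutive directions, so the path it defines determines its nodes
and directions; a direction determines its minimal representative. -/

noncomputable section

set_option linter.unusedSectionVars false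

namespace LevelZeroLS

variable {ι M N : Type*} [AddCommGroup M] [Module ℝ M] [AddCommGroup N] [Module ℝ N]
  {P : RootPairing ι ℝ M N} {b : P.Base} {θ : ι}

section

/-! ### Positive roots, heights and the highest root -/

lemma reflectionPerm_reflectionPerm_self (P : RootPairing ι ℝ M N) (a : ι) :
    P.reflectionPerm (P.reflectionPerm a a) = P.reflectionPerm a := by
  ext c
  apply P.root.injective
  rw [P.root_reflectionPerm, P.root_reflectionPerm, P.reflection_reflectionPerm]
  simp

lemma root_reflectionPerm_same (P : RootPairing ι ℝ M N) (a : ι) :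
    P.root (P.reflectionPerm a a) = -P.root a := by
  simp

lemma coroot'_reflectionPerm_same (P : RootPairing ι ℝ M N) (a : ι) (x : M) :
    P.coroot' (P.reflectionPerm a a) x = -P.coroot' a x := by
  rw [P.coroot'_reflectionPerm, LinearMap.comp_apply, LinearEquiv.coe_coe, P.reflection_apply]
  simp; ring

lemma reflectionPerm_same_conj (P : RootPairing ι ℝ M N) (c a : ι) :
    P.reflectionPerm c (P.reflectionPerm a a) =
      P.reflectionPerm (P.reflectionPerm c a) (P.reflectionPerm c a) := by
  apply P.root.injective
  rw [P.root_reflectionPerm, root_reflectionPerm_same, map_neg, root_reflectionPerm_same,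
    P.root_reflectionPerm]

lemma coroot'_root_eq_pairingIn [P.IsCrystallographic] (a c : ι) :
    P.coroot' c (P.root a) = (P.pairingIn ℤ a c : ℝ) := by
  rw [P.root_coroot'_eq_pairing, ← P.algebraMap_pairingIn ℤ]; rfl

lemma reflection_apply' (P : RootPairing ι ℝ M N) (a : ι) (x : M) :
    P.reflection a x = x - P.coroot' a x • P.root a := rfl

lemma height_reflectionPerm [P.IsCrystallographic] (b : P.Base) (c a : ι) :
    b.height (P.reflectionPerm c a) = b.height a - P.pairingIn ℤ a c * b.height c := by
  have : P.root (P.reflectionPerm c a) = P.root a + (-P.pairingIn ℤ a c) • P.root c := by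
    rw [P.root_reflectionPerm, neg_smul, P.reflection_apply_root' ℤ, sub_eq_add_neg]
  rw [b.height_add_zsmul this, smul_eq_mul]; ring

lemma height_same (b : P.Base) (a : ι) : b.height (P.reflectionPerm a a) = -b.height a :=
  b.height_reflectionPerm_self a

lemma isPos_same (b : P.Base) (a : ι) : b.IsPos (P.reflectionPerm a a) ↔ ¬ b.IsPos a :=
  RootPairing.Base.IsPos.neg_iff_not b a

/-- The linear form with value `1` on every simple root. -/
def heightForm [P.IsRootSystem] (b : P.Base) : M →ₗ[ℝ] ℝ :=
  b.toWeightBasis.constr ℝ (fun _ => (1 : ℝ))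

lemma heightForm_simple [P.IsRootSystem] {i : ι} (hi : i ∈ b.support) :
    heightForm b (P.root i) = 1 := by
  have := b.toWeightBasis.constr_basis ℝ (fun _ => (1 : ℝ)) ⟨i, hi⟩
  rwa [b.toWeightBasis_apply] at this

lemma heightForm_root [P.IsRootSystem] (b : P.Base) (a : ι) :
    heightForm b (P.root a) = b.height a := by
  obtain ⟨f, -, -, hf⟩ := b.exists_root_eq_sum_int a
  rw [RootPairing.Base.height_eq_sum hf, hf, map_sum, Int.cast_sum]
  refine Finset.sum_congr rfl fun j hj => ?_
  rw [map_zsmul, heightForm_simple hj]; simp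

/-- Every simple root in a sum contributes one, so the height vanishes only for the empty sum. This
turns the defining property of `θ` into uniqueness of the root of maximal height. -/
lemma heightForm_eq_zero_of_mem_closure [P.IsRootSystem] {x : M}
    (hx : x ∈ AddSubmonoid.closure (P.root '' (b.support : Set ι))) :
    0 ≤ heightForm b x ∧ (heightForm b x = 0 → x = 0) := by
  induction hx using AddSubmonoid.closure_induction with
  | mem x hx =>
    obtain ⟨i, hi, rfl⟩ := hx
    rw [heightForm_simple hi]; norm_num
  | zero => simp
  | add x y _ _ hx hy =>
    rw [map_add]
    refine ⟨by linarith [hx.1, hy.1], fun h => ?_⟩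
    rw [hx.2 (by linarith [hx.1, hy.1]), hy.2 (by linarith [hx.1, hy.1]), add_zero]

lemma root_mem_closure_of_isPos [P.IsRootSystem] {a : ι} (ha : b.IsPos a) :
    P.root a ∈ AddSubmonoid.closure (P.root '' (b.support : Set ι)) := by
  refine (b.root_mem_or_neg_mem a).resolve_right fun h => ?_
  have := (heightForm_eq_zero_of_mem_closure h).1
  rw [map_neg, heightForm_root] at this
  have h2 : (0 : ℝ) < b.height a := by exact_mod_cast ha
  linarith

section HighestRoot

variable [Finite ι] [P.IsCrystallographic] [P.IsReduced] [P.IsRootSystem]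

lemma IsHighestRoot.height_le (hθ : IsHighestRoot b θ) (a : ι) : b.height a ≤ b.height θ := by
  have := (heightForm_eq_zero_of_mem_closure (hθ a)).1
  rw [map_sub, heightForm_root, heightForm_root] at this
  have h : (b.height a : ℝ) ≤ b.height θ := by linarith
  exact_mod_cast h

lemma IsHighestRoot.eq_of_height (hθ : IsHighestRoot b θ) {a : ι}
    (h : b.height a = b.height θ) : a = θ := by
  have := (heightForm_eq_zero_of_mem_closure (hθ a)).2
  rw [map_sub, heightForm_root, heightForm_root, h, sub_self] at this
  exact P.root.injective (sub_eq_zero.mp (this rfl)).symm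

lemma IsHighestRoot.height_pos (hθ : IsHighestRoot b θ) : 0 < b.height θ := by
  have h := hθ.height_le (P.reflectionPerm θ θ)
  rw [height_same] at h
  have := b.height_ne_zero θ
  omega

lemma IsHighestRoot.neg_height_le (hθ : IsHighestRoot b θ) (a : ι) :
    -b.height θ ≤ b.height a := by
  have h := hθ.height_le (P.reflectionPerm a a)
  rw [height_same] at h
  omega

/-- A negative pairing would make `θ + α_i` a root of larger height. -/
lemma IsHighestRoot.pairingIn_simple_nonneg (hθ : IsHighestRoot b θ) {i : ι}
    (hi : i ∈ b.support) : 0 ≤ P.pairingIn ℤ i θ := by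
  by_contra! h
  have hh := hθ.height_pos
  have hi1 := RootPairing.Base.height_one_of_mem_support hi
  obtain ⟨k, hk⟩ := P.root_add_root_mem_of_pairingIn_neg h (fun h' => by
    rw [← root_reflectionPerm_same] at h'
    have := P.root.injective h'
    rw [this, height_same] at hi1
    omega)
  have := b.height_add hk
  have := hθ.height_le k
  omega

lemma IsHighestRoot.pairingIn_nonneg (hθ : IsHighestRoot b θ) {a : ι} (ha : b.IsPos a) :
    0 ≤ P.pairingIn ℤ a θ := by
  refine ha.induction_on_add (p := fun a => 0 ≤ P.pairingIn ℤ a θ)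
    (fun i hi => hθ.pairingIn_simple_nonneg hi) fun i j k hk h1 hj => ?_
  rw [P.pairingIn_eq_add_of_root_eq_add hk]
  exact add_nonneg h1 (hθ.pairingIn_simple_nonneg hj)

/-- If the pairing were at least two, reflecting in `θ` would lower the height of `a`, which is
below that of `θ`, past the least possible height, that of `-θ`. -/
lemma IsHighestRoot.pairingIn_le_one (hθ : IsHighestRoot b θ) {a : ι} (ha : a ≠ θ) :
    P.pairingIn ℤ a θ ≤ 1 := by
  by_contra! h
  have h1 := hθ.neg_height_le (P.reflectionPerm θ a)
  rw [height_reflectionPerm] at h1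
  have h2 := hθ.height_le a
  have h3 := hθ.height_pos
  have h4 : b.height a ≠ b.height θ := fun h => ha (hθ.eq_of_height h)
  have h5 : b.height a < b.height θ := lt_of_le_of_ne h2 h4
  nlinarith

end HighestRoot

/-! ### The affine nodes -/

/-- The index of the root `cl(α_i)`. -/
def nodeIdx (b : P.Base) (θ : ι) : AffNode b → ι
  | none => P.reflectionPerm θ θ
  | some i => i

/-- The coefficient of `δ` in `α_i`. -/
def nodeInt (b : P.Base) : AffNode b → ℤ
  | none => 1
  | some _ => 0

lemma affSimpleRoot_eq (b : P.Base) (θ : ι) (i : AffNode b) :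
    affSimpleRoot b θ i = (P.root (nodeIdx b θ i), 0, (nodeInt b i : ℝ)) := by
  cases i <;> simp [affSimpleRoot, nodeIdx, nodeInt]

lemma clRoot_eq (b : P.Base) (θ : ι) (i : AffNode b) :
    clRoot b θ i = P.root (nodeIdx b θ i) := by
  rw [clRoot, affSimpleRoot_eq]

lemma affSimpleCoroot_levelZero (b : P.Base) (θ : ι) (i : AffNode b) (x : M) (n : ℝ) :
    affSimpleCoroot b θ i (x, 0, n) = P.coroot' (nodeIdx b θ i) x := by
  cases i
  · simp only [nodeIdx, coroot'_reflectionPerm_same]; simp [affSimpleCoroot]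
  · simp [affSimpleCoroot, nodeIdx]

lemma clPairing_eq (b : P.Base) (θ : ι) (i : AffNode b) (x : M) :
    clPairing b θ i x = P.coroot' (nodeIdx b θ i) x :=
  affSimpleCoroot_levelZero b θ i x 0

lemma clRefl_eq (b : P.Base) (θ : ι) (i : AffNode b) (x : M) :
    clRefl b θ i x = P.reflection (nodeIdx b θ i) x := by
  rw [clRefl, clPairing_eq, clRoot_eq, reflection_apply']

lemma affSimpleRefl_levelZero (b : P.Base) (θ : ι) (i : AffNode b) (x : M) (n : ℝ) :
    affSimpleRefl b θ i (x, 0, n) = (P.reflection (nodeIdx b θ i) x, 0,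
      n - nodeInt b i * P.coroot' (nodeIdx b θ i) x) := by
  rw [affSimpleRefl, Module.reflection_apply, affSimpleCoroot_levelZero, affSimpleRoot_eq,
    reflection_apply']
  ext <;> simp; ring

/-- The indicator of the negative roots. -/
def negInd (b : P.Base) (a : ι) : ℤ := by
  classical exact if b.IsPos a then 0 else 1

lemma negInd_of_isPos {a : ι} (h : b.IsPos a) : negInd b a = 0 := by simp [negInd, h]

lemma negInd_of_not_isPos {a : ι} (h : ¬ b.IsPos a) : negInd b a = 1 := by simp [negInd, h]

lemma negInd_nonneg (b : P.Base) (a : ι) : 0 ≤ negInd b a := by unfold negInd; split_ifs <;> simp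

lemma negInd_le_one (b : P.Base) (a : ι) : negInd b a ≤ 1 := by unfold negInd; split_ifs <;> simp

lemma negInd_same (b : P.Base) (a : ι) : negInd b (P.reflectionPerm a a) = 1 - negInd b a := by
  by_cases h : b.IsPos a
  · rw [negInd_of_isPos h, negInd_of_not_isPos]; · rfl
    rwa [isPos_same, not_not]
  · rw [negInd_of_not_isPos h, negInd_of_isPos]; · rfl
    rwa [isPos_same]

lemma negInd_nodeIdx [Finite ι] [P.IsCrystallographic] [P.IsReduced] [P.IsRootSystem]
    (hθ : IsHighestRoot b θ) (i : AffNode b) : negInd b (nodeIdx b θ i) = nodeInt b i := by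
  cases i with
  | none =>
    rw [nodeIdx, negInd_same, negInd_of_isPos hθ.height_pos]; rfl
  | some i => exact negInd_of_isPos (RootPairing.Base.isPos_of_mem_support i.2)

lemma ne_same (P : RootPairing ι ℝ M N) (a : ι) : P.reflectionPerm a a ≠ a := (P.ne_neg a).symm

open Classical in
/-- The change of sign of roots under the affine simple reflections. -/
lemma negInd_reflectionPerm_nodeIdx [Finite ι] [P.IsCrystallographic] [P.IsReduced]
    [P.IsRootSystem] (hθ : IsHighestRoot b θ) (i : AffNode b) (a : ι) :
    negInd b (P.reflectionPerm (nodeIdx b θ i) a) = negInd b a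
      - nodeInt b i * P.pairingIn ℤ a (nodeIdx b θ i) + (if a = nodeIdx b θ i then 1 else 0)
      - (if a = P.reflectionPerm (nodeIdx b θ i) (nodeIdx b θ i) then 1 else 0) := by
  -- `negInd b a` is the least `k` for which `α_a + k δ` is positive. Since `r_i` permutes the
  -- positive affine roots other than `α_i`, only `±α_i` deviate from the shift of the
  -- `δ`-coefficient.
  by_cases h1 : a = nodeIdx b θ i
  · have h2 : a ≠ P.reflectionPerm (nodeIdx b θ i) (nodeIdx b θ i) := by
      rw [h1]; exact (ne_same P _).symm
    rw [if_pos h1, if_neg h2, h1, negInd_same, negInd_nodeIdx hθ, P.pairingIn_same]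
    ring
  rw [if_neg h1]
  by_cases h2 : a = P.reflectionPerm (nodeIdx b θ i) (nodeIdx b θ i)
  · rw [if_pos h2, h2, P.reflectionPerm_self, negInd_same, negInd_nodeIdx hθ,
      P.pairingIn_reflectionPerm_self_left, P.pairingIn_same]
    ring
  rw [if_neg h2]
  cases i with
  | some j =>
    have hj : (j : ι) ∈ b.support := j.2
    simp only [nodeIdx, nodeInt] at h1 h2 ⊢
    by_cases ha : b.IsPos a
    · rw [negInd_of_isPos ha, negInd_of_isPos (ha.reflectionPerm hj h1)]; ring
    · have h3 := ((isPos_same b a).mpr ha).reflectionPerm hj (fun h => h2 (by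
        rw [← h, reflectionPerm_reflectionPerm_self]; simp))
      rw [reflectionPerm_same_conj, isPos_same] at h3
      rw [negInd_of_not_isPos ha, negInd_of_not_isPos h3]; ring
  | none =>
    have hp := hθ.height_pos
    simp only [nodeIdx, nodeInt, reflectionPerm_reflectionPerm_self] at h1 h2 ⊢
    rw [P.reflectionPerm_self] at h2
    rw [P.pairingIn_reflectionPerm_self_right]
    -- For the node `0`, a positive root other than `θ` pairs with `θ^∨` to `0` or `1`: in the first
    -- case its height is kept, in the second it drops below zero.
    have key : ∀ c, b.IsPos c → c ≠ θ → c ≠ P.reflectionPerm θ θ →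
        negInd b (P.reflectionPerm θ c) = P.pairingIn ℤ c θ := by
      intro c hc hcθ hcθ'
      have h3 := hθ.pairingIn_nonneg hc
      have h4 := hθ.pairingIn_le_one hcθ
      have h5 := height_reflectionPerm b θ c
      have h6 := hθ.height_le c
      have h7 : b.height c ≠ b.height θ := fun h => hcθ (hθ.eq_of_height h)
      obtain h | h : P.pairingIn ℤ c θ = 0 ∨ P.pairingIn ℤ c θ = 1 := by omega
      · rw [h] at h5 ⊢
        refine negInd_of_isPos ?_
        rw [b.isPos_iff] at hc ⊢; omega
      · rw [h] at h5 ⊢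
        refine negInd_of_not_isPos ?_
        rw [b.isPos_iff]; omega
    by_cases ha : b.IsPos a
    · rw [key a ha h2 h1, negInd_of_isPos ha]; ring
    · have := key _ ((isPos_same b a).mpr ha) (fun h => h1 (by
        rw [← h, reflectionPerm_reflectionPerm_self]; simp)) (fun h => h2 (by
          have := congrArg (fun c => P.reflectionPerm c c) h
          simpa [reflectionPerm_reflectionPerm_self] using this))
      rw [reflectionPerm_same_conj, negInd_same, P.pairingIn_reflectionPerm_self_left] at this
      rw [negInd_of_not_isPos ha]; linarith

/-! ### Affine real roots -/

/-- `α_a + k δ` is a positive affine root. -/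
def PosAff (b : P.Base) (a : ι) (k : ℤ) : Prop := negInd b a ≤ k

/-- The height of `α_a + k δ`. -/
def affHeight (b : P.Base) (θ : ι) (a : ι) (k : ℤ) : ℤ := b.height a + k * (b.height θ + 1)

section AffineRoots

variable [Finite ι] [P.IsCrystallographic] [P.IsReduced] [P.IsRootSystem]

lemma posAff_nodeIdx (hθ : IsHighestRoot b θ) (i : AffNode b) :
    PosAff b (nodeIdx b θ i) (nodeInt b i) := (negInd_nodeIdx hθ i).le

lemma PosAff.reflection (hθ : IsHighestRoot b θ) (i : AffNode b) {a : ι} {k : ℤ}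
    (h : PosAff b a k) (hne : ¬ (a = nodeIdx b θ i ∧ k = nodeInt b i)) :
    PosAff b (P.reflectionPerm (nodeIdx b θ i) a)
      (k - nodeInt b i * P.pairingIn ℤ a (nodeIdx b θ i)) := by
  classical
  unfold PosAff at h ⊢
  rw [negInd_reflectionPerm_nodeIdx hθ]
  by_cases h1 : a = nodeIdx b θ i
  · have h2 : negInd b a = nodeInt b i := by rw [h1, negInd_nodeIdx hθ]
    have h3 : k ≠ nodeInt b i := fun h => hne ⟨h1, h⟩
    split_ifs <;> omega
  · split_ifs <;> omega

/-- All affine simple roots have height one, because `δ = α_0 + θ` has height `b.height θ + 1`. -/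
lemma affHeight_reflection (b : P.Base) (θ : ι) (i : AffNode b) (a : ι) (k : ℤ) :
    affHeight b θ (P.reflectionPerm (nodeIdx b θ i) a)
      (k - nodeInt b i * P.pairingIn ℤ a (nodeIdx b θ i)) =
      affHeight b θ a k - P.pairingIn ℤ a (nodeIdx b θ i) := by
  unfold affHeight
  rw [height_reflectionPerm]
  cases i with
  | none => simp only [nodeIdx, nodeInt, height_same]; ring
  | some i =>
    simp only [nodeIdx, nodeInt, RootPairing.Base.height_one_of_mem_support i.2]; ring

lemma PosAff.affHeight_pos (hθ : IsHighestRoot b θ) {a : ι} {k : ℤ} (h : PosAff b a k) :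
    0 < affHeight b θ a k := by
  unfold PosAff at h
  unfold affHeight
  have h1 := hθ.height_pos
  have h2 := hθ.neg_height_le a
  by_cases ha : b.IsPos a
  · rw [negInd_of_isPos ha] at h
    rw [b.isPos_iff] at ha
    have := mul_nonneg h (by omega : 0 ≤ b.height θ + 1)
    omega
  · rw [negInd_of_not_isPos ha] at h
    have := mul_le_mul_of_nonneg_right h (by omega : 0 ≤ b.height θ + 1)
    omega

/-- Some affine simple coroot is positive on any given root. -/
lemma exists_pairingIn_nodeIdx_pos (hθ : IsHighestRoot b θ) (a : ι) :
    ∃ i : AffNode b, 0 < P.pairingIn ℤ a (nodeIdx b θ i) := by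
  by_cases ha : b.IsPos a
  · obtain ⟨j, hj, h⟩ := ha.exists_mem_support_pos_pairingIn
    exact ⟨some ⟨j, hj⟩, (P.zero_lt_pairingIn_iff' ℤ).mp h⟩
  · by_contra! h
    have h1 : ∀ j ∈ b.support, P.coroot' a (P.root j) ≤ 0 := by
      intro j hj
      have := h (some ⟨j, hj⟩)
      rw [coroot'_root_eq_pairingIn]
      have h2 : P.pairingIn ℤ j a ≤ 0 := by
        by_contra! h3
        exact absurd ((P.zero_lt_pairingIn_iff' ℤ).mp h3) (not_lt.mpr this)
      exact_mod_cast h2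
    have h2 : ∀ x ∈ AddSubmonoid.closure (P.root '' (b.support : Set ι)), P.coroot' a x ≤ 0 := by
      intro x hx
      induction hx using AddSubmonoid.closure_induction with
      | mem x hx => obtain ⟨i, hi, rfl⟩ := hx; exact h1 i hi
      | zero => simp
      | add x y _ _ hx hy => rw [map_add]; linarith
    have h3 : P.coroot' a (P.root (P.reflectionPerm θ θ)) ≤ 0 := by
      have := h none
      rw [coroot'_root_eq_pairingIn]
      have h2 : P.pairingIn ℤ (nodeIdx b θ none) a ≤ 0 := by
        by_contra! h3
        exact absurd ((P.zero_lt_pairingIn_iff' ℤ).mp h3) (not_lt.mpr this)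
      exact_mod_cast h2
    -- For a negative root, the highest root property at `-a` puts `θ + α_a` in the cone of simple
    -- roots. Its pairing with `a^∨` would then be nonpositive, as is that of `-θ`, while the two
    -- values add up to `2`.
    have h4 := h2 _ (hθ (P.reflectionPerm a a))
    have h5 : P.coroot' a (P.root a) = 2 := by simp
    rw [root_reflectionPerm_same, sub_neg_eq_add, map_add, h5] at h4
    rw [root_reflectionPerm_same, map_neg] at h3
    linarith

/-- Induction on the height of positive affine roots, by affine simple reflections. -/
lemma PosAff.induction (hθ : IsHighestRoot b θ) {p : ι → ℤ → Prop}
    (simple : ∀ i : AffNode b, p (nodeIdx b θ i) (nodeInt b i))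
    (step : ∀ (i : AffNode b) (a : ι) (k : ℤ), PosAff b a k →
      ¬ (a = nodeIdx b θ i ∧ k = nodeInt b i) → 0 < P.pairingIn ℤ a (nodeIdx b θ i) →
      p (P.reflectionPerm (nodeIdx b θ i) a)
        (k - nodeInt b i * P.pairingIn ℤ a (nodeIdx b θ i)) → p a k)
    {a : ι} {k : ℤ} (h : PosAff b a k) : p a k := by
  generalize hn : (affHeight b θ a k).toNat = n
  induction n using Nat.strong_induction_on generalizing a k with
  | _ n ih =>
    -- Unless the root is simple, `r_i` keeps it positive and lowers its positive height by the
    -- positive pairing, so the descent terminates.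
    obtain ⟨i, hi⟩ := exists_pairingIn_nodeIdx_pos hθ a
    by_cases hs : a = nodeIdx b θ i ∧ k = nodeInt b i
    · rw [hs.1, hs.2]; exact simple i
    · have h' := h.reflection hθ i hs
      refine step i a k h hs hi (ih _ ?_ h' rfl)
      have h1 := h.affHeight_pos hθ
      have h2 := h'.affHeight_pos hθ
      rw [affHeight_reflection] at h2 ⊢
      omega

end AffineRoots

end

section

/-! ### The length of a weight and the length of an affine reflection -/

section Length

variable [Fintype ι]

open Classical in
/-- The number of negative roots whose coroots are positive on `μ`. -/
def weightLength (b : P.Base) (μ : M) : ℤ := ∑ a : ι, if 0 < P.coroot' a μ then negInd b a else 0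

open Classical in
/-- The sum of the roots whose coroots are positive on `μ`. -/
def rootSum (P : RootPairing ι ℝ M N) (μ : M) : M :=
  ∑ a : ι, if 0 < P.coroot' a μ then P.root a else 0

/-- The change of the (semi-infinite) length under the reflection in `α_a + k δ` at `μ`. -/
def reflLength (b : P.Base) (μ : M) (a : ι) (k : ℤ) : ℝ :=
  weightLength b (P.reflection a μ) - weightLength b μ + k * P.coroot' a (rootSum P μ)

lemma coroot'_reflection_apply (c a : ι) (μ : M) :
    P.coroot' a (P.reflection c μ) = P.coroot' (P.reflectionPerm c a) μ :=
  P.coroot'_reflection μ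

lemma coroot'_reflectionPerm_reflection (c a : ι) (μ : M) :
    P.coroot' (P.reflectionPerm c a) (P.reflection c μ) = P.coroot' a μ := by
  rw [coroot'_reflection_apply, P.reflectionPerm_self]

lemma coroot'_reflection_self (c : ι) (μ : M) :
    P.coroot' c (P.reflection c μ) = -P.coroot' c μ := by
  rw [coroot'_reflection_apply, coroot'_reflectionPerm_same]

lemma reflection_reflectionPerm_apply (c a : ι) (μ : M) :
    P.reflection (P.reflectionPerm c a) (P.reflection c μ) =
      P.reflection c (P.reflection a μ) := by
  rw [P.reflection_reflectionPerm]
  simp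

lemma sum_reflection {A : Type*} [AddCommMonoid A] (c : ι) (f : ι → A) (μ : M) [∀ x : ℝ, Decidable (0 < x)] :
    (∑ a, if 0 < P.coroot' a (P.reflection c μ) then f a else 0) =
      ∑ a, if 0 < P.coroot' a μ then f (P.reflectionPerm c a) else 0 := by
  rw [← Equiv.sum_comp (P.reflectionPerm c)]
  simp_rw [coroot'_reflectionPerm_reflection]

lemma rootSum_reflection (c : ι) (μ : M) :
    rootSum P (P.reflection c μ) = P.reflection c (rootSum P μ) := by
  classical
  unfold rootSum
  rw [sum_reflection c (fun a => P.root a), map_sum]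
  refine Finset.sum_congr rfl fun a _ => ?_
  split_ifs <;> simp

variable [P.IsCrystallographic] [P.IsReduced] [P.IsRootSystem]

/-- Reindex the count by `r_i` and apply the sign-change formula. The pairings add up to the
`rootSum` term; of `±α_i` exactly one is counted unless the pairing with `μ` vanishes, and this
yields the sign. -/
lemma weightLength_reflection (hθ : IsHighestRoot b θ) (i : AffNode b) (μ : M) :
    (weightLength b (P.reflection (nodeIdx b θ i) μ) : ℝ) = weightLength b μ
      + Real.sign (P.coroot' (nodeIdx b θ i) μ)
      - nodeInt b i * P.coroot' (nodeIdx b θ i) (rootSum P μ) := by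
  classical
  set c := nodeIdx b θ i with hc
  have h1 : weightLength b (P.reflection c μ) =
      ∑ a, if 0 < P.coroot' a μ then negInd b (P.reflectionPerm c a) else 0 :=
    sum_reflection c (fun a => negInd b a) μ
  have h2 : P.coroot' c (rootSum P μ) =
      ∑ a, if 0 < P.coroot' a μ then (P.pairingIn ℤ a c : ℝ) else 0 := by
    unfold rootSum
    rw [map_sum]
    refine Finset.sum_congr rfl fun a _ => ?_
    split_ifs
    · exact coroot'_root_eq_pairingIn a c
    · simp
  have h3 : Real.sign (P.coroot' c μ) = ∑ a, (if 0 < P.coroot' a μ then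
      (if a = c then (1 : ℝ) else 0) - (if a = P.reflectionPerm c c then 1 else 0) else 0) := by
    have : ∀ a, (if 0 < P.coroot' a μ then
      (if a = c then (1 : ℝ) else 0) - (if a = P.reflectionPerm c c then 1 else 0) else 0) =
      (if a = c then (if 0 < P.coroot' c μ then (1 : ℝ) else 0) else 0)
       - (if a = P.reflectionPerm c c then
          (if 0 < P.coroot' (P.reflectionPerm c c) μ then 1 else 0) else 0) := by
      intro a
      by_cases h1 : a = c
      · have h2 : a ≠ P.reflectionPerm c c := by rw [h1]; exact (ne_same P c).symm
        subst h1
        simp only [h2, if_true, if_false, sub_zero]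
      · by_cases h2 : a = P.reflectionPerm c c
        · simp only [h2, ne_same, if_true, if_false]
          split_ifs <;> simp
        · simp [h1, h2]
    rw [Finset.sum_congr rfl fun a _ => this a, Finset.sum_sub_distrib, Finset.sum_ite_eq',
      Finset.sum_ite_eq', coroot'_reflectionPerm_same]
    simp only [Finset.mem_univ, if_true]
    rcases lt_trichotomy (P.coroot' c μ) 0 with h | h | h
    · rw [Real.sign_of_neg h, if_neg (by linarith), if_pos (by linarith)]; ring
    · rw [h, Real.sign_zero]; simp
    · rw [Real.sign_of_pos h, if_pos h, if_neg (by linarith)]; ring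
  rw [h1, h2, h3]
  unfold weightLength
  push_cast
  rw [Finset.mul_sum, ← Finset.sum_add_distrib, ← Finset.sum_sub_distrib]
  refine Finset.sum_congr rfl fun a _ => ?_
  rw [negInd_reflectionPerm_nodeIdx hθ]
  split_ifs <;> push_cast <;> ring

/-- The formula for `weightLength` is used at `μ` and at `r_a μ`. The new `δ`-coefficient absorbs
the `rootSum` terms, and only the signs survive. This recursion drives both the lower bound and the
characterization of covers. -/
lemma reflLength_reflection (hθ : IsHighestRoot b θ) (i : AffNode b) (μ : M) (a : ι) (k : ℤ) :
    reflLength b (P.reflection (nodeIdx b θ i) μ) (P.reflectionPerm (nodeIdx b θ i) a)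
      (k - nodeInt b i * P.pairingIn ℤ a (nodeIdx b θ i)) = reflLength b μ a k
      + Real.sign (P.coroot' (nodeIdx b θ i) (P.reflection a μ))
      - Real.sign (P.coroot' (nodeIdx b θ i) μ) := by
  unfold reflLength
  rw [reflection_reflectionPerm_apply, weightLength_reflection hθ, weightLength_reflection hθ,
    rootSum_reflection, rootSum_reflection, coroot'_reflectionPerm_reflection,
    reflection_apply' P a (rootSum P μ), map_sub, map_smul, coroot'_root_eq_pairingIn]
  push_cast
  simp only [smul_eq_mul]
  ring

lemma reflLength_nodeIdx (hθ : IsHighestRoot b θ) (i : AffNode b) {μ : M}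
    (hμ : 0 < P.coroot' (nodeIdx b θ i) μ) :
    reflLength b μ (nodeIdx b θ i) (nodeInt b i) = 1 := by
  unfold reflLength
  rw [weightLength_reflection hθ, Real.sign_of_pos hμ]
  ring

lemma Real_sign_le_sign {x y : ℝ} (h : x ≤ y) : Real.sign x ≤ Real.sign y := by
  rcases lt_trichotomy x 0 with hx | hx | hx <;> rcases lt_trichotomy y 0 with hy | hy | hy <;>
    first
    | linarith
    | simp [hx, hy, Real.sign_of_neg, Real.sign_of_pos]

/-- Simple affine roots give exactly one. Otherwise choose `i` pairing positively with `a`: then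
`⟨α_i^∨, ·⟩` decreases from `μ` to `r_a μ`, so passing to the reflected, lower root can only
decrease the increment. -/
lemma one_le_reflLength (hθ : IsHighestRoot b θ) {a : ι} {k : ℤ} (h : PosAff b a k) {μ : M}
    (hμ : 0 < P.coroot' a μ) : 1 ≤ reflLength b μ a k := by
  refine h.induction hθ (p := fun a k => ∀ μ, 0 < P.coroot' a μ → 1 ≤ reflLength b μ a k)
    (fun i μ hμ => (reflLength_nodeIdx hθ i hμ).ge) (fun i a k _ _ hi ih μ hμ => ?_) μ hμ
  have h1 := ih (P.reflection (nodeIdx b θ i) μ) (by rwa [coroot'_reflectionPerm_reflection])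
  rw [reflLength_reflection hθ] at h1
  have h2 : P.coroot' (nodeIdx b θ i) (P.reflection a μ) ≤ P.coroot' (nodeIdx b θ i) μ := by
    rw [reflection_apply', map_sub, map_smul, coroot'_root_eq_pairingIn, smul_eq_mul]
    have : (0 : ℝ) < P.pairingIn ℤ a (nodeIdx b θ i) := by exact_mod_cast hi
    nlinarith
  have := Real_sign_le_sign h2
  linarith

end Length

/-! ### The finite Weyl group -/

section Weyl

variable [Fintype ι] [P.IsCrystallographic] [P.IsReduced] [P.IsRootSystem]

open RootPairing

lemma ofIdx_smul (P : RootPairing ι ℝ M N) (a : ι) (x : M) :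
    weylGroup.ofIdx P a • x = P.reflection a x := rfl

lemma weylGroup_smul_root (w : P.weylGroup) (a : ι) :
    w • P.root a = P.root (P.weylGroupToPerm w a) := weylGroup_apply_root P w a

lemma weylGroupToPerm_ofIdx (a c : ι) :
    P.weylGroupToPerm (weylGroup.ofIdx P a) c = P.reflectionPerm a c := rfl

lemma weylGroup_smul_smul (w : P.weylGroup) (t : ℝ) (x : M) : w • t • x = t • w • x :=
  (Equiv.weightHom P (w : Aut P)).map_smul t x

lemma weylGroup_induction {p : P.weylGroup → Prop} (one : p 1)
    (mul : ∀ a w, p w → p (weylGroup.ofIdx P a * w)) (w : P.weylGroup) : p w := by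
  have : ∀ x y : P.weylGroup, p y → p (x * y) := by
    rintro ⟨x, hx⟩
    induction hx using weylGroup.induction with
    | mem i => exact fun y hy => mul i y hy
    | one => intro y hy; rwa [show (⟨1, one_mem _⟩ : P.weylGroup) = 1 from rfl, one_mul]
    | mul x y hx hy ihx ihy =>
      intro z hz
      have : (⟨x * y, mul_mem hx hy⟩ : P.weylGroup) * z = ⟨x, hx⟩ * (⟨y, hy⟩ * z) := by
        rw [← mul_assoc]; rfl
      rw [this]
      exact ihx _ (ihy _ hz)
  simpa using this w 1 one

lemma coroot'_weylGroupToPerm_smul (w : P.weylGroup) (a : ι) (x : M) :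
    P.coroot' (P.weylGroupToPerm w a) (w • x) = P.coroot' a x := by
  induction w using weylGroup_induction generalizing a x with
  | one => simp
  | mul c w ih =>
    rw [map_mul, Equiv.Perm.mul_apply, weylGroupToPerm_ofIdx, mul_smul, ofIdx_smul,
      coroot'_reflectionPerm_reflection, ih]

lemma coroot'_smul (w : P.weylGroup) (a : ι) (x : M) :
    P.coroot' a (w • x) = P.coroot' (P.weylGroupToPerm w⁻¹ a) x := by
  rw [← coroot'_weylGroupToPerm_smul w (P.weylGroupToPerm w⁻¹ a) x, ← Equiv.Perm.mul_apply,
    ← map_mul]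
  simp

lemma smul_reflection (w : P.weylGroup) (a : ι) (x : M) :
    w • P.reflection a x = P.reflection (P.weylGroupToPerm w a) (w • x) := by
  rw [reflection_apply', reflection_apply', smul_sub, weylGroup_smul_smul, weylGroup_smul_root,
    coroot'_weylGroupToPerm_smul]

lemma weylGroup_ext {w w' : P.weylGroup} (h : ∀ x : M, w • x = w' • x) : w = w' := by
  apply Subtype.ext
  apply Equiv.weightHom_injective P
  ext x
  exact h x

lemma weylGroupToPerm_same (w : P.weylGroup) (a : ι) :
    P.weylGroupToPerm w (P.reflectionPerm a a) =
      P.reflectionPerm (P.weylGroupToPerm w a) (P.weylGroupToPerm w a) := by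
  apply P.root.injective
  rw [← weylGroup_smul_root, root_reflectionPerm_same, root_reflectionPerm_same, smul_neg,
    weylGroup_smul_root]

lemma ofIdx_mul_self (a : ι) : weylGroup.ofIdx P a * weylGroup.ofIdx P a = 1 :=
  weylGroup_ext fun x => by simp [mul_smul]

lemma mul_ofIdx (w : P.weylGroup) (a : ι) :
    w * weylGroup.ofIdx P a = weylGroup.ofIdx P (P.weylGroupToPerm w a) * w :=
  weylGroup_ext fun x => by rw [mul_smul, mul_smul, ofIdx_smul, ofIdx_smul, smul_reflection]

/-- A vector on which all simple coroots take the value `1`. -/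
lemma exists_coroot'_eq_one (b : P.Base) : ∃ ρ : M, ∀ i ∈ b.support, P.coroot' i ρ = 1 := by
  obtain ⟨ρ, hρ⟩ := P.toLinearMap.toPerfPair.surjective
    (b.toCoweightBasis.constr ℝ (fun _ => (1 : ℝ)))
  refine ⟨ρ, fun i hi => ?_⟩
  have h := b.toCoweightBasis.constr_basis ℝ (fun _ => (1 : ℝ)) ⟨i, hi⟩
  rw [b.toCoweightBasis_apply, ← hρ] at h
  exact h

lemma rootForm_self_mul_coroot' (a : ι) (x : M) :
    P.RootForm (P.root a) (P.root a) * P.coroot' a x = 2 * P.RootForm (P.root a) x := by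
  have h := congrArg (P.toLinearMap x) (P.rootForm_self_smul_coroot a)
  rw [map_smul, map_nsmul, P.toLinearMap_apply_apply_Polarization, smul_eq_mul, nsmul_eq_mul] at h
  exact_mod_cast h

lemma rootForm_root_self_pos (a : ι) : 0 < P.RootForm (P.root a) (P.root a) :=
  P.rootForm_pos_of_ne_zero (Submodule.subset_span ⟨a, rfl⟩) (P.ne_zero a)

/-- Coroots are not additive in the root, but the invariant form is, and it differs from the coroot
by a positive factor. Sign arguments along sums of simple roots are therefore carried out with the
form. -/
lemma rootForm_root_nonneg_iff (a : ι) (x : M) :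
    0 ≤ P.RootForm (P.root a) x ↔ 0 ≤ P.coroot' a x := by
  have h1 := rootForm_self_mul_coroot' (P := P) a x
  have h2 := rootForm_root_self_pos (P := P) a
  constructor
  · intro h; by_contra! h3; nlinarith [mul_neg_of_pos_of_neg h2 h3]
  · intro h; nlinarith [mul_nonneg h2.le h]

lemma rootForm_root_eq_zero_iff (a : ι) (x : M) :
    P.RootForm (P.root a) x = 0 ↔ P.coroot' a x = 0 := by
  have h1 := rootForm_self_mul_coroot' (P := P) a x
  have h2 := rootForm_root_self_pos (P := P) a
  constructor
  · intro h; rw [h, mul_zero] at h1; exact (mul_eq_zero.mp h1).resolve_left h2.ne'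
  · intro h; rw [h, mul_zero] at h1; linarith

lemma coroot'_nonneg_of_isPos {x : M} (hx : ∀ i ∈ b.support, 0 ≤ P.coroot' i x) {a : ι}
    (ha : b.IsPos a) : 0 ≤ P.coroot' a x := by
  rw [← rootForm_root_nonneg_iff]
  have := root_mem_closure_of_isPos ha
  generalize P.root a = r at this ⊢
  induction this using AddSubmonoid.closure_induction with
  | mem y hy =>
    obtain ⟨i, hi, rfl⟩ := hy
    exact (rootForm_root_nonneg_iff i x).mpr (hx i hi)
  | zero => simp
  | add y z _ _ hy hz => rw [map_add, LinearMap.add_apply]; exact add_nonneg hy hz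

lemma isPos_of_coroot'_pos {x : M} (hx : ∀ i ∈ b.support, 0 ≤ P.coroot' i x) {a : ι}
    (ha : 0 < P.coroot' a x) : b.IsPos a := by
  by_contra h
  have := coroot'_nonneg_of_isPos hx ((isPos_same b a).mpr h)
  rw [coroot'_reflectionPerm_same] at this
  linarith

/-- The form with a dominant `x` is a sum of nonnegative contributions of simple roots; if it
vanishes, only simple roots orthogonal to `x` occur. -/
lemma root_mem_closure_of_coroot'_eq_zero {x : M} (hx : ∀ i ∈ b.support, 0 ≤ P.coroot' i x)
    {a : ι} (ha : b.IsPos a) (h0 : P.coroot' a x = 0) :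
    P.root a ∈ AddSubmonoid.closure (P.root '' {j | j ∈ b.support ∧ P.coroot' j x = 0}) := by
  have key : ∀ y ∈ AddSubmonoid.closure (P.root '' (b.support : Set ι)),
      0 ≤ P.RootForm y x ∧ (P.RootForm y x = 0 →
        y ∈ AddSubmonoid.closure (P.root '' {j | j ∈ b.support ∧ P.coroot' j x = 0})) := by
    intro y hy
    induction hy using AddSubmonoid.closure_induction with
    | mem y hy =>
      obtain ⟨i, hi, rfl⟩ := hy
      refine ⟨(rootForm_root_nonneg_iff i x).mpr (hx i hi), fun h => ?_⟩
      exact AddSubmonoid.subset_closure ⟨i, ⟨hi, (rootForm_root_eq_zero_iff i x).mp h⟩, rfl⟩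
    | zero => simp
    | add y z _ _ hy hz =>
      rw [map_add, LinearMap.add_apply]
      refine ⟨add_nonneg hy.1 hz.1, fun h => ?_⟩
      exact add_mem (hy.2 (by linarith [hy.1, hz.1])) (hz.2 (by linarith [hy.1, hz.1]))
  exact (key _ (root_mem_closure_of_isPos ha)).2 ((rootForm_root_eq_zero_iff a x).mpr h0)

lemma mem_rootsJ_iff {x : M} (hx : ∀ i ∈ b.support, 0 ≤ P.coroot' i x) (a : ι) :
    a ∈ rootsJ b x ↔ P.coroot' a x = 0 := by
  constructor
  · intro h
    rw [← rootForm_root_eq_zero_iff]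
    change P.root a ∈ AddSubgroup.closure _ at h
    generalize P.root a = r at h ⊢
    induction h using AddSubgroup.closure_induction with
    | mem y hy =>
      obtain ⟨i, hi, rfl⟩ := hy
      exact (rootForm_root_eq_zero_iff i x).mpr hi.2
    | zero => simp
    | add y z _ _ hy hz => rw [map_add, LinearMap.add_apply, hy, hz, add_zero]
    | neg y _ hy => rw [map_neg, LinearMap.neg_apply, hy, neg_zero]
  · intro h
    have hle : ∀ y ∈ AddSubmonoid.closure (P.root '' {j | j ∈ b.support ∧ P.coroot' j x = 0}),
        y ∈ AddSubgroup.closure (P.root '' {j | j ∈ b.support ∧ P.coroot' j x = 0}) := fun y hy =>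
      AddSubgroup.le_closure_toAddSubmonoid _ hy
    change P.root a ∈ AddSubgroup.closure _
    by_cases ha : b.IsPos a
    · exact hle _ (root_mem_closure_of_coroot'_eq_zero hx ha h)
    · have := hle _ (root_mem_closure_of_coroot'_eq_zero hx ((isPos_same b a).mpr ha)
        (by rw [coroot'_reflectionPerm_same, h, neg_zero]))
      rw [root_reflectionPerm_same] at this
      exact neg_mem_iff.mp this

/-- For dominant `x`, the roots whose coroots are positive on `x` are precisely the positive roots
outside `Φ_J`. -/
lemma twoRhoSub_eq {x : M} (hx : ∀ i ∈ b.support, 0 ≤ P.coroot' i x) :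
    twoRhoSub b x = rootSum P x := by
  classical
  unfold twoRhoSub rootSum
  rw [Finset.sum_filter, Finset.sum_filter, ← Finset.sum_sub_distrib]
  refine Finset.sum_congr rfl fun a _ => ?_
  rw [mem_rootsJ_iff hx]
  by_cases ha : b.IsPos a
  · have h1 := coroot'_nonneg_of_isPos hx ha
    rcases h1.eq_or_lt with h | h
    · rw [← h]; simp [ha]
    · simp only [ha, h, h.ne', if_true, true_and, if_false, sub_zero]
  · have : ¬ 0 < P.coroot' a x := fun h => ha (isPos_of_coroot'_pos hx h)
    rw [if_neg this]; simp [ha]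

lemma exists_coroot'_eq_intCast {x : M} (hx : ∀ i ∈ b.support, ∃ n : ℤ, P.coroot' i x = n)
    (a : ι) : ∃ n : ℤ, P.coroot' a x = n := by
  have key : ∀ y ∈ AddSubmonoid.closure (P.coroot '' (b.support : Set ι)),
      ∃ n : ℤ, P.toLinearMap x y = n := by
    intro y hy
    induction hy using AddSubmonoid.closure_induction with
    | mem y hy => obtain ⟨i, hi, rfl⟩ := hy; exact hx i hi
    | zero => exact ⟨0, by simp⟩
    | add y z _ _ hy hz =>
      obtain ⟨m, hm⟩ := hy
      obtain ⟨n, hn⟩ := hz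
      exact ⟨m + n, by rw [map_add, hm, hn]; push_cast; rfl⟩
  rcases b.coroot_mem_or_neg_mem a with h | h
  · exact key _ h
  · obtain ⟨n, hn⟩ := key _ h
    refine ⟨-n, ?_⟩
    rw [map_neg] at hn
    push_cast
    rw [← hn, neg_neg]; rfl

/-! ### Lengths in the finite Weyl group -/

/-- The number of positive roots that `w` makes negative. -/
def invLength (b : P.Base) (w : P.weylGroup) : ℤ := by
  classical exact ∑ a : ι, if b.IsPos a then negInd b (P.weylGroupToPerm w a) else 0

lemma weightLength_smul (b : P.Base) (w : P.weylGroup) (x : M) [∀ x : ℝ, Decidable (0 < x)] :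
    weightLength b (w • x) =
      ∑ a, if 0 < P.coroot' a x then negInd b (P.weylGroupToPerm w a) else 0 := by
  unfold weightLength
  rw [← Equiv.sum_comp (P.weylGroupToPerm w)]
  refine Finset.sum_congr rfl fun a _ => ?_
  simp_rw [coroot'_weylGroupToPerm_smul]

lemma coroot'_pos_iff_isPos {ρ : M} (hρ : ∀ i ∈ b.support, P.coroot' i ρ = 1) (a : ι) :
    0 < P.coroot' a ρ ↔ b.IsPos a := by
  have h0 : ∀ i ∈ b.support, 0 ≤ P.coroot' i ρ := fun i hi => by rw [hρ i hi]; norm_num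
  have key : ∀ a, b.IsPos a → 0 < P.coroot' a ρ := by
    intro a ha
    refine (coroot'_nonneg_of_isPos h0 ha).lt_of_ne fun h => ?_
    have h1 := root_mem_closure_of_coroot'_eq_zero h0 ha h.symm
    have h2 : {j | j ∈ b.support ∧ P.coroot' j ρ = 0} = (∅ : Set ι) := by
      ext j
      simp only [Set.mem_ofPred_eq, Set.mem_empty_iff_false, iff_false, not_and]
      intro hj; rw [hρ j hj]; norm_num
    rw [h2, Set.image_empty, AddSubmonoid.closure_empty, AddSubmonoid.mem_bot] at h1
    exact P.ne_zero a h1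
  exact ⟨isPos_of_coroot'_pos h0, key a⟩

/-- Since `ρ` is regular and dominant, inversion counts in the Weyl group are a special case of the
length of weights, and the reflection formulas above apply to them. -/
lemma invLength_eq_weightLength {ρ : M} (hρ : ∀ i ∈ b.support, P.coroot' i ρ = 1)
    (w : P.weylGroup) : invLength b w = weightLength b (w • ρ) := by
  classical
  rw [weightLength_smul, invLength]
  refine Finset.sum_congr rfl fun a _ => ?_
  simp_rw [coroot'_pos_iff_isPos hρ]

lemma invLength_one (b : P.Base) : invLength b (1 : P.weylGroup) = 0 := by
  unfold invLength
  refine Finset.sum_eq_zero fun a _ => ?_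
  split_ifs with h
  · rw [map_one, Equiv.Perm.one_apply, negInd_of_isPos h]
  · rfl

lemma invLength_ofIdx_mul_of_isPos (hθ : IsHighestRoot b θ) {i : ι} (hi : i ∈ b.support)
    {w : P.weylGroup} (h : b.IsPos (P.weylGroupToPerm w⁻¹ i)) :
    invLength b (weylGroup.ofIdx P i * w) = invLength b w + 1 := by
  obtain ⟨ρ, hρ⟩ := exists_coroot'_eq_one b
  rw [invLength_eq_weightLength hρ, invLength_eq_weightLength hρ, mul_smul, ofIdx_smul]
  have := weightLength_reflection hθ (some ⟨i, hi⟩) (w • ρ)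
  simp only [nodeIdx, nodeInt] at this
  rw [Real.sign_of_pos (by rwa [coroot'_smul, coroot'_pos_iff_isPos hρ])] at this
  push_cast at this
  rw [zero_mul, sub_zero] at this
  exact_mod_cast this

lemma invLength_ofIdx_mul_of_not_isPos (hθ : IsHighestRoot b θ) {i : ι} (hi : i ∈ b.support)
    {w : P.weylGroup} (h : ¬ b.IsPos (P.weylGroupToPerm w⁻¹ i)) :
    invLength b (weylGroup.ofIdx P i * w) + 1 = invLength b w := by
  have := invLength_ofIdx_mul_of_isPos hθ hi (w := weylGroup.ofIdx P i * w) (by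
    rw [mul_inv_rev, map_mul, Equiv.Perm.mul_apply, inv_eq_of_mul_eq_one_left (ofIdx_mul_self i),
      weylGroupToPerm_ofIdx, weylGroupToPerm_same, isPos_same]
    exact h)
  rw [← this, ← mul_assoc, ofIdx_mul_self, one_mul]

/-- This is the lower bound on `reflLength` at `w ρ` with `δ`-coefficient zero. -/
lemma invLength_lt_mul_ofIdx (hθ : IsHighestRoot b θ) {a : ι} (ha : b.IsPos a)
    {w : P.weylGroup} (h : b.IsPos (P.weylGroupToPerm w a)) :
    invLength b w + 1 ≤ invLength b (w * weylGroup.ofIdx P a) := by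
  obtain ⟨ρ, hρ⟩ := exists_coroot'_eq_one b
  rw [invLength_eq_weightLength hρ, invLength_eq_weightLength hρ, mul_smul, ofIdx_smul,
    smul_reflection]
  have := one_le_reflLength hθ (k := 0) (negInd_of_isPos h).le (μ := w • ρ)
    (by rwa [coroot'_weylGroupToPerm_smul, coroot'_pos_iff_isPos hρ])
  unfold reflLength at this
  rw [Int.cast_zero, zero_mul, add_zero] at this
  have h2 : ((weightLength b (w • ρ) + 1 : ℤ) : ℝ) ≤
      (weightLength b (P.reflection (P.weylGroupToPerm w a) (w • ρ)) : ℤ) := by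
    push_cast; linarith
  exact_mod_cast h2

lemma invLength_mul_ofIdx_lt (hθ : IsHighestRoot b θ) {a : ι} (ha : b.IsPos a)
    {w : P.weylGroup} (h : ¬ b.IsPos (P.weylGroupToPerm w a)) :
    invLength b (w * weylGroup.ofIdx P a) + 1 ≤ invLength b w := by
  have := invLength_lt_mul_ofIdx hθ ha (w := w * weylGroup.ofIdx P a) (by
    rwa [map_mul, Equiv.Perm.mul_apply, weylGroupToPerm_ofIdx, weylGroupToPerm_same, isPos_same])
  rwa [mul_assoc, ofIdx_mul_self, mul_one] at this

/-- The strong exchange condition. -/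
lemma exists_word_ofIdx_mul (l : List P.weylGroup)
    (hl : ∀ s ∈ l, s ∈ {s | ∃ i ∈ b.support, s = weylGroup.ofIdx P i}) {a : ι}
    (ha : b.IsPos a) (h : ¬ b.IsPos (P.weylGroupToPerm (l.prod)⁻¹ a)) :
    ∃ l' : List P.weylGroup, l'.length + 1 = l.length ∧
      (∀ s ∈ l', s ∈ {s | ∃ i ∈ b.support, s = weylGroup.ofIdx P i}) ∧
      l'.prod = weylGroup.ofIdx P a * l.prod := by
  induction l generalizing a with
  | nil => simp [ha] at h
  | cons s t ih =>
    obtain ⟨j, hj, rfl⟩ := hl s (by simp)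
    have ht : ∀ s ∈ t, s ∈ {s | ∃ i ∈ b.support, s = weylGroup.ofIdx P i} :=
      fun s hs => hl s (by simp [hs])
    by_cases haj : a = j
    · exact ⟨t, by simp, ht, by rw [haj, List.prod_cons, ← mul_assoc, ofIdx_mul_self, one_mul]⟩
    · rw [List.prod_cons, mul_inv_rev, inv_eq_of_mul_eq_one_left (ofIdx_mul_self j), map_mul,
        Equiv.Perm.mul_apply, weylGroupToPerm_ofIdx] at h
      obtain ⟨t', h1, h2, h3⟩ := ih ht (ha.reflectionPerm hj haj) h
      refine ⟨weylGroup.ofIdx P j :: t', by simp [h1], ?_, ?_⟩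
      · simp only [List.mem_cons]
        rintro s (rfl | hs)
        · exact ⟨j, hj, rfl⟩
        · exact h2 s hs
      · rw [List.prod_cons, h3, List.prod_cons, ← mul_assoc, mul_ofIdx, weylGroupToPerm_ofIdx,
          P.reflectionPerm_self, mul_assoc]

lemma exists_word (b : P.Base) (w : P.weylGroup) : ∃ l : List P.weylGroup,
    (∀ s ∈ l, s ∈ {s | ∃ i ∈ b.support, s = weylGroup.ofIdx P i}) ∧ l.prod = w := by
  have key : ∀ a, ∃ l : List P.weylGroup,
      (∀ s ∈ l, s ∈ {s | ∃ i ∈ b.support, s = weylGroup.ofIdx P i}) ∧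
      l.prod = weylGroup.ofIdx P a := by
    intro a
    refine b.induction_reflect a (p := fun a => ∃ l : List P.weylGroup,
      (∀ s ∈ l, s ∈ {s | ∃ i ∈ b.support, s = weylGroup.ofIdx P i}) ∧
      l.prod = weylGroup.ofIdx P a) (fun i ⟨l, h1, h2⟩ => ⟨l, h1, ?_⟩)
      (fun i hi => ⟨[weylGroup.ofIdx P i], by simpa using ⟨i, hi, rfl⟩, by simp⟩)
      (fun i j ⟨l, h1, h2⟩ hj => ⟨weylGroup.ofIdx P j :: (l ++ [weylGroup.ofIdx P j]), ?_, ?_⟩)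
    · rw [h2]
      exact weylGroup_ext fun x => by simp [P.reflection_reflectionPerm]
    · simp only [List.mem_cons, List.mem_append, List.not_mem_nil, or_false]
      rintro s (rfl | hs | rfl)
      exacts [⟨j, hj, rfl⟩, h1 s hs, ⟨j, hj, rfl⟩]
    · rw [List.prod_cons, List.prod_append, List.prod_singleton, h2]
      exact weylGroup_ext fun x => by simp [mul_smul, P.reflection_reflectionPerm]
  induction w using weylGroup_induction with
  | one => exact ⟨[], by simp, by simp⟩
  | mul a w ih =>
    obtain ⟨l, h1, h2⟩ := key a
    obtain ⟨l', h3, h4⟩ := ih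
    refine ⟨l ++ l', ?_, by rw [List.prod_append, h2, h4]⟩
    simp only [List.mem_append]
    rintro s (hs | hs)
    exacts [h1 s hs, h3 s hs]

/-- Build a reduced word letter by letter: a letter that raises the inversion count is prepended,
and one that lowers it is absorbed by the strong exchange condition. -/
lemma exists_word_length_eq (hθ : IsHighestRoot b θ) (w : P.weylGroup) : ∃ l : List P.weylGroup,
    (l.length : ℤ) = invLength b w ∧
    (∀ s ∈ l, s ∈ {s | ∃ i ∈ b.support, s = weylGroup.ofIdx P i}) ∧ l.prod = w := by
  obtain ⟨l, hl, rfl⟩ := exists_word b w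
  induction l with
  | nil => exact ⟨[], by simp [invLength_one], by simp, by simp⟩
  | cons s t ih =>
    obtain ⟨j, hj, rfl⟩ := hl s (by simp)
    obtain ⟨l, h1, h2, h3⟩ := ih fun s hs => hl s (by simp [hs])
    rw [List.prod_cons, ← h3]
    by_cases h : b.IsPos (P.weylGroupToPerm (l.prod)⁻¹ j)
    · refine ⟨weylGroup.ofIdx P j :: l, ?_, ?_, by simp⟩
      · rw [invLength_ofIdx_mul_of_isPos hθ hj h, List.length_cons, h3, ← h1]; push_cast; rfl
      · simp only [List.mem_cons]
        rintro s (rfl | hs)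
        exacts [⟨j, hj, rfl⟩, h2 s hs]
    · obtain ⟨l', h4, h5, h6⟩ :=
        exists_word_ofIdx_mul l h2 (RootPairing.Base.isPos_of_mem_support hj) h
      refine ⟨l', ?_, h5, h6⟩
      have := invLength_ofIdx_mul_of_not_isPos hθ hj h
      rw [h3] at this ⊢
      omega

lemma invLength_prod_le (hθ : IsHighestRoot b θ) (l : List P.weylGroup)
    (hl : ∀ s ∈ l, s ∈ {s | ∃ i ∈ b.support, s = weylGroup.ofIdx P i}) :
    invLength b l.prod ≤ l.length := by
  induction l with
  | nil => simp [invLength_one]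
  | cons s t ih =>
    obtain ⟨j, hj, rfl⟩ := hl s (by simp)
    have := ih fun s hs => hl s (by simp [hs])
    rw [List.prod_cons, List.length_cons]
    push_cast
    by_cases h : b.IsPos (P.weylGroupToPerm (t.prod)⁻¹ j)
    · rw [invLength_ofIdx_mul_of_isPos hθ hj h]; omega
    · have := invLength_ofIdx_mul_of_not_isPos hθ hj h
      omega

lemma weylLength_eq_invLength (hθ : IsHighestRoot b θ) (w : P.weylGroup) :
    (weylLength b w : ℤ) = invLength b w := by
  obtain ⟨l, h1, h2, h3⟩ := exists_word_length_eq hθ w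
  unfold weylLength wordLength
  apply le_antisymm
  · rw [← h1]
    exact_mod_cast Nat.sInf_le (s := {n | ∃ l : List P.weylGroup, l.length = n ∧
      (∀ s ∈ l, s ∈ {s | ∃ i ∈ b.support, s = weylGroup.ofIdx P i}) ∧ l.prod = w})
      ⟨l, rfl, h2, h3⟩
  · obtain ⟨l', h4, h5, h6⟩ := Nat.sInf_mem (s := {n | ∃ l : List P.weylGroup, l.length = n ∧
      (∀ s ∈ l, s ∈ {s | ∃ i ∈ b.support, s = weylGroup.ofIdx P i}) ∧ l.prod = w})
      ⟨_, l, rfl, h2, h3⟩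
    rw [← h4, ← h6]
    exact invLength_prod_le hθ l' h5

lemma eq_one_of_forall_isPos (hθ : IsHighestRoot b θ) {w : P.weylGroup}
    (h : ∀ a, b.IsPos a → b.IsPos (P.weylGroupToPerm w a)) : w = 1 := by
  obtain ⟨l, h1, -, h3⟩ := exists_word_length_eq hθ w
  have : invLength b w = 0 := Finset.sum_eq_zero fun a _ => by
    split_ifs with ha
    · exact negInd_of_isPos (h a ha)
    · rfl
  rw [this, Int.natCast_eq_zero, List.length_eq_zero_iff] at h1
  rw [← h3, h1, List.prod_nil]

/-! ### Minimum-length coset representatives -/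

section MinReps

variable {lam : M}

lemma IsDominantIntegral.nonneg (hlam : IsDominantIntegral b lam) :
    ∀ i ∈ b.support, 0 ≤ P.coroot' i lam := fun i hi => by
  obtain ⟨n, hn⟩ := hlam i hi
  rw [hn]; exact Nat.cast_nonneg n

/-- Otherwise multiplying by `r_a`, which stabilizes `lam`, would give a shorter element of the
coset. -/
lemma isPos_of_mem_minReps (hθ : IsHighestRoot b θ) {w : P.weylGroup}
    (hw : w ∈ minReps b lam) {a : ι} (ha : b.IsPos a) (h0 : P.coroot' a lam = 0) :
    b.IsPos (P.weylGroupToPerm w a) := by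
  by_contra h
  have h1 := invLength_mul_ofIdx_lt hθ ha h
  have h2 := hw (weylGroup.ofIdx P a) (by
    change weylGroup.ofIdx P a • lam = lam
    rw [ofIdx_smul, reflection_apply', h0, zero_smul, sub_zero])
  rw [← weylLength_eq_invLength hθ, ← weylLength_eq_invLength hθ] at h1
  omega

lemma weightLength_le_weylLength (hθ : IsHighestRoot b θ) (hlam : IsDominantIntegral b lam)
    (w : P.weylGroup) : weightLength b (w • lam) ≤ weylLength b w := by
  classical
  rw [weylLength_eq_invLength hθ, weightLength_smul, invLength]
  refine Finset.sum_le_sum fun a _ => ?_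
  split_ifs with h1 h2 h2
  · exact le_rfl
  · exact absurd (isPos_of_coroot'_pos hlam.nonneg h1) h2
  · exact negInd_nonneg b _
  · exact le_rfl

/-- A minimal representative has no inversions in `Φ_J`, and the positive roots outside `Φ_J` are
those counted by `weightLength`. -/
lemma weylLength_eq_weightLength (hθ : IsHighestRoot b θ) (hlam : IsDominantIntegral b lam)
    {w : P.weylGroup} (hw : w ∈ minReps b lam) :
    (weylLength b w : ℤ) = weightLength b (w • lam) := by
  classical
  rw [weylLength_eq_invLength hθ, weightLength_smul, invLength]
  refine Finset.sum_congr rfl fun a _ => ?_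
  split_ifs with h1 h2 h2
  · rfl
  · refine negInd_of_isPos (isPos_of_mem_minReps hθ hw h1 ?_)
    exact le_antisymm (not_lt.mp h2) (coroot'_nonneg_of_isPos hlam.nonneg h1)
  · exact absurd (isPos_of_coroot'_pos hlam.nonneg h2) h1
  · rfl

/-- The quotient `w⁻¹ w'` fixes `lam`, so it preserves positivity outside `Φ_J` by the values of the
coroots. On `Φ_J` it does so because both representatives send `Φ_J⁺` to positive roots. An element
without inversions is trivial. -/
lemma minReps_injOn (hθ : IsHighestRoot b θ) (hlam : IsDominantIntegral b lam)
    {w w' : P.weylGroup} (hw : w ∈ minReps b lam) (hw' : w' ∈ minReps b lam)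
    (h : w • lam = w' • lam) : w = w' := by
  have hz : (w⁻¹ * w') • lam = lam := by rw [mul_smul, ← h, inv_smul_smul]
  have : w⁻¹ * w' = 1 := by
    refine eq_one_of_forall_isPos hθ fun a ha => ?_
    have h1 : P.coroot' (P.weylGroupToPerm (w⁻¹ * w') a) lam = P.coroot' a lam := by
      conv_lhs => rw [← hz]
      exact coroot'_weylGroupToPerm_smul _ _ _
    rcases (coroot'_nonneg_of_isPos hlam.nonneg ha).eq_or_lt with h0 | h0
    · by_contra hn
      have h2 := isPos_of_mem_minReps hθ hw ((isPos_same b _).mpr hn)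
        (by rw [coroot'_reflectionPerm_same, h1, ← h0, neg_zero])
      rw [weylGroupToPerm_same, isPos_same, ← Equiv.Perm.mul_apply, ← map_mul,
        mul_inv_cancel_left] at h2
      exact h2 (isPos_of_mem_minReps hθ hw' ha h0.symm)
    · exact isPos_of_coroot'_pos hlam.nonneg (h1 ▸ h0)
  rw [inv_mul_eq_one] at this
  exact this

lemma exists_mem_minReps (b : P.Base) (lam : M) (w : P.weylGroup) :
    ∃ v ∈ minReps b lam, v • lam = w • lam := by
  obtain ⟨v, hv, hmin⟩ := exists_minimalFor_of_wellFoundedLT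
    (fun v : P.weylGroup => v • lam = w • lam) (weylLength b) ⟨w, rfl⟩
  refine ⟨v, fun z hz => ?_, hv⟩
  have hz' : z • lam = lam := hz
  have : (v * z) • lam = w • lam := by rw [mul_smul, hz', hv]
  by_contra! h
  exact absurd (hmin this h.le) (not_le.mpr h)

lemma isFloor_iff {w v : P.weylGroup} :
    IsFloor b lam w v ↔ v ∈ minReps b lam ∧ v • lam = w • lam := by
  unfold IsFloor
  have : w⁻¹ * v ∈ stabJ P lam ↔ v • lam = w • lam := by
    change (w⁻¹ * v) • lam = lam ↔ _
    rw [mul_smul, inv_smul_eq_iff]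
  rw [this]

end MinReps

end Weyl

end

section

/-! ### The level-zero action of the affine Weyl group -/

lemma affSimpleRefl_mul_self (b : P.Base) (θ : ι) (i : AffNode b) :
    affSimpleRefl b θ i * affSimpleRefl b θ i = 1 := by
  ext1 x
  exact Module.involutive_reflection (affSimpleCoroot_affSimpleRoot b θ i) x

lemma affWeylGroup_induction {p : (AffSpace M ≃ₗ[ℝ] AffSpace M) → Prop}
    (simple : ∀ i, p (affSimpleRefl b θ i)) (one : p 1) 
    (mul : ∀ v w, w ∈ affWeylGroup b θ → p v → p w → p (v * w))
    {w : AffSpace M ≃ₗ[ℝ] AffSpace M} (hw : w ∈ affWeylGroup b θ) : p w := by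
  induction hw using Subgroup.closure_induction'' with
  | mem x hx => obtain ⟨i, rfl⟩ := hx; exact simple i
  | inv_mem x hx =>
    obtain ⟨i, rfl⟩ := hx
    rw [inv_eq_of_mul_eq_one_left (affSimpleRefl_mul_self b θ i)]; exact simple i
  | one => exact one
  | mul x y _ hy' hx hy => exact mul x y hy' hx hy

lemma affSimpleRefl_mem (b : P.Base) (θ : ι) (i : AffNode b) :
    affSimpleRefl b θ i ∈ affWeylGroup b θ := Subgroup.subset_closure ⟨i, rfl⟩

lemma exists_affWeylGroup_apply_levelZero {w : AffSpace M ≃ₗ[ℝ] AffSpace M}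
    (hw : w ∈ affWeylGroup b θ) :
    ∀ x n, ∃ (v : P.weylGroup) (n' : ℝ), w (x, 0, n) = (v • x, 0, n') := by
  refine affWeylGroup_induction (b := b) (θ := θ)
    (p := fun w => ∀ x n, ∃ (v : P.weylGroup) (n' : ℝ), w (x, 0, n) = (v • x, 0, n'))
    (fun i x n => ?_) (fun x n => ?_) (fun v w _ hv hw x n => ?_) hw
  · exact ⟨RootPairing.weylGroup.ofIdx P (nodeIdx b θ i), _, affSimpleRefl_levelZero b θ i x n⟩
  · exact ⟨1, n, by simp⟩
  · obtain ⟨v1, n1, h1⟩ := hw x n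
    obtain ⟨v2, n2, h2⟩ := hv (v1 • x) n1
    exact ⟨v2 * v1, n2, by rw [LinearEquiv.mul_apply, h1, h2, mul_smul]⟩

lemma exists_affWeylGroup_apply_root [P.IsCrystallographic] {w : AffSpace M ≃ₗ[ℝ] AffSpace M}
    (hw : w ∈ affWeylGroup b θ) : ∀ (a : ι) (k : ℤ), ∃ (a' : ι) (k' : ℤ),
      w (P.root a, 0, (k : ℝ)) = (P.root a', 0, (k' : ℝ)) ∧
      ∀ (x : M) (n : ℝ), P.coroot' a' (w (x, 0, n)).1 = P.coroot' a x := by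
  refine affWeylGroup_induction (b := b) (θ := θ) (p := fun w => ∀ (a : ι) (k : ℤ),
      ∃ (a' : ι) (k' : ℤ), w (P.root a, 0, (k : ℝ)) = (P.root a', 0, (k' : ℝ)) ∧
      ∀ (x : M) (n : ℝ), P.coroot' a' (w (x, 0, n)).1 = P.coroot' a x)
    (fun i a k => ?_) (fun a k => ?_) (fun v w hw' hv hw a k => ?_) hw
  · refine ⟨P.reflectionPerm (nodeIdx b θ i) a,
      k - nodeInt b i * P.pairingIn ℤ a (nodeIdx b θ i), ?_, fun x n => ?_⟩
    · rw [affSimpleRefl_levelZero, coroot'_root_eq_pairingIn, P.root_reflectionPerm]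
      push_cast; rfl
    · rw [affSimpleRefl_levelZero]
      rw [P.coroot'_reflectionPerm]; simp
  · exact ⟨a, k, by simp, by simp⟩
  · obtain ⟨a1, k1, h1, h1'⟩ := hw a k
    obtain ⟨a2, k2, h2, h2'⟩ := hv a1 k1
    refine ⟨a2, k2, by rw [LinearEquiv.mul_apply, h1, h2], fun x n => ?_⟩
    obtain ⟨u, n', hu⟩ := exists_affWeylGroup_apply_levelZero hw' x n
    rw [LinearEquiv.mul_apply, ← h1' x n, hu, h2']

lemma exists_eq_of_mem_orbit {lam : M} {μ : AffSpace M} (h : μ ∈ orbit b θ lam) :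
    ∃ (w : P.weylGroup) (n : ℝ), μ = (w • lam, 0, n) := by
  obtain ⟨w, hw, rfl⟩ := h
  exact exists_affWeylGroup_apply_levelZero hw lam 0

section

variable [Fintype ι] [P.IsCrystallographic] [P.IsReduced] [P.IsRootSystem]

lemma heightForm_add_eq_affHeight (b : P.Base) (θ : ι) (a : ι) (k : ℤ) :
    heightForm b (P.root a) + (b.height θ + 1) * k = affHeight b θ a k := by
  rw [heightForm_root, affHeight]; push_cast; ring

/-- The affine height is nonnegative on the cone. If `α_a + k δ` were not positive, its negative
would be, forcing a negative height. -/
lemma posAff_of_mem_closure (hθ : IsHighestRoot b θ) {a : ι} {k : ℤ}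
    (h : (P.root a, (0 : ℝ), (k : ℝ)) ∈ AddSubmonoid.closure (Set.range (affSimpleRoot b θ))) :
    PosAff b a k := by
  have key : ∀ x ∈ AddSubmonoid.closure (Set.range (affSimpleRoot b θ)),
      0 ≤ heightForm b x.1 + (b.height θ + 1) * x.2.2 := by
    intro x hx
    induction hx using AddSubmonoid.closure_induction with
    | mem x hx =>
      obtain ⟨i, rfl⟩ := hx
      rw [affSimpleRoot_eq]
      have := heightForm_add_eq_affHeight b θ (nodeIdx b θ i) (nodeInt b i)
      rw [this]
      exact_mod_cast ((posAff_nodeIdx hθ i).affHeight_pos hθ).le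
    | zero => simp
    | add x y _ _ hx hy =>
      simp only [Prod.fst_add, Prod.snd_add, map_add]; linarith
  have h1 := key _ h
  rw [heightForm_add_eq_affHeight] at h1
  by_contra hn
  have h2 : PosAff b (P.reflectionPerm a a) (-k) := by
    unfold PosAff at hn ⊢
    rw [negInd_same]; omega
  have h3 := h2.affHeight_pos hθ
  have h4 : affHeight b θ (P.reflectionPerm a a) (-k) = -affHeight b θ a k := by
    unfold affHeight; rw [height_same]; ring
  have h5 : (0 : ℤ) ≤ affHeight b θ a k := by exact_mod_cast h1
  omega

/-- A positive affine real root is some `α_a + k δ`, with coroot restricting to `α_a^∨`. -/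
lemma IsPosAffRoot.exists_posAff (hθ : IsHighestRoot b θ) {β : AffSpace M}
    {βv : Module.Dual ℝ (AffSpace M)} (h : IsPosAffRoot b θ β βv) :
    ∃ (a : ι) (k : ℤ), PosAff b a k ∧ β = (P.root a, 0, (k : ℝ)) ∧
      ∀ (x : M) (n : ℝ), βv (x, 0, n) = P.coroot' a x := by
  obtain ⟨⟨w, hw, i, rfl, hv⟩, hcl⟩ := h
  obtain ⟨a, k, h1, h2⟩ := exists_affWeylGroup_apply_root hw (nodeIdx b θ i) (nodeInt b i)
  rw [affSimpleRoot_eq] at hcl ⊢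
  rw [h1] at hcl
  refine ⟨a, k, posAff_of_mem_closure hθ hcl, h1, fun x n => ?_⟩
  obtain ⟨v, n', hx⟩ := exists_affWeylGroup_apply_levelZero (inv_mem hw) x n
  rw [hv, hx, affSimpleCoroot_levelZero, ← h2 _ n', ← hx, ← LinearEquiv.mul_apply, mul_inv_cancel]
  rfl

/-- The height induction is run upwards: undoing the reflection in `α_i` adds a positive multiple of
`α_i`, so membership in the cone persists. -/
lemma PosAff.exists_affWeylGroup (hθ : IsHighestRoot b θ) {a : ι} {k : ℤ} (h : PosAff b a k) :
    (∃ w ∈ affWeylGroup b θ, ∃ i : AffNode b,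
      (P.root a, (0 : ℝ), (k : ℝ)) = w (affSimpleRoot b θ i)) ∧
    (P.root a, (0 : ℝ), (k : ℝ)) ∈ AddSubmonoid.closure (Set.range (affSimpleRoot b θ)) := by
  refine h.induction hθ (p := fun a k => (∃ w ∈ affWeylGroup b θ, ∃ i : AffNode b,
      (P.root a, (0 : ℝ), (k : ℝ)) = w (affSimpleRoot b θ i)) ∧
    (P.root a, (0 : ℝ), (k : ℝ)) ∈ AddSubmonoid.closure (Set.range (affSimpleRoot b θ)))
    (fun i => ?_) (fun i a k _ _ hi ih => ?_)
  · rw [← affSimpleRoot_eq]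
    exact ⟨⟨1, one_mem _, i, rfl⟩, AddSubmonoid.subset_closure ⟨i, rfl⟩⟩
  · have h1 : (P.root (P.reflectionPerm (nodeIdx b θ i) a), (0 : ℝ),
        ((k - nodeInt b i * P.pairingIn ℤ a (nodeIdx b θ i) : ℤ) : ℝ)) =
        affSimpleRefl b θ i (P.root a, 0, (k : ℝ)) := by
      rw [affSimpleRefl_levelZero, P.root_reflectionPerm, coroot'_root_eq_pairingIn]
      push_cast; rfl
    rw [h1] at ih
    obtain ⟨⟨w, hw, j, hj⟩, h2⟩ := ih
    refine ⟨⟨affSimpleRefl b θ i * w, mul_mem (affSimpleRefl_mem b θ i) hw, j, ?_⟩, ?_⟩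
    · rw [LinearEquiv.mul_apply, ← hj, ← LinearEquiv.mul_apply, affSimpleRefl_mul_self]; rfl
    · have h3 : (P.root a, (0 : ℝ), (k : ℝ)) = affSimpleRefl b θ i (P.root a, 0, (k : ℝ)) +
          (P.pairingIn ℤ a (nodeIdx b θ i)).toNat • affSimpleRoot b θ i := by
        have h4 : (((P.pairingIn ℤ a (nodeIdx b θ i)).toNat : ℤ) : ℝ) =
          (P.pairingIn ℤ a (nodeIdx b θ i) : ℝ) := by rw [Int.toNat_of_nonneg hi.le]
        rw [affSimpleRefl, Module.reflection_apply, affSimpleCoroot_levelZero,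
          coroot'_root_eq_pairingIn, ← Nat.cast_smul_eq_nsmul ℝ, ← h4, Int.cast_natCast,
          sub_add_cancel]
      rw [h3]
      exact add_mem h2 (nsmul_mem (AddSubmonoid.subset_closure (Set.mem_range_self i)) _)

/-- The reflection in `α_a + k δ` on the level-zero part. -/
def affRefl (P : RootPairing ι ℝ M N) (a : ι) (k : ℤ) (μ : AffSpace M) : AffSpace M :=
  μ - P.coroot' a μ.1 • (P.root a, 0, (k : ℝ))

lemma affRefl_fst (a : ι) (k : ℤ) (μ : AffSpace M) :
    (affRefl P a k μ).1 = P.reflection a μ.1 := by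
  simp [affRefl, P.reflection_apply]

lemma PosAff.exists_isPosAffRoot (hθ : IsHighestRoot b θ) {a : ι} {k : ℤ} (h : PosAff b a k) :
    ∃ βv : Module.Dual ℝ (AffSpace M), IsPosAffRoot b θ (P.root a, 0, (k : ℝ)) βv ∧
      ∀ (x : M) (n : ℝ), βv (x, 0, n) = P.coroot' a x := by
  obtain ⟨⟨w, hw, i, h1⟩, h2⟩ := h.exists_affWeylGroup hθ
  have h3 : IsPosAffRoot b θ (P.root a, 0, (k : ℝ))
      (affSimpleCoroot b θ i ∘ₗ (w⁻¹ : AffSpace M ≃ₗ[ℝ] AffSpace M).toLinearMap) :=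
    ⟨⟨w, hw, i, h1, fun μ => rfl⟩, h2⟩
  refine ⟨_, h3, fun x n => ?_⟩
  obtain ⟨a', k', -, h5, h6⟩ := IsPosAffRoot.exists_posAff hθ h3
  rw [h6 x n, P.root.injective (congrArg Prod.fst h5)]

lemma IsPosAffRoot.sub_mem_orbit {β : AffSpace M} {βv : Module.Dual ℝ (AffSpace M)}
    (h : IsPosAffRoot b θ β βv) {lam : M} {μ : AffSpace M} (hμ : μ ∈ orbit b θ lam) :
    μ - βv μ • β ∈ orbit b θ lam := by
  obtain ⟨⟨w, hw, i, rfl, hv⟩, -⟩ := h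
  obtain ⟨u, hu, rfl⟩ := hμ
  refine ⟨w * affSimpleRefl b θ i * w⁻¹ * u, mul_mem (mul_mem (mul_mem hw
    (affSimpleRefl_mem b θ i)) (inv_mem hw)) hu, ?_⟩
  simp only [LinearEquiv.mul_apply]
  rw [hv, affSimpleRefl, Module.reflection_apply, map_sub, map_smul]
  congr 1
  rw [← LinearEquiv.mul_apply, mul_inv_cancel]; rfl

lemma affRefl_mem_orbit (hθ : IsHighestRoot b θ) {a : ι} {k : ℤ} (h : PosAff b a k) {lam : M}
    {μ : AffSpace M} (hμ : μ ∈ orbit b θ lam) : affRefl P a k μ ∈ orbit b θ lam := by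
  obtain ⟨βv, h1, h2⟩ := h.exists_isPosAffRoot hθ
  have := h1.sub_mem_orbit hμ
  obtain ⟨w, n, rfl⟩ := exists_eq_of_mem_orbit hμ
  rwa [h2] at this

/-- The generating relation of the level-zero weight poset. -/
def AffStep (b : P.Base) (μ ν : AffSpace M) : Prop :=
  ∃ (a : ι) (k : ℤ), PosAff b a k ∧ 0 < P.coroot' a μ.1 ∧ ν = affRefl P a k μ

lemma ReflLT.exists_posAff (hθ : IsHighestRoot b θ) {lam : M} {β : AffSpace M}
    {βv : Module.Dual ℝ (AffSpace M)} {μ ν : AffSpace M} (h : ReflLT b θ lam β βv μ ν) :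
    ∃ (a : ι) (k : ℤ), PosAff b a k ∧ β = (P.root a, 0, (k : ℝ)) ∧ 0 < P.coroot' a μ.1 ∧
      ν = affRefl P a k μ ∧ βv μ = P.coroot' a μ.1 ∧ βv ν = -P.coroot' a μ.1 := by
  obtain ⟨a, k, h1, h2, h3⟩ := h.root.exists_posAff hθ
  obtain ⟨w, n, hw⟩ := exists_eq_of_mem_orbit h.left_mem
  obtain ⟨w', n', hw'⟩ := exists_eq_of_mem_orbit h.right_mem
  have h4 : βv μ = P.coroot' a μ.1 := by rw [hw, h3]
  have h5 : ν = affRefl P a k μ := by rw [h.eq_refl, h4, h2]; rfl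
  refine ⟨a, k, h1, h2, h4 ▸ h.pos, h5, h4, ?_⟩
  have h6 : βv ν = P.coroot' a ν.1 := by rw [hw', h3]
  rw [h6, h5, affRefl_fst, coroot'_reflection_self]

lemma exists_reflLT (hθ : IsHighestRoot b θ) {lam : M} {μ : AffSpace M} (hμ : μ ∈ orbit b θ lam)
    {a : ι} {k : ℤ} (h : PosAff b a k) (hp : 0 < P.coroot' a μ.1) :
    ∃ βv, ReflLT b θ lam (P.root a, 0, (k : ℝ)) βv μ (affRefl P a k μ) := by
  obtain ⟨βv, h1, h2⟩ := h.exists_isPosAffRoot hθ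
  have h3 : βv μ = P.coroot' a μ.1 := by
    obtain ⟨w, n, rfl⟩ := exists_eq_of_mem_orbit hμ
    rw [h2]
  exact ⟨βv, hμ, affRefl_mem_orbit hθ h hμ, h1, by rw [h3]; rfl, h3 ▸ hp⟩

/-- The order of the level-zero weight poset. -/
def AffLT (b : P.Base) : AffSpace M → AffSpace M → Prop := Relation.TransGen (AffStep b)

/-- Reflections preserve the orbit, so the orbit conditions along a chain reduce to the one at its
bottom. From here on the order is handled through pairs `(a, k)` instead of abstract affine roots.
-/
lemma weightLT_iff (hθ : IsHighestRoot b θ) {lam : M} {μ ν : AffSpace M} :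
    WeightLT b θ lam μ ν ↔ μ ∈ orbit b θ lam ∧ AffLT b μ ν := by
  constructor
  · intro h
    induction h using Relation.TransGen.head_induction_on with
    | single h =>
      obtain ⟨β, βv, h⟩ := h
      obtain ⟨a, k, h1, -, h3, h4, -⟩ := h.exists_posAff hθ
      exact ⟨h.left_mem, .single ⟨a, k, h1, h3, h4⟩⟩
    | head h _ ih =>
      obtain ⟨β, βv, h⟩ := h
      obtain ⟨a, k, h1, -, h3, h4, -⟩ := h.exists_posAff hθ
      exact ⟨h.left_mem, .head ⟨a, k, h1, h3, h4⟩ ih.2⟩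
  · rintro ⟨hμ, h⟩
    induction h using Relation.TransGen.head_induction_on with
    | single h =>
      obtain ⟨a, k, h1, h3, rfl⟩ := h
      obtain ⟨βv, h⟩ := exists_reflLT hθ hμ h1 h3
      exact .single ⟨_, _, h⟩
    | head h _ ih =>
      obtain ⟨a, k, h1, h3, rfl⟩ := h
      obtain ⟨βv, h⟩ := exists_reflLT hθ hμ h1 h3
      exact .head ⟨_, _, h⟩ (ih h.right_mem)

/-! ### Diamond lemmas and covers -/

lemma AffLT.mem_orbit (hθ : IsHighestRoot b θ) {lam : M} {μ ν : AffSpace M} (h : AffLT b μ ν)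
    (hμ : μ ∈ orbit b θ lam) : ν ∈ orbit b θ lam := by
  induction h with
  | single h => obtain ⟨a, k, h1, -, rfl⟩ := h; exact affRefl_mem_orbit hθ h1 hμ
  | tail _ h ih => obtain ⟨a, k, h1, -, rfl⟩ := h; exact affRefl_mem_orbit hθ h1 ih

/-- A step upward subtracts a positive multiple of a positive affine root, so the affine height
strictly falls; this is what excludes cycles. -/
lemma AffLT.height_lt (hθ : IsHighestRoot b θ) {μ ν : AffSpace M} (h : AffLT b μ ν) :
    heightForm b ν.1 + (b.height θ + 1) * ν.2.2 < heightForm b μ.1 + (b.height θ + 1) * μ.2.2 := by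
  have step : ∀ μ ν, AffStep b μ ν → heightForm b ν.1 + (b.height θ + 1) * ν.2.2 <
      heightForm b μ.1 + (b.height θ + 1) * μ.2.2 := by
    rintro μ ν ⟨a, k, h1, h2, rfl⟩
    have h3 : (0 : ℝ) < affHeight b θ a k := by exact_mod_cast h1.affHeight_pos hθ
    rw [← heightForm_add_eq_affHeight] at h3
    simp only [affRefl, Prod.fst_sub, Prod.snd_sub, Prod.smul_fst, Prod.smul_snd, map_sub,
      map_smul, smul_eq_mul]
    nlinarith [mul_pos h2 h3]
  induction h with
  | single h => exact step _ _ h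
  | tail _ h ih => exact (step _ _ h).trans ih

lemma AffLT.irrefl (hθ : IsHighestRoot b θ) (μ : AffSpace M) : ¬ AffLT b μ μ :=
  fun h => lt_irrefl _ (h.height_lt hθ)

/-- The affine simple reflections on the level-zero part. -/
def nodeRefl (b : P.Base) (θ : ι) (i : AffNode b) : AffSpace M → AffSpace M :=
  affRefl P (nodeIdx b θ i) (nodeInt b i)

lemma nodeRefl_fst (i : AffNode b) (μ : AffSpace M) :
    (nodeRefl b θ i μ).1 = P.reflection (nodeIdx b θ i) μ.1 := affRefl_fst _ _ _

lemma coroot'_nodeRefl (i : AffNode b) (μ : AffSpace M) :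
    P.coroot' (nodeIdx b θ i) (nodeRefl b θ i μ).1 = -P.coroot' (nodeIdx b θ i) μ.1 := by
  rw [nodeRefl_fst, coroot'_reflection_self]

lemma nodeRefl_nodeRefl (i : AffNode b) (μ : AffSpace M) :
    nodeRefl b θ i (nodeRefl b θ i μ) = μ := by
  have h := coroot'_nodeRefl (b := b) (θ := θ) i μ
  rw [nodeRefl] at h ⊢
  rw [affRefl, h, affRefl]
  module

lemma nodeRefl_affRefl (i : AffNode b) (a : ι) (k : ℤ) (μ : AffSpace M) :
    nodeRefl b θ i (affRefl P a k μ) = affRefl P (P.reflectionPerm (nodeIdx b θ i) a)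
      (k - nodeInt b i * P.pairingIn ℤ a (nodeIdx b θ i)) (nodeRefl b θ i μ) := by
  have h1 : P.coroot' (P.reflectionPerm (nodeIdx b θ i) a) (nodeRefl b θ i μ).1 =
      P.coroot' a μ.1 := by
    rw [nodeRefl_fst, coroot'_reflectionPerm_reflection]
  rw [affRefl, affRefl, h1, nodeRefl, affRefl, affRefl, P.root_reflectionPerm,
    reflection_apply', coroot'_root_eq_pairingIn]
  simp only [Prod.fst_sub, Prod.smul_fst, map_sub, map_smul, coroot'_root_eq_pairingIn]
  ext
  · simp; module
  · simp
  · simp; ring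

lemma affStep_nodeRefl (hθ : IsHighestRoot b θ) (i : AffNode b) {μ : AffSpace M}
    (h : 0 < P.coroot' (nodeIdx b θ i) μ.1) : AffStep b μ (nodeRefl b θ i μ) :=
  ⟨_, _, posAff_nodeIdx hθ i, h, rfl⟩

lemma nodeRefl_eq_self (i : AffNode b) {μ : AffSpace M}
    (h : P.coroot' (nodeIdx b θ i) μ.1 = 0) : nodeRefl b θ i μ = μ := by
  rw [nodeRefl, affRefl, h, zero_smul, sub_zero]

lemma le_nodeRefl (hθ : IsHighestRoot b θ) (i : AffNode b) {μ : AffSpace M}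
    (h : 0 ≤ P.coroot' (nodeIdx b θ i) μ.1) :
    Relation.ReflTransGen (AffStep b) μ (nodeRefl b θ i μ) := by
  rcases h.eq_or_lt with h | h
  · rw [nodeRefl_eq_self i h.symm]
  · exact .single (affStep_nodeRefl hθ i h)

lemma nodeRefl_lt (hθ : IsHighestRoot b θ) (i : AffNode b) {μ : AffSpace M}
    (h : P.coroot' (nodeIdx b θ i) μ.1 < 0) : AffLT b (nodeRefl b θ i μ) μ := by
  have := affStep_nodeRefl hθ i (μ := nodeRefl b θ i μ) (by rw [coroot'_nodeRefl]; linarith)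
  rw [nodeRefl_nodeRefl] at this
  exact .single this

lemma AffStep.nodeRefl_of_ne (hθ : IsHighestRoot b θ) (i : AffNode b) {μ : AffSpace M} {a : ι}
    {k : ℤ} (h : PosAff b a k) (hp : 0 < P.coroot' a μ.1)
    (hne : ¬ (a = nodeIdx b θ i ∧ k = nodeInt b i)) :
    AffStep b (nodeRefl b θ i μ) (nodeRefl b θ i (affRefl P a k μ)) :=
  ⟨_, _, h.reflection hθ i hne, by rwa [nodeRefl_fst, coroot'_reflectionPerm_reflection],
    nodeRefl_affRefl i a k μ⟩

/-- The diamond property: `r_i` permutes the positive affine roots other than `α_i`, so it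
transports every step except the one along `α_i`. -/
lemma AffStep.nodeRefl (hθ : IsHighestRoot b θ) (i : AffNode b) {μ ν : AffSpace M}
    (h : AffStep b μ ν) :
    ν = nodeRefl b θ i μ ∨ AffStep b (nodeRefl b θ i μ) (nodeRefl b θ i ν) := by
  obtain ⟨a, k, h1, h2, rfl⟩ := h
  by_cases hne : a = nodeIdx b θ i ∧ k = nodeInt b i
  · left; rw [hne.1, hne.2]; rfl
  · exact Or.inr (AffStep.nodeRefl_of_ne hθ i h1 h2 hne)

lemma AffLT.nodeRefl_left (hθ : IsHighestRoot b θ) (i : AffNode b) {μ ν : AffSpace M}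
    (h : AffLT b μ ν) : Relation.ReflTransGen (AffStep b) (nodeRefl b θ i μ) ν ∨
      AffLT b (nodeRefl b θ i μ) (nodeRefl b θ i ν) := by
  induction h using Relation.TransGen.head_induction_on with
  | single h =>
    rcases h.nodeRefl hθ i with rfl | h
    · exact Or.inl .refl
    · exact Or.inr (.single h)
  | head h h' ih =>
    rcases h.nodeRefl hθ i with rfl | h
    · exact Or.inl h'.to_reflTransGen
    · exact ih.imp (fun h'' => .head h h'') (fun h'' => .head h h'')

lemma AffLT.nodeRefl_right (hθ : IsHighestRoot b θ) (i : AffNode b) {μ ν : AffSpace M}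
    (h : AffLT b μ ν) : Relation.ReflTransGen (AffStep b) μ (nodeRefl b θ i ν) ∨
      AffLT b (nodeRefl b θ i μ) (nodeRefl b θ i ν) := by
  induction h with
  | single h =>
    rcases h.nodeRefl hθ i with rfl | h
    · rw [nodeRefl_nodeRefl]; exact Or.inl .refl
    · exact Or.inr (.single h)
  | tail h' h ih =>
    rcases h.nodeRefl hθ i with rfl | h
    · rw [nodeRefl_nodeRefl]; exact Or.inl h'.to_reflTransGen
    · exact ih.imp (fun h'' => .tail h'' h) (fun h'' => .tail h'' h)

/-- There is no element strictly between `μ` and `ν`. -/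
def NoBetween (b : P.Base) (μ ν : AffSpace M) : Prop := ¬ ∃ κ, AffLT b μ κ ∧ AffLT b κ ν

lemma noBetween_nodeRefl_self (hθ : IsHighestRoot b θ) (i : AffNode b) {μ : AffSpace M}
    (h : 0 < P.coroot' (nodeIdx b θ i) μ.1) : NoBetween b μ (nodeRefl b θ i μ) := by
  rintro ⟨κ, h1, h2⟩
  have h0 : AffLT b μ (nodeRefl b θ i μ) := .single (affStep_nodeRefl hθ i h)
  rcases h1.nodeRefl_left hθ i with h3 | h3
  · exact AffLT.irrefl hθ _ (Relation.TransGen.trans_right h3 h2)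
  · rcases h2.nodeRefl_right hθ i with h4 | h4 <;> rw [nodeRefl_nodeRefl] at h4
    · exact AffLT.irrefl hθ _ (Relation.TransGen.trans_left h1 h4)
    · exact AffLT.irrefl hθ _ (h0.trans (h3.trans h4))

/-- Given `κ` strictly between the reflected points, the diamond lemmas place one of `κ`, `r_i κ`,
`r_i μ`, `r_i ν` strictly between the original ones. -/
lemma NoBetween.nodeRefl (hθ : IsHighestRoot b θ) (i : AffNode b) {μ ν : AffSpace M}
    (h : NoBetween b μ ν)
    (hs : 0 < P.coroot' (nodeIdx b θ i) μ.1 ∧ 0 < P.coroot' (nodeIdx b θ i) ν.1 ∨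
      P.coroot' (nodeIdx b θ i) μ.1 < 0 ∧ P.coroot' (nodeIdx b θ i) ν.1 < 0) :
    NoBetween b (nodeRefl b θ i μ) (nodeRefl b θ i ν) := by
  rintro ⟨κ, h1, h2⟩
  rcases hs with ⟨hμ, hν⟩ | ⟨hμ, hν⟩
  · have h0 : AffLT b μ (LevelZeroLS.nodeRefl b θ i μ) := .single (affStep_nodeRefl hθ i hμ)
    rcases le_or_gt 0 (P.coroot' (nodeIdx b θ i) κ.1) with hκ | hκ
    · rcases h2.nodeRefl_right hθ i with h3 | h3 <;> rw [nodeRefl_nodeRefl] at h3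
      · exact h ⟨_, h0, Relation.TransGen.trans_left h1 h3⟩
      · exact h ⟨_, h0.trans h1, Relation.TransGen.trans_right (le_nodeRefl hθ i hκ) h3⟩
    · refine h ⟨LevelZeroLS.nodeRefl b θ i κ, ?_, ?_⟩
      · rcases h1.nodeRefl_right hθ i with h3 | h3
        · exact Relation.TransGen.trans_left h0 h3
        · rwa [nodeRefl_nodeRefl] at h3
      · rcases h2.nodeRefl_right hθ i with h3 | h3 <;> rw [nodeRefl_nodeRefl] at h3
        · exact Relation.TransGen.trans_left (nodeRefl_lt hθ i hκ) h3
        · exact h3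
  · have h0 : AffLT b (LevelZeroLS.nodeRefl b θ i ν) ν := nodeRefl_lt hθ i hν
    rcases h1.nodeRefl_left hθ i with h3 | h3 <;> rw [nodeRefl_nodeRefl] at h3
    · rcases Relation.reflTransGen_iff_eq_or_transGen.mp h3 with h4 | h4
      · rw [h4] at h2; exact h ⟨_, h2, h0⟩
      · exact h ⟨_, h4, h2.trans h0⟩
    · rcases le_or_gt 0 (P.coroot' (nodeIdx b θ i) κ.1) with hκ | hκ
      · refine h ⟨LevelZeroLS.nodeRefl b θ i κ, h3, ?_⟩
        rcases h2.nodeRefl_left hθ i with h4 | h4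
        · exact Relation.TransGen.trans_right h4 h0
        · rwa [nodeRefl_nodeRefl] at h4
      · exact h ⟨κ, h3.trans (nodeRefl_lt hθ i hκ), h2.trans h0⟩

/-- The covers of the level-zero weight poset are the reflections of semi-infinite length one. -/
lemma noBetween_affRefl_iff (hθ : IsHighestRoot b θ) {a : ι} {k : ℤ} (h : PosAff b a k)
    {μ : AffSpace M} (hμ : 0 < P.coroot' a μ.1) :
    NoBetween b μ (affRefl P a k μ) ↔ reflLength b μ.1 a k = 1 := by
  refine h.induction hθ (p := fun a k => ∀ μ : AffSpace M, 0 < P.coroot' a μ.1 →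
    (NoBetween b μ (affRefl P a k μ) ↔ reflLength b μ.1 a k = 1))
    (fun i μ hμ => iff_of_true (noBetween_nodeRefl_self hθ i hμ) (reflLength_nodeIdx hθ i hμ))
    (fun i a k h hne hi ih μ hμ => ?_) μ hμ
  set ν := affRefl P a k μ with hν
  have hpos : 0 < P.coroot' (P.reflectionPerm (nodeIdx b θ i) a) (nodeRefl b θ i μ).1 := by
    rwa [nodeRefl_fst, coroot'_reflectionPerm_reflection]
  have ih' := ih (nodeRefl b θ i μ) hpos
  rw [← nodeRefl_affRefl, ← hν, nodeRefl_fst, reflLength_reflection hθ, ← affRefl_fst a k,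
    ← hν] at ih'
  have hd := one_le_reflLength hθ (h.reflection hθ i hne) hpos
  rw [nodeRefl_fst, reflLength_reflection hθ, ← affRefl_fst a k, ← hν] at hd
  have hlt : P.coroot' (nodeIdx b θ i) ν.1 < P.coroot' (nodeIdx b θ i) μ.1 := by
    rw [hν, affRefl_fst, reflection_apply', map_sub, map_smul, coroot'_root_eq_pairingIn,
      smul_eq_mul]
    have : (0 : ℝ) < P.pairingIn ℤ a (nodeIdx b θ i) := by exact_mod_cast hi
    nlinarith [mul_pos hμ this]
  have same : ∀ hs : (0 < P.coroot' (nodeIdx b θ i) μ.1 ∧ 0 < P.coroot' (nodeIdx b θ i) ν.1 ∨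
      P.coroot' (nodeIdx b θ i) μ.1 < 0 ∧ P.coroot' (nodeIdx b θ i) ν.1 < 0),
      (NoBetween b μ ν ↔ NoBetween b (nodeRefl b θ i μ) (nodeRefl b θ i ν)) := by
    refine fun hs => ⟨fun h => h.nodeRefl hθ i hs, fun h => ?_⟩
    have := h.nodeRefl hθ i (by
      rw [coroot'_nodeRefl, coroot'_nodeRefl]
      rcases hs with hs | hs
      · right; constructor <;> linarith
      · left; constructor <;> linarith)
    rwa [nodeRefl_nodeRefl, nodeRefl_nodeRefl] at this
  have hstep : AffLT b (nodeRefl b θ i μ) (nodeRefl b θ i ν) :=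
    .single (AffStep.nodeRefl_of_ne hθ i h hμ hne)
  -- When the sign drops from `μ` to `ν`, the bound for the reflected root makes `reflLength` at
  -- least two. It then suffices to exhibit an intermediate point, which is `r_i ν` if the pairing
  -- with `μ` is zero and `r_i μ` if it is positive.
  have diff : Real.sign (P.coroot' (nodeIdx b θ i) ν.1) + 1 ≤
      Real.sign (P.coroot' (nodeIdx b θ i) μ.1) → ¬ NoBetween b μ ν →
      (NoBetween b μ ν ↔ reflLength b μ.1 a k = 1) := by
    intro h1 h2
    exact iff_of_false h2 (fun h3 => by linarith)
  rcases lt_trichotomy (P.coroot' (nodeIdx b θ i) μ.1) 0 with hx | hx | hx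
  · rw [same (Or.inr ⟨hx, hlt.trans hx⟩), ih', Real.sign_of_neg hx,
      Real.sign_of_neg (hlt.trans hx)]
    ring_nf
  · rw [hx] at hlt
    refine diff ?_ (fun h => h ⟨nodeRefl b θ i ν, ?_, nodeRefl_lt hθ i hlt⟩)
    · rw [hx, Real.sign_zero, Real.sign_of_neg hlt]; norm_num
    · rwa [nodeRefl_eq_self i hx] at hstep
  · rcases lt_or_ge 0 (P.coroot' (nodeIdx b θ i) ν.1) with hy | hy
    · rw [same (Or.inl ⟨hx, hy⟩), ih', Real.sign_of_pos hx, Real.sign_of_pos hy]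
      ring_nf
    · refine diff ?_ (fun h => h ⟨nodeRefl b θ i μ, .single (affStep_nodeRefl hθ i hx), ?_⟩)
      · rw [Real.sign_of_pos hx]
        rcases hy.eq_or_lt with hy | hy
        · rw [hy, Real.sign_zero]; norm_num
        · rw [Real.sign_of_neg hy]; norm_num
      · refine Relation.TransGen.trans_left hstep ?_
        have := le_nodeRefl hθ i (μ := nodeRefl b θ i ν) (by rw [coroot'_nodeRefl]; linarith)
        rwa [nodeRefl_nodeRefl] at this

end

end

section

lemma neg_of_sign_le {s t : ℝ} (h : Real.sign s ≤ Real.sign t) (ht : t < 0) : s < 0 := by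
  by_contra! hs
  rw [Real.sign_of_neg ht] at h
  rcases hs.eq_or_lt with hs | hs
  · rw [← hs, Real.sign_zero] at h; linarith
  · rw [Real.sign_of_pos hs] at h; linarith

lemma pos_of_sign_le {s t : ℝ} (h : Real.sign s ≤ Real.sign t) (hs : 0 < s) : 0 < t := by
  by_contra! ht
  rw [Real.sign_of_pos hs] at h
  rcases ht.eq_or_lt with ht | ht
  · rw [ht, Real.sign_zero] at h; linarith
  · rw [Real.sign_of_neg ht] at h; linarith

variable [Fintype ι] [P.IsCrystallographic] [P.IsReduced] [P.IsRootSystem]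

/-! ### The quantum Bruhat graph on weights -/

/-- An edge `μ → ν = r_a μ`, with `p = ⟨α_a^∨, μ⟩ > 0`, of the quantum Bruhat graph on weights. -/
def Edge (b : P.Base) (μ ν : M) (p : ℝ) : Prop :=
  ∃ (a : ι) (k : ℤ), PosAff b a k ∧ 0 < P.coroot' a μ ∧ p = P.coroot' a μ ∧
    ν = P.reflection a μ ∧ reflLength b μ a k = 1

/-- Directed paths whose labels satisfy the integrality condition for `σ`. -/
def Up (b : P.Base) (σ : ℝ) : M → M → Prop :=
  Relation.ReflTransGen fun μ ν => ∃ p, Edge b μ ν p ∧ ∃ n : ℤ, σ * p = n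

/-- The reflected edge has increment one plus the difference of the two signs, and this must again
be at least one; it is an edge when the signs agree. -/
lemma Edge.cases (hθ : IsHighestRoot b θ) (i : AffNode b) {μ ν : M} {p : ℝ} (h : Edge b μ ν p) :
    (0 < P.coroot' (nodeIdx b θ i) μ ∧ p = P.coroot' (nodeIdx b θ i) μ ∧
      ν = P.reflection (nodeIdx b θ i) μ) ∨
    (Real.sign (P.coroot' (nodeIdx b θ i) μ) ≤ Real.sign (P.coroot' (nodeIdx b θ i) ν) ∧
      (Real.sign (P.coroot' (nodeIdx b θ i) μ) = Real.sign (P.coroot' (nodeIdx b θ i) ν) →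
        Edge b (P.reflection (nodeIdx b θ i) μ) (P.reflection (nodeIdx b θ i) ν) p)) := by
  obtain ⟨a, k, h1, h2, rfl, rfl, h3⟩ := h
  by_cases hne : a = nodeIdx b θ i ∧ k = nodeInt b i
  · left; rw [hne.1] at h2 ⊢; exact ⟨h2, rfl, rfl⟩
  · right
    have h4 := h1.reflection hθ i hne
    have hp : P.coroot' (P.reflectionPerm (nodeIdx b θ i) a) (P.reflection (nodeIdx b θ i) μ) =
      P.coroot' a μ := coroot'_reflectionPerm_reflection _ _ _
    have h5 := one_le_reflLength hθ h4 (hp ▸ h2)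
    rw [reflLength_reflection hθ, h3] at h5
    refine ⟨by linarith, fun heq => ⟨_, _, h4, hp ▸ h2, hp.symm, ?_, ?_⟩⟩
    · rw [reflection_reflectionPerm_apply]
    · rw [reflLength_reflection hθ, h3, heq]; ring

lemma edge_reflection (hθ : IsHighestRoot b θ) (i : AffNode b) {μ : M}
    (h : 0 < P.coroot' (nodeIdx b θ i) μ) :
    Edge b μ (P.reflection (nodeIdx b θ i) μ) (P.coroot' (nodeIdx b θ i) μ) :=
  ⟨_, _, posAff_nodeIdx hθ i, h, rfl, rfl, reflLength_nodeIdx hθ i h⟩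

/-! ### Adding, deleting and transporting `r_i`-edges in directed paths. -/

section Up

variable {σ : ℝ} {x y : M}

lemma Up.sub_integral (h : Up b σ x y) (c : ι) :
    ∃ n : ℤ, σ * P.coroot' c x - σ * P.coroot' c y = n := by
  induction h with
  | refl => exact ⟨0, by simp⟩
  | tail _ h ih =>
    obtain ⟨m, hm⟩ := ih
    obtain ⟨p, ⟨a, k, -, -, rfl, rfl, -⟩, n, hn⟩ := h
    refine ⟨m + n * P.pairingIn ℤ a c, ?_⟩
    rw [reflection_apply', map_sub, map_smul, coroot'_root_eq_pairingIn, smul_eq_mul]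
    push_cast
    rw [← hm, ← hn]; ring

/-- Modulo integers, `σ ⟨α_i^∨, ·⟩` is constant along the path. An `r_i`-edge would make it
integral, so all edges are of the kind that cannot lower the sign. -/
lemma Up.sign_le (hθ : IsHighestRoot b θ) (i : AffNode b) (h : Up b σ x y)
    (hx : ¬ ∃ n : ℤ, σ * P.coroot' (nodeIdx b θ i) x = n) :
    Real.sign (P.coroot' (nodeIdx b θ i) x) ≤ Real.sign (P.coroot' (nodeIdx b θ i) y) ∧
    (Real.sign (P.coroot' (nodeIdx b θ i) x) = Real.sign (P.coroot' (nodeIdx b θ i) y) →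
      Up b σ (P.reflection (nodeIdx b θ i) x) (P.reflection (nodeIdx b θ i) y)) := by
  induction h with
  | refl => exact ⟨le_rfl, fun _ => .refl⟩
  | @tail ξ y hxξ h ih =>
    obtain ⟨p, he, n, hn⟩ := h
    obtain ⟨m, hm⟩ := Up.sub_integral hxξ (nodeIdx b θ i)
    rcases he.cases hθ i with ⟨-, h2, -⟩ | ⟨h1, h2⟩
    · refine absurd ⟨m + n, ?_⟩ hx
      push_cast; rw [← hm, ← hn, h2]; ring
    · refine ⟨ih.1.trans h1, fun heq => ?_⟩
      have h3 := le_antisymm ih.1 (by rw [heq]; exact h1)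
      exact .tail (ih.2 h3) ⟨p, h2 (by rw [← h3, heq]), n, hn⟩

/-- Only an `r_i`-edge can take the pairing from nonnegative to negative. Delete the last such edge
and reflect everything after it. -/
lemma Up.reflection_right (hθ : IsHighestRoot b θ) (i : AffNode b) (h : Up b σ x y)
    (hx : 0 ≤ P.coroot' (nodeIdx b θ i) x) (hy : P.coroot' (nodeIdx b θ i) y < 0) :
    Up b σ x (P.reflection (nodeIdx b θ i) y) := by
  induction h with
  | refl => exact absurd hy (not_lt.mpr hx)
  | @tail ξ y hxξ h ih =>
    obtain ⟨p, he, n, hn⟩ := h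
    rcases he.cases hθ i with ⟨-, -, h2⟩ | ⟨h1, h2⟩
    · rw [h2, P.reflection_same]; exact hxξ
    · have hξ := neg_of_sign_le h1 hy
      exact .tail (ih hξ) ⟨p, h2 (by rw [Real.sign_of_neg hξ, Real.sign_of_neg hy]), n, hn⟩

lemma Up.reflection_left (hθ : IsHighestRoot b θ) (i : AffNode b) (h : Up b σ x y)
    (hx : 0 < P.coroot' (nodeIdx b θ i) x) (hy : P.coroot' (nodeIdx b θ i) y ≤ 0) :
    Up b σ (P.reflection (nodeIdx b θ i) x) y := by
  induction h using Relation.ReflTransGen.head_induction_on with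
  | refl => exact absurd hx (not_lt.mpr hy)
  | @head x ξ h hξy ih =>
    obtain ⟨p, he, n, hn⟩ := h
    rcases he.cases hθ i with ⟨-, -, h2⟩ | ⟨h1, h2⟩
    · rw [← h2]; exact hξy
    · have hξ := pos_of_sign_le h1 hx
      exact .head ⟨p, h2 (by rw [Real.sign_of_pos hξ, Real.sign_of_pos hx]), n, hn⟩ (ih hξ)

lemma Up.reflection_left_of_neg (hθ : IsHighestRoot b θ) (i : AffNode b) (h : Up b σ x y)
    (hx : P.coroot' (nodeIdx b θ i) x < 0)
    (hint : ∃ n : ℤ, σ * P.coroot' (nodeIdx b θ i) x = n) :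
    Up b σ (P.reflection (nodeIdx b θ i) x) y := by
  obtain ⟨n, hn⟩ := hint
  have h1 := coroot'_reflection_self (P := P) (nodeIdx b θ i) x
  have := edge_reflection hθ i (μ := P.reflection (nodeIdx b θ i) x) (by rw [h1]; linarith)
  rw [P.reflection_same] at this
  exact .head ⟨_, this, -n, by rw [h1]; push_cast; linarith⟩ h

lemma Up.reflection_right_of_pos (hθ : IsHighestRoot b θ) (i : AffNode b) (h : Up b σ x y)
    (hy : 0 < P.coroot' (nodeIdx b θ i) y)
    (hint : ∃ n : ℤ, σ * P.coroot' (nodeIdx b θ i) y = n) :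
    Up b σ x (P.reflection (nodeIdx b θ i) y) :=
  .tail h ⟨_, edge_reflection hθ i hy, hint⟩

end Up

/-! ### Comparison with the parabolic quantum Bruhat graph -/

lemma rootSum_smul (w : P.weylGroup) (x : M) : rootSum P (w • x) = w • rootSum P x := by
  induction w using weylGroup_induction with
  | one => simp
  | mul a w ih => rw [mul_smul, mul_smul, ofIdx_smul, ofIdx_smul, rootSum_reflection, ih]

/-- Add the lower bounds for `α_a + k δ` at `μ` and for `-α_a + (1 - k) δ` at `r_a μ`, with `k =
negInd b a`: the lengths cancel and one copy of the pairing remains. -/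
lemma two_le_coroot'_rootSum (hθ : IsHighestRoot b θ) {a : ι} {μ : M}
    (h : 0 < P.coroot' a μ) : 2 ≤ P.coroot' a (rootSum P μ) := by
  have h1 := one_le_reflLength hθ (a := a) (k := negInd b a) le_rfl h
  have h2 := one_le_reflLength hθ (a := P.reflectionPerm a a) (k := 1 - negInd b a)
    (negInd_same b a).le (μ := P.reflection a μ)
    (by rwa [coroot'_reflectionPerm_reflection])
  unfold reflLength at h1 h2
  rw [reflection_reflectionPerm_apply, P.reflection_same, rootSum_reflection,
    coroot'_reflectionPerm_reflection] at h2
  push_cast at h2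
  linarith

/-- Raising the `δ`-coefficient by one adds at least two to the increment, so only the smallest
admissible value can give one. Thus a projected cover has coefficient `0` or `1`, matching Bruhat
and quantum edges. -/
lemma eq_negInd_of_reflLength_eq_one (hθ : IsHighestRoot b θ) {a : ι} {k : ℤ} {μ : M}
    (hk : PosAff b a k) (h : 0 < P.coroot' a μ) (h1 : reflLength b μ a k = 1) :
    k = negInd b a := by
  have h2 := two_le_coroot'_rootSum hθ h
  have h3 := one_le_reflLength hθ (a := a) (k := negInd b a) le_rfl h
  unfold reflLength at h1 h3
  by_contra hne
  have h4 : negInd b a + 1 ≤ k := by unfold PosAff at hk; omega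
  have h5 : (negInd b a : ℝ) + 1 ≤ k := by exact_mod_cast h4
  nlinarith

section QuantumBruhat

variable {lam : M}

open RootPairing

/-- A Bruhat edge has `δ`-coefficient zero: projecting to weights can only shorten the target, and
the general lower bound gives equality. For a quantum edge with coefficient one, the length
condition is literally increment one. -/
lemma QBEdge.edge (hθ : IsHighestRoot b θ) (hlam : IsDominantIntegral b lam) {w v : P.weylGroup}
    {γ : ι} (h : QBEdge b lam w γ v) : Edge b (w • lam) (v • lam) (P.coroot' γ lam) := by
  have hγ : 0 < P.coroot' γ lam := by
    refine (coroot'_nonneg_of_isPos hlam.nonneg h.label_pos).lt_of_ne fun h0 => ?_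
    exact h.label_not_mem ((mem_rootsJ_iff hlam.nonneg γ).mpr h0.symm)
  obtain ⟨hv, hv'⟩ := isFloor_iff.mp h.target
  have hp : P.coroot' (P.weylGroupToPerm w γ) (w • lam) = P.coroot' γ lam :=
    coroot'_weylGroupToPerm_smul w γ lam
  have hr : v • lam = P.reflection (P.weylGroupToPerm w γ) (w • lam) := by
    rw [hv', mul_smul, ofIdx_smul, smul_reflection]
  have hw : (weightLength b (w • lam) : ℝ) = weylLength b w := by
    rw [← weylLength_eq_weightLength hθ hlam h.source_mem]; simp
  rcases h.bruhat_or_quantum with hb | hq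
  · have ha : b.IsPos (P.weylGroupToPerm w γ) := by
      by_contra hn
      have := invLength_mul_ofIdx_lt hθ h.label_pos hn
      rw [← weylLength_eq_invLength hθ, ← weylLength_eq_invLength hθ] at this
      omega
    have h0 : PosAff b (P.weylGroupToPerm w γ) 0 := (negInd_of_isPos ha).le
    refine ⟨_, 0, h0, hp ▸ hγ, hp.symm, hr, le_antisymm ?_ (one_le_reflLength hθ h0 (hp ▸ hγ))⟩
    have h1 := weightLength_le_weylLength hθ hlam (w * weylGroup.ofIdx P γ)
    rw [mul_smul, ofIdx_smul, smul_reflection, hb] at h1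
    have h2 : (weightLength b (P.reflection (P.weylGroupToPerm w γ) (w • lam)) : ℝ) ≤
      ((weylLength b w + 1 : ℕ) : ℤ) := by exact_mod_cast h1
    unfold reflLength
    rw [hw]
    push_cast at h2 ⊢
    linarith
  · refine ⟨_, 1, (negInd_le_one b _ : _ ≤ _), hp ▸ hγ, hp.symm, hr, ?_⟩
    unfold reflLength
    have hvl : (weightLength b (v • lam) : ℝ) = weylLength b v := by
      rw [← weylLength_eq_weightLength hθ hlam hv]; simp
    rw [← hr, hw, hvl, hq, rootSum_smul, coroot'_weylGroupToPerm_smul, twoRhoSub_eq hlam.nonneg]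
    push_cast; ring

lemma Edge.exists_qbEdge (hθ : IsHighestRoot b θ) (hlam : IsDominantIntegral b lam)
    {w : P.weylGroup} (hw : w ∈ minReps b lam) {ν : M} {p : ℝ} (h : Edge b (w • lam) ν p) :
    ∃ γ v, QBEdge b lam w γ v ∧ v • lam = ν ∧ p = P.coroot' γ lam := by
  obtain ⟨a, k, hk, ha, hpa, hν, hd⟩ := h
  have hk' := eq_negInd_of_reflLength_eq_one hθ hk ha hd
  set γ := P.weylGroupToPerm w⁻¹ a with hγ
  have haγ : P.weylGroupToPerm w γ = a := by
    rw [hγ, ← Equiv.Perm.mul_apply, ← map_mul]; simp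
  have hp : P.coroot' a (w • lam) = P.coroot' γ lam := coroot'_smul w a lam
  have hγ0 : 0 < P.coroot' γ lam := hp ▸ ha
  have hγpos : b.IsPos γ := isPos_of_coroot'_pos hlam.nonneg hγ0
  obtain ⟨v, hv, hv'⟩ := exists_mem_minReps b lam (w * weylGroup.ofIdx P γ)
  have hvν : v • lam = ν := by rw [hv', mul_smul, ofIdx_smul, smul_reflection, haγ, hν]
  refine ⟨γ, v, ⟨hw, hγpos, fun hmem => ?_, isFloor_iff.mpr ⟨hv, hv'⟩, ?_⟩, hvν, hpa.trans hp⟩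
  · rw [mem_rootsJ_iff hlam.nonneg] at hmem; linarith
  have hwl : (weightLength b (w • lam) : ℝ) = weylLength b w := by
    rw [← weylLength_eq_weightLength hθ hlam hw]; simp
  have hvl : (weightLength b (v • lam) : ℝ) = weylLength b v := by
    rw [← weylLength_eq_weightLength hθ hlam hv]; simp
  unfold reflLength at hd
  rw [← hν, ← hvν, hwl, hvl] at hd
  by_cases hpos : b.IsPos a
  · left
    rw [hk', negInd_of_isPos hpos, Int.cast_zero, zero_mul, add_zero] at hd
    have hd' : weylLength b v = weylLength b w + 1 := by
      have : (weylLength b v : ℝ) = (weylLength b w + 1 : ℕ) := by push_cast; linarith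
      exact_mod_cast this
    -- It remains to see that `w r_γ` is already minimal. Writing `v = w z r_{z⁻¹γ}`, the element `w
    -- z` is shorter than `v`, hence no longer than `w`; so it is also a minimal representative of
    -- the coset of `w`, and `z = 1`.
    set z := (w * weylGroup.ofIdx P γ)⁻¹ * v with hz
    have hzl : z • lam = lam := by rw [hz, mul_smul, hv', inv_smul_smul]
    have hvz : v = w * z * weylGroup.ofIdx P (P.weylGroupToPerm z⁻¹ γ) := by
      rw [mul_assoc, mul_ofIdx, ← Equiv.Perm.mul_apply, ← map_mul, mul_inv_cancel, map_one,
        Equiv.Perm.one_apply, hz, ← mul_assoc, mul_inv_cancel_left]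
    have h1 : P.coroot' (P.weylGroupToPerm z⁻¹ γ) lam = P.coroot' γ lam := by
      rw [← coroot'_smul, hzl]
    have h2 := invLength_lt_mul_ofIdx hθ (isPos_of_coroot'_pos hlam.nonneg (h1 ▸ hγ0))
      (w := w * z) (by
        rw [← Equiv.Perm.mul_apply, ← map_mul, mul_inv_cancel_right, haγ]; exact hpos)
    rw [← hvz, ← weylLength_eq_invLength hθ, ← weylLength_eq_invLength hθ, hd'] at h2
    have h3 : w * z ∈ minReps b lam := by
      intro z' hz'
      have := hw (z * z') (by change (z * z') • lam = lam; rw [mul_smul, (hz' : z' • lam = lam), hzl])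
      rw [mul_assoc]
      omega
    have h4 := minReps_injOn hθ hlam hw h3 (by rw [mul_smul, hzl])
    rw [left_eq_mul] at h4
    have : v = w * weylGroup.ofIdx P γ := by
      rw [h4, mul_one, inv_one, map_one, Equiv.Perm.one_apply] at hvz; exact hvz
    rw [← this, hd']
  · right
    rw [hk', negInd_of_not_isPos hpos, rootSum_smul, ← haγ, coroot'_weylGroupToPerm_smul,
      ← twoRhoSub_eq hlam.nonneg] at hd
    push_cast at hd
    linarith

lemma HasDirectedPath.up (hθ : IsHighestRoot b θ) (hlam : IsDominantIntegral b lam) {σ : ℚ}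
    {y x : P.weylGroup} (h : HasDirectedPath b lam σ y x) : Up b σ (y • lam) (x • lam) := by
  induction h with
  | refl => exact .refl
  | tail _ h ih =>
    obtain ⟨γ, h, hn⟩ := h
    exact .tail ih ⟨_, h.edge hθ hlam, hn⟩

lemma Up.hasDirectedPath (hθ : IsHighestRoot b θ) (hlam : IsDominantIntegral b lam) {σ : ℚ}
    {y x : P.weylGroup} (hy : y ∈ minReps b lam) (hx : x ∈ minReps b lam)
    (h : Up b σ (y • lam) (x • lam)) : HasDirectedPath b lam σ y x := by
  have key : ∀ ν, Up b σ (y • lam) ν →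
      ∃ v ∈ minReps b lam, v • lam = ν ∧ HasDirectedPath b lam σ y v := by
    intro ν h
    induction h with
    | refl => exact ⟨y, hy, rfl, .refl⟩
    | tail _ h ih =>
      obtain ⟨w, hw, rfl, hyw⟩ := ih
      obtain ⟨p, he, hn⟩ := h
      obtain ⟨γ, v, h1, h2, rfl⟩ := he.exists_qbEdge hθ hlam hw
      exact ⟨v, (isFloor_iff.mp h1.target).1, h2, .tail hyw ⟨γ, h1, hn⟩⟩
  obtain ⟨v, hv, h1, h2⟩ := key _ h
  rwa [minReps_injOn hθ hlam hv hx h1] at h2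

end QuantumBruhat

/-! ### Comparison with the level-zero weight poset -/

section LevelZeroPoset

variable {lam : M}

/-- The minus sign appears because the integrality condition pairs the label with the upper element,
whereas an edge records its value at the lower one. -/
lemma LabeledCover.edge (hθ : IsHighestRoot b θ) {β : AffSpace M}
    {βv : Module.Dual ℝ (AffSpace M)} {μ ν : AffSpace M} (h : LabeledCover b θ lam β βv μ ν) :
    Edge b μ.1 ν.1 (-βv ν) := by
  obtain ⟨h1, h2⟩ := h
  obtain ⟨a, k, h3, -, h4, rfl, -, h6⟩ := h1.exists_posAff hθ
  refine ⟨a, k, h3, h4, by rw [h6, neg_neg], affRefl_fst _ _ _, ?_⟩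
  rw [← noBetween_affRefl_iff hθ h3 h4]
  rintro ⟨κ, h7, h8⟩
  exact h2 ⟨κ, (weightLT_iff hθ).mpr ⟨h1.left_mem, h7⟩,
    (weightLT_iff hθ).mpr ⟨h7.mem_orbit hθ h1.left_mem, h8⟩⟩

lemma Edge.exists_labeledCover (hθ : IsHighestRoot b θ) {μ : AffSpace M}
    (hμ : μ ∈ orbit b θ lam) {x : M} {p : ℝ} (h : Edge b μ.1 x p) :
    ∃ ν : AffSpace M, ν.1 = x ∧ ∃ β βv, LabeledCover b θ lam β βv μ ν ∧ βv ν = -p := by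
  obtain ⟨a, k, h1, h2, rfl, rfl, h3⟩ := h
  obtain ⟨βv, h4⟩ := exists_reflLT hθ hμ h1 h2
  refine ⟨_, affRefl_fst a k μ, _, βv, ⟨h4, ?_⟩, ?_⟩
  · rintro ⟨κ, h7, h8⟩
    exact (noBetween_affRefl_iff hθ h1 h2).mpr h3
      ⟨κ, ((weightLT_iff hθ).mp h7).2, ((weightLT_iff hθ).mp h8).2⟩
  · have h5 : βv μ = P.coroot' a μ.1 := by
      obtain ⟨a', k', -, h6, -, -, h7, -⟩ := h4.exists_posAff hθ
      rw [h7, P.root.injective (congrArg Prod.fst h6)]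
    obtain ⟨a', k', -, h6, -, -, -, h7⟩ := h4.exists_posAff hθ
    rw [h7, P.root.injective (congrArg Prod.fst h6)]

lemma HasChain.up (hθ : IsHighestRoot b θ) {σ : ℚ} {μ ν : AffSpace M}
    (h : HasChain b θ lam σ μ ν) : Up b σ ν.1 μ.1 := by
  have step : ∀ {ξ ξ' : AffSpace M}, (∃ γ γv, LabeledCover b θ lam γ γv ξ' ξ ∧
      ∃ n : ℤ, (σ : ℝ) * γv ξ = n) → ∃ p, Edge b ξ'.1 ξ.1 p ∧ ∃ n : ℤ, (σ : ℝ) * p = n := by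
    rintro ξ ξ' ⟨γ, γv, h, n, hn⟩
    exact ⟨_, h.edge hθ, -n, by push_cast; rw [← hn]; ring⟩
  induction h with
  | single h => exact .single (step h)
  | tail _ h ih => exact .head (step h) ih

lemma HasChain.weightLT {σ : ℚ} {μ ν : AffSpace M} (h : HasChain b θ lam σ μ ν) :
    WeightLT b θ lam ν μ := by
  induction h with
  | single h => obtain ⟨γ, γv, h, -⟩ := h; exact .single ⟨_, _, h.1⟩
  | tail _ h ih => obtain ⟨γ, γv, h, -⟩ := h; exact .head ⟨_, _, h.1⟩ ih

/-- An edge fixes the affine root, so it lifts uniformly from any point above its source. Distinct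
end points are needed because a chain has at least one cover. -/
lemma Up.exists_hasChain (hθ : IsHighestRoot b θ) {σ : ℚ} {ν : AffSpace M}
    (hν : ν ∈ orbit b θ lam) {x : M} (h : Up b σ ν.1 x) (hne : ν.1 ≠ x) :
    ∃ μ ∈ orbit b θ lam, μ.1 = x ∧ HasChain b θ lam σ μ ν := by
  have key : ∃ μ ∈ orbit b θ lam, μ.1 = x ∧ (μ = ν ∨ HasChain b θ lam σ μ ν) := by
    clear hne
    induction h with
    | refl => exact ⟨ν, hν, rfl, Or.inl rfl⟩
    | tail _ h ih =>
      obtain ⟨μ, hμ, rfl, h1⟩ := ih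
      obtain ⟨p, he, n, hn⟩ := h
      obtain ⟨κ, h2, β, βv, h3, h4⟩ := he.exists_labeledCover hθ hμ
      have h5 : ∃ γ γv, LabeledCover b θ lam γ γv μ κ ∧ ∃ n : ℤ, (σ : ℝ) * γv κ = n :=
        ⟨β, βv, h3, -n, by rw [h4]; push_cast; linarith⟩
      refine ⟨κ, h3.1.right_mem, h2, Or.inr ?_⟩
      rcases h1 with rfl | h1
      · exact .single h5
      · exact .head h5 h1
  obtain ⟨μ, h1, h2, rfl | h3⟩ := key
  · exact absurd h2 hne
  · exact ⟨μ, h1, h2, h3⟩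

lemma smul_mem_orbit (b : P.Base) (θ : ι) (lam : M) (w : P.weylGroup) :
    (w • lam, (0 : ℝ), (0 : ℝ)) ∈ orbit b θ lam := by
  obtain ⟨l, hl, rfl⟩ := exists_word b w
  induction l with
  | nil => exact ⟨1, one_mem _, by simp⟩
  | cons s t ih =>
    obtain ⟨j, hj, rfl⟩ := hl s (by simp)
    obtain ⟨u, hu, h⟩ := ih fun s hs => hl s (by simp [hs])
    refine ⟨affSimpleRefl b θ (some ⟨j, hj⟩) * u, mul_mem (affSimpleRefl_mem _ _ _) hu, ?_⟩
    rw [LinearEquiv.mul_apply, ← h, affSimpleRefl_levelZero, List.prod_cons, mul_smul, ofIdx_smul]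
    simp [nodeIdx, nodeInt]

end LevelZeroPoset

end

section

/-! ### Piecewise linear paths with nodes `τ_0 < τ_1 < ⋯ < τ_n` -/

section PiecewiseLinear

variable {V : Type*} [AddCommGroup V] [Module ℝ V]

/-- The piecewise linear function with direction `y_l` on `[τ_l, τ_{l+1}]`, for `l < n`. -/
def seqFun (n : ℕ) (τ : ℕ → ℚ) (y : ℕ → V) (t : ℝ) : V :=
  ∑ l ∈ Finset.range n, (min t (τ (l + 1)) - min t (τ l)) • y l

/-- The path given by `seqFun`. -/
def seqPath (n : ℕ) (τ : ℕ → ℚ) (y : ℕ → V) : Path V := fun t => seqFun n τ y t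

/-- `0 = τ_0 < τ_1 < ⋯ < τ_n = 1`. -/
structure IsNodes (n : ℕ) (τ : ℕ → ℚ) : Prop where
  zero : τ 0 = 0
  last : τ n = 1
  lt : ∀ j < n, τ j < τ (j + 1)

lemma seqFun_succ (n : ℕ) (τ : ℕ → ℚ) (y : ℕ → V) (t : ℝ) :
    seqFun (n + 1) τ y t = seqFun n τ y t + (min t (τ (n + 1)) - min t (τ n)) • y n :=
  Finset.sum_range_succ _ _

namespace IsNodes

variable {n : ℕ} {τ : ℕ → ℚ} (h : IsNodes n τ)
include h

lemma strict {j k : ℕ} (hjk : j < k) (hk : k ≤ n) : τ j < τ k := by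
  induction k with
  | zero => omega
  | succ k ih =>
    rcases Nat.lt_succ_iff_lt_or_eq.mp hjk with h1 | rfl
    · exact (ih h1 (by omega)).trans (h.lt k (by omega))
    · exact h.lt _ (by omega)

lemma mono {j k : ℕ} (hjk : j ≤ k) (hk : k ≤ n) : τ j ≤ τ k := by
  rcases hjk.eq_or_lt with rfl | hjk
  · exact le_rfl
  · exact (h.strict hjk hk).le

lemma mono' {j k : ℕ} (hjk : j ≤ k) (hk : k ≤ n) : (τ j : ℝ) ≤ τ k := by
  exact_mod_cast h.mono hjk hk

lemma strict' {j k : ℕ} (hjk : j < k) (hk : k ≤ n) : (τ j : ℝ) < τ k := by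
  exact_mod_cast h.strict hjk hk

lemma pos : 0 < n := by
  rcases Nat.eq_zero_or_pos n with rfl | hn
  · have h1 := h.zero
    rw [h.last] at h1
    norm_num at h1
  · exact hn

lemma mem_Icc {j : ℕ} (hj : j ≤ n) : (τ j : ℝ) ∈ unitInterval := by
  constructor
  · have := h.mono' (Nat.zero_le j) hj
    rwa [h.zero, Rat.cast_zero] at this
  · have := h.mono' hj le_rfl
    rwa [h.last, Rat.cast_one] at this

/-- Cutting the time off at `τ_k` kills the contributions of all later segments. -/
lemma seqFun_min {k : ℕ} (hk : k ≤ n) (y : ℕ → V) (t : ℝ) :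
    seqFun n τ y (min t (τ k)) = seqFun k τ y t := by
  unfold seqFun
  rw [← Finset.sum_range_add_sum_Ico _ hk]
  have h1 : ∑ l ∈ Finset.Ico k n, (min (min t (τ k)) (τ (l + 1)) - min (min t (τ k)) (τ l)) • y l
      = 0 := by
    refine Finset.sum_eq_zero fun l hl => ?_
    rw [Finset.mem_Ico] at hl
    rw [min_eq_left ((min_le_right _ _).trans (h.mono' (by omega : k ≤ l + 1) (by omega))),
      min_eq_left ((min_le_right _ _).trans (h.mono' (by omega : k ≤ l) (by omega))), sub_self,
      zero_smul]
  rw [h1, add_zero]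
  refine Finset.sum_congr rfl fun l hl => ?_
  rw [Finset.mem_range] at hl
  rw [min_assoc, min_eq_right (h.mono' (by omega : l + 1 ≤ k) hk), min_assoc,
    min_eq_right (h.mono' (by omega : l ≤ k) hk)]

lemma seqFun_node {k : ℕ} (hk : k ≤ n) (y : ℕ → V) {t : ℝ} (ht : (τ k : ℝ) ≤ t) :
    seqFun k τ y t = seqFun n τ y (τ k) := by
  rw [← h.seqFun_min hk, min_eq_right ht]

lemma seqFun_zero (y : ℕ → V) : seqFun n τ y 0 = 0 := by
  have := h.seqFun_min (Nat.zero_le n) y 0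
  rwa [h.zero, Rat.cast_zero, min_self] at this

lemma seqFun_eq_add {j : ℕ} (hj : j < n) (y : ℕ → V) {t : ℝ} (h0 : (τ j : ℝ) ≤ t)
    (h1 : t ≤ τ (j + 1)) : seqFun n τ y t = seqFun n τ y (τ j) + (t - τ j) • y j := by
  have h2 := h.seqFun_min (by omega : j + 1 ≤ n) y t
  rw [min_eq_left h1] at h2
  rw [h2, seqFun_succ, h.seqFun_node hj.le y h0, min_eq_left h1, min_eq_right h0]

/-- On a segment, a linear functional is a convex combination of its values at the end points. -/
lemma convex {j : ℕ} (hj : j < n) (y : ℕ → V) (c : V →ₗ[ℝ] ℝ) {t : ℝ} (h0 : (τ j : ℝ) ≤ t)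
    (h1 : t ≤ τ (j + 1)) : (τ (j + 1) - τ j) * c (seqFun n τ y t) =
      (τ (j + 1) - t) * c (seqFun n τ y (τ j)) + (t - τ j) * c (seqFun n τ y (τ (j + 1))) := by
  rw [h.seqFun_eq_add hj y h0 h1, h.seqFun_eq_add hj y (h.mono' (Nat.le_succ j) hj) le_rfl]
  simp only [map_add, map_smul, smul_eq_mul]
  ring

lemma exists_mem_Ico {k l : ℕ} (hkl : k ≤ l) {t : ℝ} (h0 : (τ k : ℝ) ≤ t) (h1 : t < τ l) :
    ∃ j, k ≤ j ∧ j < l ∧ (τ j : ℝ) ≤ t ∧ t < τ (j + 1) := by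
  induction l, hkl using Nat.le_induction with
  | base => exact absurd h1 (not_lt.mpr h0)
  | succ l hl ih =>
    rcases lt_or_ge t (τ l) with h2 | h2
    · obtain ⟨j, hj, hj', h3⟩ := ih h2
      exact ⟨j, hj, by omega, h3⟩
    · exact ⟨l, hl, by omega, h2, h1⟩

lemma exists_mem_Ioc {k l : ℕ} (hkl : k ≤ l) {t : ℝ} (h0 : (τ k : ℝ) < t) (h1 : t ≤ τ l) :
    ∃ j, k ≤ j ∧ j < l ∧ (τ j : ℝ) < t ∧ t ≤ τ (j + 1) := by
  induction l, hkl using Nat.le_induction with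
  | base => exact absurd h1 (not_le.mpr h0)
  | succ l hl ih =>
    rcases le_or_gt t (τ l) with h2 | h2
    · obtain ⟨j, hj, hj', h3⟩ := ih h2
      exact ⟨j, hj, by omega, h3⟩
    · exact ⟨l, hl, by omega, h2, h1⟩

/-- A lower bound at the nodes holds in between, strictly if it is strict except on the right. -/
lemma lt_seqFun_left (y : ℕ → V) (c : V →ₗ[ℝ] ℝ) {k l : ℕ} (hkl : k ≤ l) (hl : l ≤ n) {m : ℝ}
    (hle : m ≤ c (seqFun n τ y (τ l)))
    (hlt : ∀ j, k ≤ j → j < l → m < c (seqFun n τ y (τ j))) {t : ℝ} (h0 : (τ k : ℝ) ≤ t)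
    (h1 : t < τ l) : m < c (seqFun n τ y t) := by
  obtain ⟨j, hj, hj', h2, h3⟩ := h.exists_mem_Ico hkl h0 h1
  have h4 := h.convex (by omega : j < n) y c h2 h3.le
  have h5 : m ≤ c (seqFun n τ y (τ (j + 1))) := by
    rcases (Nat.succ_le_of_lt hj').eq_or_lt with h6 | h6
    · rwa [show j + 1 = l from h6]
    · exact (hlt _ (by omega) h6).le
  have h6 := mul_lt_mul_of_pos_left (hlt j hj hj') (sub_pos.mpr h3)
  have h7 := mul_le_mul_of_nonneg_left h5 (sub_nonneg.mpr h2)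
  by_contra! h8
  have h9 := mul_le_mul_of_nonneg_left h8 (sub_nonneg.mpr (h2.trans h3.le))
  linarith

/-- A lower bound at the nodes holds in between, strictly if it is strict except on the left. -/
lemma lt_seqFun_right (y : ℕ → V) (c : V →ₗ[ℝ] ℝ) {k l : ℕ} (hkl : k ≤ l) (hl : l ≤ n) {m : ℝ}
    (hle : m ≤ c (seqFun n τ y (τ k)))
    (hlt : ∀ j, k < j → j ≤ l → m < c (seqFun n τ y (τ j))) {t : ℝ} (h0 : (τ k : ℝ) < t)
    (h1 : t ≤ τ l) : m < c (seqFun n τ y t) := by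
  obtain ⟨j, hj, hj', h2, h3⟩ := h.exists_mem_Ioc hkl h0 h1
  have h4 := h.convex (by omega : j < n) y c h2.le h3
  have h5 : m ≤ c (seqFun n τ y (τ j)) := by
    rcases hj.eq_or_lt with rfl | h6
    · exact hle
    · exact (hlt _ h6 hj'.le).le
  have h6 := mul_lt_mul_of_pos_left (hlt (j + 1) (by omega) hj') (sub_pos.mpr h2)
  have h7 := mul_le_mul_of_nonneg_left h5 (sub_nonneg.mpr h3)
  by_contra! h8
  have h9 := mul_le_mul_of_nonneg_left h8 (sub_nonneg.mpr (h2.le.trans h3))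
  linarith

/-- A path that is linear with direction `y_l` on the `l`-th segment is `seqFun`. -/
lemma eq_seqFun (y : ℕ → V) (F : ℝ → V) (hF : F 0 = 0)
    (hl : ∀ j < n, ∀ t : ℝ, (τ j : ℝ) ≤ t → t ≤ τ (j + 1) → F t = F (τ j) + (t - τ j) • y j)
    {t : ℝ} (ht : t ∈ unitInterval) : F t = seqFun n τ y t := by
  have key : ∀ j ≤ n, F (τ j) = seqFun n τ y (τ j) := by
    intro j
    induction j with
    | zero => intro _; rw [h.zero, Rat.cast_zero, hF, h.seqFun_zero]
    | succ j ih =>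
      intro hj
      have h1 := h.mono' (Nat.le_succ j) hj
      rw [hl j hj _ h1 le_rfl, ih (by omega), h.seqFun_eq_add hj y h1 le_rfl]
  rcases ht.1.eq_or_lt with h0 | h0
  · rw [← h0, hF, h.seqFun_zero]
  · obtain ⟨j, -, hj, h1, h2⟩ := h.exists_mem_Ioc (Nat.zero_le n)
      (by rwa [h.zero, Rat.cast_zero]) (by rw [h.last, Rat.cast_one]; exact ht.2)
    rw [hl j hj t h1.le h2, key j hj.le, h.seqFun_eq_add hj y h1.le h2]

end IsNodes

/-- The effect on `seqFun` of reflecting the directions between two nodes. -/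
lemma seqFun_flip (τ : ℕ → ℚ) (y : ℕ → V) (c : V →ₗ[ℝ] ℝ) (α : V) {j₀ j₁ : ℕ} (hj : j₀ ≤ j₁)
    (t : ℝ) (k : ℕ) :
    seqFun k τ (fun l => if j₀ ≤ l ∧ l < j₁ then y l - c (y l) • α else y l) t =
      seqFun k τ y t - (c (seqFun (min k j₁) τ y t) - c (seqFun (min k j₀) τ y t)) • α := by
  induction k with
  | zero => simp [seqFun]
  | succ k ih =>
    rw [seqFun_succ, ih, seqFun_succ]
    rcases lt_or_ge k j₀ with h1 | h1
    · rw [if_neg (by omega), min_eq_left (by omega : k ≤ j₁), min_eq_left (by omega : k ≤ j₀),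
        min_eq_left (by omega : k + 1 ≤ j₁), min_eq_left (by omega : k + 1 ≤ j₀)]
      module
    · rcases lt_or_ge k j₁ with h2 | h2
      · rw [if_pos ⟨h1, h2⟩, min_eq_left (by omega : k ≤ j₁), min_eq_right h1,
          min_eq_left (by omega : k + 1 ≤ j₁), min_eq_right (by omega : j₀ ≤ k + 1), seqFun_succ,
          map_add, map_smul, smul_eq_mul]
        module
      · rw [if_neg (by omega), min_eq_right h2, min_eq_right h1,
          min_eq_right (by omega : j₁ ≤ k + 1), min_eq_right (by omega : j₀ ≤ k + 1)]
        module

end PiecewiseLinear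

/-! ### Root operators on piecewise linear paths -/

section RootOperators

variable {n : ℕ} {τ : ℕ → ℚ} {y : ℕ → M}

/-- The value of `H_i` at the `j`-th node. -/
def nodeHeight (b : P.Base) (θ : ι) (i : AffNode b) (n : ℕ) (τ : ℕ → ℚ) (y : ℕ → M) (j : ℕ) : ℝ :=
  P.coroot' (nodeIdx b θ i) (seqFun n τ y (τ j))

/-- The directions `y` with those between the nodes `j₀` and `j₁` reflected. -/
def flip (b : P.Base) (θ : ι) (i : AffNode b) (j₀ j₁ : ℕ) (y : ℕ → M) (l : ℕ) : M :=
  if j₀ ≤ l ∧ l < j₁ then P.reflection (nodeIdx b θ i) (y l) else y l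

lemma flip_flip (i : AffNode b) (j₀ j₁ : ℕ) (y : ℕ → M) :
    flip b θ i j₀ j₁ (flip b θ i j₀ j₁ y) = y := by
  ext l
  unfold flip
  split_ifs <;> simp

/-- The nodes between which `e_i` reflects, for `H_i` with the values `H j` at the nodes. -/
structure EData (n : ℕ) (H : ℕ → ℝ) (m : ℝ) (j₀ j₁ : ℕ) : Prop where
  lt : j₀ < j₁
  le : j₁ ≤ n
  min : ∀ j ≤ n, m ≤ H j
  eq : H j₁ = m
  first : ∀ j < j₁, m < H j
  eq' : H j₀ = m + 1
  last : ∀ j, j₀ < j → j ≤ j₁ → H j < m + 1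
  before : ∀ j ≤ j₀, m + 1 ≤ H j

/-- The nodes between which `f_i` reflects, for `H_i` with the values `H j` at the nodes. -/
structure FData (n : ℕ) (H : ℕ → ℝ) (m : ℝ) (j₀ j₁ : ℕ) : Prop where
  lt : j₀ < j₁
  le : j₁ ≤ n
  min : ∀ j ≤ n, m ≤ H j
  eq : H j₀ = m
  last : ∀ j, j₀ < j → j ≤ n → m < H j
  eq' : H j₁ = m + 1
  first : ∀ j, j₀ ≤ j → j < j₁ → H j < m + 1
  after : ∀ j, j₁ ≤ j → j ≤ n → m + 1 ≤ H j

variable (h : IsNodes n τ) (i : AffNode b)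
include h

lemma seqPath_flip {j₀ j₁ : ℕ} (hj : j₀ ≤ j₁) (hn : j₁ ≤ n) (t : ℝ) :
    seqFun n τ (flip b θ i j₀ j₁ y) t = seqFun n τ y t -
      (P.coroot' (nodeIdx b θ i) (seqFun n τ y (min t (τ j₁))) -
        P.coroot' (nodeIdx b θ i) (seqFun n τ y (min t (τ j₀)))) • P.root (nodeIdx b θ i) := by
  rw [h.seqFun_min hn, h.seqFun_min (hj.trans hn)]
  have := seqFun_flip τ y (P.coroot' (nodeIdx b θ i)) (P.root (nodeIdx b θ i)) hj t n
  rw [min_eq_right hn, min_eq_right (hj.trans hn)] at this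
  exact this

lemma nodeHeight_zero : nodeHeight b θ i n τ y 0 = 0 := by
  rw [nodeHeight, h.zero, Rat.cast_zero, h.seqFun_zero, map_zero]

lemma height_seqPath {j : ℕ} (hj : j < n) {t : ℝ} (h0 : (τ j : ℝ) ≤ t) (h1 : t ≤ τ (j + 1)) :
    P.coroot' (nodeIdx b θ i) (seqFun n τ y t) =
      nodeHeight b θ i n τ y j + (t - τ j) * P.coroot' (nodeIdx b θ i) (y j) := by
  rw [h.seqFun_eq_add hj y h0 h1, map_add, map_smul, smul_eq_mul, nodeHeight]

lemma nodeHeight_succ {j : ℕ} (hj : j < n) : nodeHeight b θ i n τ y (j + 1) =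
    nodeHeight b θ i n τ y j + (τ (j + 1) - τ j) * P.coroot' (nodeIdx b θ i) (y j) :=
  height_seqPath h i hj (h.mono' (by omega) (by omega)) le_rfl

lemma nodeHeight_flip {j₀ j₁ : ℕ} (hj : j₀ ≤ j₁) (hn : j₁ ≤ n) {j : ℕ} (hjn : j ≤ n) :
    nodeHeight b θ i n τ (flip b θ i j₀ j₁ y) j = nodeHeight b θ i n τ y j -
      2 * (nodeHeight b θ i n τ y (min j j₁) - nodeHeight b θ i n τ y (min j j₀)) := by
  have hmin : ∀ k ≤ n, min (τ j : ℝ) (τ k) = τ (min j k) := by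
    intro k hk
    rcases le_total j k with h1 | h1
    · rw [min_eq_left h1, min_eq_left (h.mono' h1 hk)]
    · rw [min_eq_right h1, min_eq_right (h.mono' h1 hjn)]
  unfold nodeHeight
  rw [seqPath_flip h i hj hn, hmin _ hn, hmin _ (hj.trans hn), map_sub, map_smul]
  have : P.coroot' (nodeIdx b θ i) (P.root (nodeIdx b θ i)) = 2 := by simp
  rw [this, smul_eq_mul]; ring

lemma nodeHeight_flip_left {j₀ j₁ : ℕ} (hj : j₀ ≤ j₁) (hn : j₁ ≤ n) {j : ℕ} (hjn : j ≤ j₀) :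
    nodeHeight b θ i n τ (flip b θ i j₀ j₁ y) j = nodeHeight b θ i n τ y j := by
  rw [nodeHeight_flip h i hj hn (by omega), min_eq_left (by omega : j ≤ j₁), min_eq_left hjn]; ring

lemma nodeHeight_flip_mid {j₀ j₁ : ℕ} (hn : j₁ ≤ n) {j : ℕ} (h1 : j₀ ≤ j) (h2 : j ≤ j₁) :
    nodeHeight b θ i n τ (flip b θ i j₀ j₁ y) j =
      2 * nodeHeight b θ i n τ y j₀ - nodeHeight b θ i n τ y j := by
  rw [nodeHeight_flip h i (by omega) hn (by omega), min_eq_left h2, min_eq_right h1]; ring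

lemma nodeHeight_flip_right {j₀ j₁ : ℕ} (hj : j₀ ≤ j₁) {j : ℕ} (h1 : j₁ ≤ j) (h2 : j ≤ n) :
    nodeHeight b θ i n τ (flip b θ i j₀ j₁ y) j = nodeHeight b θ i n τ y j -
      2 * (nodeHeight b θ i n τ y j₁ - nodeHeight b θ i n τ y j₀) := by
  rw [nodeHeight_flip h i hj (by omega) h2, min_eq_right h1, min_eq_right (by omega : j₀ ≤ j)]

lemma height_eq (t : unitInterval) :
    height b θ i (seqPath n τ y) t = P.coroot' (nodeIdx b θ i) (seqFun n τ y t) :=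
  clPairing_eq _ _ _ _

lemma height_one : height b θ i (seqPath n τ y) 1 = nodeHeight b θ i n τ y n := by
  rw [height_eq h, nodeHeight, h.last]; simp

lemma le_height {m : ℝ} (hm : ∀ j ≤ n, m ≤ nodeHeight b θ i n τ y j) (t : unitInterval) :
    m ≤ height b θ i (seqPath n τ y) t := by
  rw [height_eq h]
  rcases t.2.1.eq_or_lt with h0 | h0
  · rw [← h0, h.seqFun_zero, map_zero, ← nodeHeight_zero h i (y := y)]
    exact hm 0 (by omega)
  · obtain ⟨j, -, hj, h1, h2⟩ := h.exists_mem_Ioc (Nat.zero_le n) (by rwa [h.zero, Rat.cast_zero])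
      (by rw [h.last]; simpa using t.2.2)
    have h3 := h.convex hj y (P.coroot' (nodeIdx b θ i)) h1.le h2
    have h4 := h.strict' (Nat.lt_succ_self j) hj
    have h5 := mul_le_mul_of_nonneg_left (hm j hj.le) (sub_nonneg.mpr h2)
    have h6 := mul_le_mul_of_nonneg_left (hm (j + 1) hj) (sub_nonneg.mpr h1.le)
    by_contra! h7
    have h8 := mul_lt_mul_of_pos_left h7 (sub_pos.mpr h4)
    simp only [nodeHeight, Nat.succ_eq_add_one] at h5 h6 h8
    linarith

lemma minHeight_eq {m : ℝ} (hm : ∀ j ≤ n, m ≤ nodeHeight b θ i n τ y j) {k : ℕ} (hk : k ≤ n)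
    (hkm : nodeHeight b θ i n τ y k = m) : minHeight b θ i (seqPath n τ y) = m := by
  refine IsLeast.csInf_eq ⟨⟨⟨τ k, h.mem_Icc hk⟩, ?_⟩, ?_⟩
  · rw [height_eq h, ← hkm]; rfl
  · rintro _ ⟨t, rfl⟩
    exact le_height h i hm t

end RootOperators

end

section

/-! ### Integral minima and monotone stretches of sequences of heights. -/

section HeightSequences

variable {n : ℕ} {H : ℕ → ℝ}

/-- The first minimum of `H` is an integer if `H` keeps decreasing at non-integral values. -/
lemma exists_int_min (hzero : ∃ z : ℤ, H 0 = z) (hlast : ∃ z : ℤ, H n = z)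
    (hneg : ∀ j, j + 1 < n → (¬ ∃ z : ℤ, H (j + 1) = z) → H (j + 1) < H j →
      H (j + 2) < H (j + 1)) :
    ∃ z : ℤ, (∃ j ≤ n, H j = z) ∧ ∀ j ≤ n, (z : ℝ) ≤ H j := by
  classical
  obtain ⟨k, hk, hmin⟩ := Finset.exists_min_image (Finset.range (n + 1)) H ⟨0, by simp⟩
  have hk' : k ≤ n := by simpa [Nat.lt_succ_iff] using hk
  have hex : ∃ j, j ≤ n ∧ H j = H k := ⟨k, hk', rfl⟩
  obtain ⟨h1, h2⟩ := Nat.find_spec hex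
  have h3 := fun j => Nat.find_min hex (m := j)
  generalize Nat.find hex = j at h1 h2 h3
  have hmin' : ∀ l ≤ n, H j ≤ H l := fun l hl => h2 ▸ hmin l (by simp; omega)
  by_cases hz : ∃ z : ℤ, H j = z
  · obtain ⟨z, hz⟩ := hz
    exact ⟨z, ⟨j, h1, hz⟩, fun l hl => hz ▸ hmin' l hl⟩
  -- A non-integral first minimum is entered by a strict descent, which then continues past it.
  · exfalso
    have hj0 : j ≠ 0 := by rintro rfl; exact hz hzero
    have hjn : j ≠ n := by rintro rfl; exact hz hlast
    obtain ⟨l, rfl⟩ := Nat.exists_eq_succ_of_ne_zero hj0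
    have h4 : H (l + 1) < H l := lt_of_le_of_ne (hmin' l (by omega)) fun he =>
      h3 l (by omega) ⟨by omega, he ▸ h2⟩
    exact absurd (hmin' (l + 2) (by omega)) (not_le.mpr (hneg l (by omega) hz h4))

lemma not_int_of_between {x : ℝ} {m : ℤ} (h1 : (m : ℝ) < x) (h2 : x < m + 1) :
    ¬ ∃ z : ℤ, x = z := by
  rintro ⟨z, rfl⟩
  have h3 : m < z := by exact_mod_cast h1
  have h4 : z < m + 1 := by exact_mod_cast h2
  omega

/-- Existence of the nodes between which `e_i` reflects; `H` decreases between them. -/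
lemma exists_eData {m : ℤ}
    (hneg : ∀ j, j + 1 < n → (¬ ∃ z : ℤ, H (j + 1) = z) → H (j + 1) < H j →
      H (j + 2) < H (j + 1))
    (hpos : ∀ j, j + 1 < n → (¬ ∃ z : ℤ, H (j + 1) = z) → H (j + 1) < H (j + 2) →
      H j < H (j + 1))
    (hint : ∀ j < n, ∀ z : ℤ, H (j + 1) < z → H j ≤ z)
    (hmin : ∀ j ≤ n, (m : ℝ) ≤ H j) (hex : ∃ j ≤ n, H j = m) (h0 : (m : ℝ) + 1 ≤ H 0) :
    ∃ j₀ j₁, EData n H m j₀ j₁ ∧ ∀ j, j₀ ≤ j → j < j₁ → H (j + 1) < H j := by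
  classical
  obtain ⟨h1, h2⟩ := Nat.find_spec hex
  have h3 := fun j => Nat.find_min hex (m := j)
  generalize Nat.find hex = j₁ at h1 h2 h3
  have hfirst : ∀ j < j₁, (m : ℝ) < H j := fun j hj =>
    lt_of_le_of_ne (hmin j (by omega)) fun he => h3 j hj ⟨by omega, he.symm⟩
  -- `j₀` is the last index up to `j₁` with height at least `m + 1`; equality follows since no
  -- integer is crossed inside a segment.
  have h4 := Nat.findGreatest_spec (P := fun j => (m : ℝ) + 1 ≤ H j) (Nat.zero_le j₁) h0
  have h5 := fun k => Nat.findGreatest_is_greatest (P := fun j => (m : ℝ) + 1 ≤ H j) (n := j₁)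
    (k := k)
  have h6 := Nat.findGreatest_le (P := fun j => (m : ℝ) + 1 ≤ H j) j₁
  generalize Nat.findGreatest (fun j => (m : ℝ) + 1 ≤ H j) j₁ = j₀ at h4 h5 h6
  have hlt : j₀ < j₁ := by
    refine lt_of_le_of_ne h6 ?_
    rintro rfl
    rw [h2] at h4; linarith
  have hlast : ∀ j, j₀ < j → j ≤ j₁ → H j < (m : ℝ) + 1 := fun j hj hj' =>
    not_le.mp (h5 j hj hj')
  have heq : H j₀ = (m : ℝ) + 1 := by
    refine le_antisymm ?_ h4
    have := hint j₀ (by omega) (m + 1) (by push_cast; exact hlast _ (by omega) (by omega))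
    exact_mod_cast this
  -- An ascent from a height strictly between `m` and `m + 1` would be preceded by another ascent,
  -- and so on back to the start, which lies at height at least `m + 1`.
  have hup : ∀ k, k < j₁ → H k < H (k + 1) → (m : ℝ) + 1 ≤ H k := by
    intro k
    induction k with
    | zero => intro _ _; exact h0
    | succ k ih =>
      intro hk hlt'
      by_contra! hcon
      have h7 := hpos k (by omega) (not_int_of_between (hfirst _ hk) hcon) hlt'
      linarith [ih (by omega) h7]
  refine ⟨j₀, j₁, ⟨hlt, h1, hmin, h2, hfirst, heq, hlast, ?_⟩, ?_⟩
  · intro j hj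
    obtain ⟨d, hd⟩ := Nat.exists_eq_add_of_le hj
    induction d generalizing j with
    | zero => obtain rfl : j₀ = j := by omega
              exact heq.ge
    | succ d ih =>
      by_contra! hcon
      exact absurd (hup j (by omega) (hcon.trans_le (ih (j + 1) (by omega) (by omega))))
        (not_le.mpr hcon)
  · intro j hj
    obtain ⟨d, rfl⟩ := Nat.exists_eq_add_of_le hj
    clear hj
    induction d with
    | zero => intro _; rw [add_zero, heq]; exact hlast _ (by omega) (by omega)
    | succ d ih =>
      intro hj
      exact hneg (j₀ + d) (by omega) (not_int_of_between (hfirst _ hj)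
        (hlast _ (by omega) hj.le)) (ih (by omega))

/-- Existence of the nodes between which `f_i` reflects; `H` increases between them. -/
lemma exists_fData {m : ℤ}
    (hneg : ∀ j, j + 1 < n → (¬ ∃ z : ℤ, H (j + 1) = z) → H (j + 1) < H j →
      H (j + 2) < H (j + 1))
    (hpos : ∀ j, j + 1 < n → (¬ ∃ z : ℤ, H (j + 1) = z) → H (j + 1) < H (j + 2) →
      H j < H (j + 1))
    (hint : ∀ j < n, ∀ z : ℤ, H j < z → H (j + 1) ≤ z)
    (hmin : ∀ j ≤ n, (m : ℝ) ≤ H j) (hex : ∃ j ≤ n, H j = m) (h0 : (m : ℝ) + 1 ≤ H n) :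
    ∃ j₀ j₁, FData n H m j₀ j₁ ∧ ∀ j, j₀ ≤ j → j < j₁ → H j < H (j + 1) := by
  -- Time reversal exchanges the two monotonicity hypotheses and turns the data for `f_i` into those
  -- for `e_i`.
  have key := exists_eData (n := n) (H := fun j => H (n - j)) (m := m) ?_ ?_ ?_ ?_ ?_ ?_
  · obtain ⟨k₀, k₁, hE, hd⟩ := key
    have hlt := hE.lt
    have hle := hE.le
    have hr : ∀ j ≤ n, n - (n - j) = j := fun j hj => Nat.sub_sub_self hj
    refine ⟨n - k₁, n - k₀, ⟨by omega, by omega, hmin, hE.eq, ?_, hE.eq', ?_, ?_⟩, ?_⟩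
    · intro j h1 h2
      have := hE.first (n - j) (by omega)
      rwa [hr j h2] at this
    · intro j h1 h2
      have := hE.last (n - j) (by omega) (by omega)
      rwa [hr j (by omega)] at this
    · intro j h1 h2
      have := hE.before (n - j) (by omega)
      rwa [hr j (by omega)] at this
    · intro j h1 h2
      have := hd (n - (j + 1)) (by omega) (by omega)
      rwa [hr (j + 1) (by omega), show n - (n - (j + 1) + 1) = j by omega] at this
  · intro j hj h1 h2
    obtain ⟨k, rfl⟩ : ∃ k, n = j + 2 + k := Nat.exists_eq_add_of_le (by omega)
    simp only [show j + 2 + k - (j + 1) = k + 1 by omega, show j + 2 + k - j = k + 2 by omega,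
      show j + 2 + k - (j + 2) = k by omega] at h1 h2 ⊢
    exact hpos k (by omega) h1 h2
  · intro j hj h1 h2
    obtain ⟨k, rfl⟩ : ∃ k, n = j + 2 + k := Nat.exists_eq_add_of_le (by omega)
    simp only [show j + 2 + k - (j + 1) = k + 1 by omega, show j + 2 + k - j = k + 2 by omega,
      show j + 2 + k - (j + 2) = k by omega] at h1 h2 ⊢
    exact hneg k (by omega) h1 h2
  · intro j hj z h1
    obtain ⟨k, rfl⟩ : ∃ k, n = j + 1 + k := Nat.exists_eq_add_of_le (by omega)
    simp only [show j + 1 + k - (j + 1) = k by omega, show j + 1 + k - j = k + 1 by omega] at h1 ⊢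
    exact hint k (by omega) z h1
  · intro j _
    exact hmin _ (by omega)
  · obtain ⟨j, hj, he⟩ := hex
    exact ⟨n - j, by omega, by simpa only [Nat.sub_sub_self hj] using he⟩
  · simpa using h0

end HeightSequences

/-! ### Root operators as reflections of directions between two nodes. -/

section RootOperators

variable {n : ℕ} {τ : ℕ → ℚ} {y : ℕ → M}

variable (h : IsNodes n τ) (i : AffNode b)
include h

lemma rootE_seqPath {m : ℝ} {j₀ j₁ : ℕ} (hE : EData n (nodeHeight b θ i n τ y) m j₀ j₁)
    (hm : m ≤ -1) :
    rootE b θ i (seqPath n τ y) = some (seqPath n τ (flip b θ i j₀ j₁ y)) := by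
  have hj0 := hE.lt.le.trans hE.le
  have hmin : minHeight b θ i (seqPath n τ y) = m := minHeight_eq h i hE.min hE.le hE.eq
  have ht1 : sInf {t | height b θ i (seqPath n τ y) t = m} = ⟨τ j₁, h.mem_Icc hE.le⟩ := by
    refine IsLeast.csInf_eq ⟨?_, fun t ht => ?_⟩
    · rw [Set.mem_ofPred_eq, height_eq h]; exact hE.eq
    · rw [Set.mem_ofPred_eq, height_eq h] at ht
      by_contra! hlt
      refine absurd ht (h.lt_seqFun_left y (P.coroot' (nodeIdx b θ i)) (Nat.zero_le j₁) hE.le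
        hE.eq.ge (fun j _ hj => hE.first j hj) ?_ hlt).ne'
      rw [h.zero, Rat.cast_zero]; exact t.2.1
  have ht0 : sSup {t | t ≤ (⟨τ j₁, h.mem_Icc hE.le⟩ : unitInterval) ∧
      height b θ i (seqPath n τ y) t = m + 1} = ⟨τ j₀, h.mem_Icc hj0⟩ := by
    refine IsGreatest.csSup_eq ⟨⟨h.mono' hE.lt.le hE.le, ?_⟩, fun t ht => ?_⟩
    · rw [height_eq h]; exact hE.eq'
    · obtain ⟨ht', ht⟩ := ht
      rw [height_eq h] at ht
      by_contra! hlt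
      have := h.lt_seqFun_right y (-P.coroot' (nodeIdx b θ i)) (m := -(m + 1)) hE.lt.le hE.le
        (neg_le_neg hE.eq'.le) (fun j h1 h2 => neg_lt_neg (hE.last j h1 h2)) hlt ht'
      simp only [LinearMap.neg_apply] at this
      linarith
  unfold rootE
  simp only [hmin, ht1, ht0, if_pos hm]
  congr 1
  ext t
  have hflip := seqPath_flip h i (b := b) (θ := θ) (y := y) hE.lt.le hE.le t
  change _ = seqFun n τ (flip b θ i j₀ j₁ y) t
  rw [hflip]
  rcases le_or_gt t ⟨τ j₀, h.mem_Icc hj0⟩ with h1 | h1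
  · rw [if_pos h1, min_eq_left (a := (t : ℝ)) (b := τ j₀) h1,
      min_eq_left (le_trans (α := ℝ) h1 (h.mono' hE.lt.le hE.le)), sub_self, zero_smul, sub_zero]
    rfl
  · rw [if_neg (not_le.mpr h1), min_eq_right (a := (t : ℝ)) (b := τ j₀) (le_of_lt h1)]
    rcases le_or_gt t ⟨τ j₁, h.mem_Icc hE.le⟩ with h2 | h2
    · rw [if_pos h2, min_eq_left (a := (t : ℝ)) (b := τ j₁) h2, clRefl_eq, reflection_apply',
        map_sub]
      simp only [seqPath]
      module
    · rw [if_neg (not_le.mpr h2), min_eq_right (a := (t : ℝ)) (b := τ j₁) (le_of_lt h2)]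
      have e0 : P.coroot' (nodeIdx b θ i) (seqFun n τ y (τ j₀)) = m + 1 := hE.eq'
      have e1 : P.coroot' (nodeIdx b θ i) (seqFun n τ y (τ j₁)) = m := hE.eq
      rw [e0, e1, clRoot_eq]
      simp only [seqPath]
      module

lemma rootF_seqPath {m : ℝ} {j₀ j₁ : ℕ} (hF : FData n (nodeHeight b θ i n τ y) m j₀ j₁) :
    rootF b θ i (seqPath n τ y) = some (seqPath n τ (flip b θ i j₀ j₁ y)) := by
  have hj0 := hF.lt.le.trans hF.le
  have hmin : minHeight b θ i (seqPath n τ y) = m := minHeight_eq h i hF.min hj0 hF.eq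
  have ht0 : sSup {t | height b θ i (seqPath n τ y) t = m} = ⟨τ j₀, h.mem_Icc hj0⟩ := by
    refine IsGreatest.csSup_eq ⟨?_, fun t ht => ?_⟩
    · rw [Set.mem_ofPred_eq, height_eq h]; exact hF.eq
    · rw [Set.mem_ofPred_eq, height_eq h] at ht
      by_contra! hlt
      refine absurd ht (h.lt_seqFun_right y (P.coroot' (nodeIdx b θ i)) hj0 le_rfl
        hF.eq.ge hF.last hlt ?_).ne'
      rw [h.last, Rat.cast_one]; exact t.2.2
  have ht1 : sInf {t | (⟨τ j₀, h.mem_Icc hj0⟩ : unitInterval) ≤ t ∧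
      height b θ i (seqPath n τ y) t = m + 1} = ⟨τ j₁, h.mem_Icc hF.le⟩ := by
    refine IsLeast.csInf_eq ⟨⟨h.mono' hF.lt.le hF.le, ?_⟩, fun t ht => ?_⟩
    · rw [height_eq h]; exact hF.eq'
    · obtain ⟨ht', ht⟩ := ht
      rw [height_eq h] at ht
      by_contra! hlt
      have := h.lt_seqFun_left y (-P.coroot' (nodeIdx b θ i)) (m := -(m + 1)) hF.lt.le hF.le
        (neg_le_neg hF.eq'.le) (fun j h1 h2 => neg_lt_neg (hF.first j h1 h2)) ht' hlt
      simp only [LinearMap.neg_apply] at this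
      linarith
  have hm : 1 ≤ height b θ i (seqPath n τ y) 1 - m := by
    rw [height_one h]; linarith [hF.after n hF.le le_rfl]
  unfold rootF
  simp only [hmin, ht0, ht1, if_pos hm]
  congr 1
  ext t
  have hflip := seqPath_flip h i (b := b) (θ := θ) (y := y) hF.lt.le hF.le t
  change _ = seqFun n τ (flip b θ i j₀ j₁ y) t
  rw [hflip]
  rcases le_or_gt t ⟨τ j₀, h.mem_Icc hj0⟩ with h1 | h1
  · rw [if_pos h1, min_eq_left (a := (t : ℝ)) (b := τ j₀) h1,
      min_eq_left (le_trans (α := ℝ) h1 (h.mono' hF.lt.le hF.le)), sub_self, zero_smul, sub_zero]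
    rfl
  · rw [if_neg (not_le.mpr h1), min_eq_right (a := (t : ℝ)) (b := τ j₀) (le_of_lt h1)]
    rcases le_or_gt t ⟨τ j₁, h.mem_Icc hF.le⟩ with h2 | h2
    · rw [if_pos h2, min_eq_left (a := (t : ℝ)) (b := τ j₁) h2, clRefl_eq, reflection_apply',
        map_sub]
      simp only [seqPath]
      module
    · rw [if_neg (not_le.mpr h2), min_eq_right (a := (t : ℝ)) (b := τ j₁) (le_of_lt h2)]
      have e0 : P.coroot' (nodeIdx b θ i) (seqFun n τ y (τ j₀)) = m := hF.eq
      have e1 : P.coroot' (nodeIdx b θ i) (seqFun n τ y (τ j₁)) = m + 1 := hF.eq'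
      rw [e0, e1, clRoot_eq]
      simp only [seqPath]
      module

/-- Between the two nodes the graph of `H_i` is mirrored at height `m + 1`, and afterwards it is
raised by two. The same nodes then serve for `f_i`, so `f_i` undoes `e_i`. -/
lemma EData.flip {m : ℝ} {j₀ j₁ : ℕ} (hE : EData n (nodeHeight b θ i n τ y) m j₀ j₁) :
    FData n (nodeHeight b θ i n τ (flip b θ i j₀ j₁ y)) (m + 1) j₀ j₁ := by
  have hl := fun j (hj : j ≤ j₀) => nodeHeight_flip_left (b := b) (θ := θ) h i (y := y) hE.lt.le hE.le hj
  have hm := fun j (h1 : j₀ ≤ j) (h2 : j ≤ j₁) =>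
    nodeHeight_flip_mid (b := b) (θ := θ) h i (y := y) hE.le h1 h2
  have hr := fun j (h1 : j₁ ≤ j) (h2 : j ≤ n) =>
    nodeHeight_flip_right (b := b) (θ := θ) h i (y := y) hE.lt.le h1 h2
  simp only [hE.eq, hE.eq'] at hm hr
  have hlast : ∀ j, j₀ < j → j ≤ n →
      m + 1 < nodeHeight b θ i n τ (LevelZeroLS.flip b θ i j₀ j₁ y) j := by
    intro j h1 h2
    rcases le_total j j₁ with h3 | h3
    · rw [hm j h1.le h3]; linarith [hE.last j h1 h3]
    · rw [hr j h3 h2]; linarith [hE.min j h2]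
  have heq : nodeHeight b θ i n τ (LevelZeroLS.flip b θ i j₀ j₁ y) j₀ = m + 1 := by
    rw [hl j₀ le_rfl, hE.eq']
  refine ⟨hE.lt, hE.le, fun j hj => ?_, heq, hlast, ?_, ?_, ?_⟩
  · rcases le_or_gt j j₀ with h1 | h1
    · rw [hl j h1]; exact hE.before j h1
    · exact (hlast j h1 hj).le
  · rw [hm j₁ hE.lt.le le_rfl, hE.eq]; ring
  · intro j h1 h2
    rw [hm j h1 h2.le]; linarith [hE.first j h2]
  · intro j h1 h2
    rw [hr j h1 h2]; linarith [hE.min j h2]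

/-- The graph is mirrored at height `m` between the nodes and lowered by two afterwards. -/
lemma FData.flip {m : ℝ} {j₀ j₁ : ℕ} (hF : FData n (nodeHeight b θ i n τ y) m j₀ j₁) :
    EData n (nodeHeight b θ i n τ (flip b θ i j₀ j₁ y)) (m - 1) j₀ j₁ := by
  have hl := fun j (hj : j ≤ j₀) => nodeHeight_flip_left (b := b) (θ := θ) h i (y := y) hF.lt.le hF.le hj
  have hm := fun j (h1 : j₀ ≤ j) (h2 : j ≤ j₁) =>
    nodeHeight_flip_mid (b := b) (θ := θ) h i (y := y) hF.le h1 h2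
  have hr := fun j (h1 : j₁ ≤ j) (h2 : j ≤ n) =>
    nodeHeight_flip_right (b := b) (θ := θ) h i (y := y) hF.lt.le h1 h2
  simp only [hF.eq, hF.eq'] at hm hr
  have hj0 := hF.lt.le.trans hF.le
  have hfirst : ∀ j < j₁,
      m - 1 < nodeHeight b θ i n τ (LevelZeroLS.flip b θ i j₀ j₁ y) j := by
    intro j h1
    rcases le_total j j₀ with h3 | h3
    · rw [hl j h3]; linarith [hF.min j (by omega)]
    · rw [hm j h3 h1.le]; linarith [hF.first j h3 h1]
  have heq : nodeHeight b θ i n τ (LevelZeroLS.flip b θ i j₀ j₁ y) j₁ = m - 1 := by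
    rw [hm j₁ hF.lt.le le_rfl, hF.eq']; ring
  refine ⟨hF.lt, hF.le, fun j hj => ?_, heq, hfirst, ?_, ?_, ?_⟩
  · rcases lt_or_ge j j₁ with h1 | h1
    · exact (hfirst j h1).le
    · rw [hr j h1 hj]; linarith [hF.after j h1 hj]
  · rw [hl j₀ le_rfl, hF.eq]; ring
  · intro j h1 h2
    rw [hm j h1.le h2]; linarith [hF.last j h1 (h2.trans hF.le)]
  · intro j h1
    rw [hl j h1]; linarith [hF.min j (by omega)]

end RootOperators

end

section

/-! ### Paths with directions joined by edges, and their stability under reflection. -/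

section

variable [Fintype ι] [P.IsCrystallographic] [P.IsReduced] [P.IsRootSystem]
  {lam : M} {n : ℕ} {τ : ℕ → ℚ} {y : ℕ → M}

/-- The data of a piecewise linear path with directions in `W lam` such that consecutive
directions are joined by chains of edges subject to the integrality condition. -/
structure Rep (b : P.Base) (lam : M) (n : ℕ) (τ : ℕ → ℚ) (y : ℕ → M) : Prop where
  nodes : IsNodes n τ
  mem : ∀ j < n, ∃ w : P.weylGroup, y j = w • lam
  up : ∀ j, j + 1 < n → Up b (τ (j + 1)) (y (j + 1)) (y j)

lemma exists_coroot'_smul_eq_intCast (hlam : IsDominantIntegral b lam) (w : P.weylGroup) (a : ι) :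
    ∃ z : ℤ, P.coroot' a (w • lam) = z := by
  rw [coroot'_smul]
  refine exists_coroot'_eq_intCast (b := b) (fun i hi => ?_) _
  obtain ⟨k, hk⟩ := hlam i hi
  exact ⟨k, by rw [hk]; simp⟩

namespace Rep

variable (R : Rep b lam n τ y)
include R

lemma exists_slope_eq_intCast (hlam : IsDominantIntegral b lam) (a : ι) {j : ℕ} (hj : j < n) :
    ∃ z : ℤ, P.coroot' a (y j) = z := by
  obtain ⟨w, hw⟩ := R.mem j hj
  rw [hw]
  exact exists_coroot'_smul_eq_intCast hlam w a

/-- At each node the jump of the slope, multiplied by the node, is an integer. Hence `H_i` is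
integral at a node exactly when the node times the adjacent slope is, which is the condition on
`r_i`-edges. -/
lemma exists_sub_eq_intCast (i : AffNode b) {j : ℕ} (hj : j < n) :
    ∃ z : ℤ, nodeHeight b θ i n τ y j - τ j * P.coroot' (nodeIdx b θ i) (y j) = z := by
  induction j with
  | zero => exact ⟨0, by rw [nodeHeight_zero R.nodes, R.nodes.zero]; simp⟩
  | succ j ih =>
    obtain ⟨z, hz⟩ := ih (by omega)
    obtain ⟨z', hz'⟩ := (R.up j hj).sub_integral (nodeIdx b θ i)
    refine ⟨z - z', ?_⟩
    rw [nodeHeight_succ R.nodes i (by omega : j < n)]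
    push_cast
    linarith

lemma exists_sub_eq_intCast' (i : AffNode b) {j : ℕ} (hj : j < n) :
    ∃ z : ℤ, nodeHeight b θ i n τ y (j + 1) - τ (j + 1) * P.coroot' (nodeIdx b θ i) (y j) = z := by
  obtain ⟨z, hz⟩ := R.exists_sub_eq_intCast (θ := θ) i hj
  exact ⟨z, by rw [nodeHeight_succ R.nodes i hj]; linarith⟩

lemma exists_last_eq_intCast (hlam : IsDominantIntegral b lam) (i : AffNode b) :
    ∃ z : ℤ, nodeHeight b θ i n τ y n = z := by
  obtain ⟨k, rfl⟩ := Nat.exists_eq_succ_of_ne_zero R.nodes.pos.ne'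
  obtain ⟨z, hz⟩ := R.exists_sub_eq_intCast' (θ := θ) i (Nat.lt_succ_self k)
  obtain ⟨z', hz'⟩ := R.exists_slope_eq_intCast hlam (nodeIdx b θ i) (Nat.lt_succ_self k)
  refine ⟨z + z', ?_⟩
  have hl := R.nodes.last
  simp only [Nat.succ_eq_add_one] at hl ⊢
  rw [hl] at hz
  push_cast at hz ⊢
  linarith

lemma nodeHeight_lt_iff (i : AffNode b) {j : ℕ} (hj : j < n) :
    nodeHeight b θ i n τ y (j + 1) < nodeHeight b θ i n τ y j ↔
      P.coroot' (nodeIdx b θ i) (y j) < 0 := by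
  have h1 : (0 : ℝ) < τ (j + 1) - τ j := sub_pos.mpr (R.nodes.strict' (Nat.lt_succ_self j) hj)
  rw [nodeHeight_succ R.nodes i hj, add_lt_iff_neg_left]
  exact smul_neg_iff_of_pos_left h1

lemma lt_nodeHeight_iff (i : AffNode b) {j : ℕ} (hj : j < n) :
    nodeHeight b θ i n τ y j < nodeHeight b θ i n τ y (j + 1) ↔
      0 < P.coroot' (nodeIdx b θ i) (y j) := by
  have h1 : (0 : ℝ) < τ (j + 1) - τ j := sub_pos.mpr (R.nodes.strict' (Nat.lt_succ_self j) hj)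
  rw [nodeHeight_succ R.nodes i hj, lt_add_iff_pos_right, mul_pos_iff_of_pos_left h1]

lemma sign_le (hθ : IsHighestRoot b θ) (i : AffNode b) {j : ℕ} (hj : j + 1 < n)
    (hint : ¬ ∃ z : ℤ, nodeHeight b θ i n τ y (j + 1) = z) :
    Real.sign (P.coroot' (nodeIdx b θ i) (y (j + 1))) ≤
        Real.sign (P.coroot' (nodeIdx b θ i) (y j)) ∧
      (Real.sign (P.coroot' (nodeIdx b θ i) (y (j + 1))) =
          Real.sign (P.coroot' (nodeIdx b θ i) (y j)) →
        Up b (τ (j + 1)) (P.reflection (nodeIdx b θ i) (y (j + 1)))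
          (P.reflection (nodeIdx b θ i) (y j))) := by
  refine (R.up j hj).sign_le hθ i fun ⟨z, hz⟩ => hint ?_
  obtain ⟨z', hz'⟩ := R.exists_sub_eq_intCast (θ := θ) i hj
  exact ⟨z' + z, by push_cast; linarith⟩

lemma neg_step (hθ : IsHighestRoot b θ) (i : AffNode b) {j : ℕ} (hj : j + 1 < n)
    (hint : ¬ ∃ z : ℤ, nodeHeight b θ i n τ y (j + 1) = z)
    (h : nodeHeight b θ i n τ y (j + 1) < nodeHeight b θ i n τ y j) :
    nodeHeight b θ i n τ y (j + 2) < nodeHeight b θ i n τ y (j + 1) := by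
  rw [R.nodeHeight_lt_iff i (by omega)] at h ⊢
  exact neg_of_sign_le (R.sign_le hθ i hj hint).1 h

lemma pos_step (hθ : IsHighestRoot b θ) (i : AffNode b) {j : ℕ} (hj : j + 1 < n)
    (hint : ¬ ∃ z : ℤ, nodeHeight b θ i n τ y (j + 1) = z)
    (h : nodeHeight b θ i n τ y (j + 1) < nodeHeight b θ i n τ y (j + 2)) :
    nodeHeight b θ i n τ y j < nodeHeight b θ i n τ y (j + 1) := by
  rw [R.lt_nodeHeight_iff i (by omega)] at h ⊢
  exact pos_of_sign_le (R.sign_le hθ i hj hint).1 h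

/-- Connecting paths have to be rebuilt at the left end, in the interior and at the right end of the
reflected stretch; the others are unchanged. -/
lemma flip (i : AffNode b) {j₀ j₁ : ℕ}
    (hl : ∀ j, j + 1 = j₀ → j + 1 < n →
      Up b (τ (j + 1)) (P.reflection (nodeIdx b θ i) (y (j + 1))) (y j))
    (hm : ∀ j, j₀ ≤ j → j + 1 < j₁ → j + 1 < n → Up b (τ (j + 1))
      (P.reflection (nodeIdx b θ i) (y (j + 1))) (P.reflection (nodeIdx b θ i) (y j)))
    (hr : ∀ j, j + 1 = j₁ → j + 1 < n →
      Up b (τ (j + 1)) (y (j + 1)) (P.reflection (nodeIdx b θ i) (y j))) :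
    Rep b lam n τ (flip b θ i j₀ j₁ y) := by
  refine ⟨R.nodes, fun j hjn => ?_, fun j hjn => ?_⟩
  · obtain ⟨w, hw⟩ := R.mem j hjn
    unfold LevelZeroLS.flip
    split_ifs
    · exact ⟨RootPairing.weylGroup.ofIdx P (nodeIdx b θ i) * w, by rw [mul_smul, ofIdx_smul, hw]⟩
    · exact ⟨w, hw⟩
  · unfold LevelZeroLS.flip
    split_ifs with h1 h2 h2
    · exact hm j h2.1 h1.2 hjn
    · exact hl j (by omega) hjn
    · exact hr j (by omega) hjn
    · exact R.up j hjn

/-- `H_i` attains its minimum at a node, and the minimum is a non-positive integer. -/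
lemma exists_min (hθ : IsHighestRoot b θ) (hlam : IsDominantIntegral b lam) (i : AffNode b) :
    ∃ z : ℤ, (∃ j ≤ n, nodeHeight b θ i n τ y j = z) ∧
      ∀ j ≤ n, (z : ℝ) ≤ nodeHeight b θ i n τ y j :=
  exists_int_min ⟨0, by rw [nodeHeight_zero R.nodes]; simp⟩ (R.exists_last_eq_intCast hlam i)
    fun _ hj hint h => R.neg_step hθ i hj hint h

lemma exists_eData (hθ : IsHighestRoot b θ) (i : AffNode b)
    (hint : ∀ j < n, ∀ z : ℤ, nodeHeight b θ i n τ y (j + 1) < z → nodeHeight b θ i n τ y j ≤ z)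
    {m : ℤ} (hmin : ∀ j ≤ n, (m : ℝ) ≤ nodeHeight b θ i n τ y j)
    (hex : ∃ j ≤ n, nodeHeight b θ i n τ y j = m) (hm : m ≤ -1) :
    ∃ j₀ j₁, EData n (nodeHeight b θ i n τ y) m j₀ j₁ ∧
      Rep b lam n τ (LevelZeroLS.flip b θ i j₀ j₁ y) := by
  have h0 : (m : ℝ) + 1 ≤ nodeHeight b θ i n τ y 0 := by
    rw [nodeHeight_zero R.nodes]
    have : (m : ℝ) ≤ -1 := by exact_mod_cast hm
    linarith
  obtain ⟨j₀, j₁, hE, hd⟩ := LevelZeroLS.exists_eData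
    (fun _ hj hint h => R.neg_step hθ i hj hint h)
    (fun _ hj hint h => R.pos_step hθ i hj hint h) hint hmin hex h0
  have hd' : ∀ j, j₀ ≤ j → j < j₁ → P.coroot' (nodeIdx b θ i) (y j) < 0 := fun j h1 h2 =>
    (R.nodeHeight_lt_iff i (h2.trans_le hE.le)).mp (hd j h1 h2)
  refine ⟨j₀, j₁, hE, R.flip i ?_ ?_ ?_⟩
  -- At the left node `H_i` has the integral value `m + 1`, so prepending an `r_i`-edge is allowed.
  · rintro j rfl hj
    refine (R.up j hj).reflection_left_of_neg hθ i (hd' _ le_rfl hE.lt) ?_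
    obtain ⟨z, hz⟩ := R.exists_sub_eq_intCast (θ := θ) i hj
    rw [hE.eq'] at hz
    exact ⟨m + 1 - z, by push_cast; linarith⟩
  · intro j h1 h2 hj
    refine (R.sign_le hθ i hj ?_).2 ?_
    · exact not_int_of_between (hE.first _ h2) (hE.last _ (by omega) h2.le)
    · rw [Real.sign_of_neg (hd' _ h1 (by omega)), Real.sign_of_neg (hd' _ (by omega) h2)]
  -- At the minimum the next slope is nonnegative and the previous one negative, so the connecting
  -- path contains an `r_i`-edge that can be deleted.
  · rintro j rfl hj
    refine (R.up j hj).reflection_right hθ i ?_ (hd' j (by have := hE.lt; omega) (by omega))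
    by_contra! hcon
    rw [← R.nodeHeight_lt_iff i hj, hE.eq] at hcon
    exact absurd (hE.min (j + 2) hj) (not_le.mpr hcon)

lemma exists_fData (hθ : IsHighestRoot b θ) (i : AffNode b)
    (hint : ∀ j < n, ∀ z : ℤ, nodeHeight b θ i n τ y j < z → nodeHeight b θ i n τ y (j + 1) ≤ z)
    {m : ℤ} (hmin : ∀ j ≤ n, (m : ℝ) ≤ nodeHeight b θ i n τ y j)
    (hex : ∃ j ≤ n, nodeHeight b θ i n τ y j = m)
    (hm : (m : ℝ) + 1 ≤ nodeHeight b θ i n τ y n) :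
    ∃ j₀ j₁, FData n (nodeHeight b θ i n τ y) m j₀ j₁ ∧
      Rep b lam n τ (LevelZeroLS.flip b θ i j₀ j₁ y) := by
  obtain ⟨j₀, j₁, hF, hd⟩ := LevelZeroLS.exists_fData
    (fun _ hj hint h => R.neg_step hθ i hj hint h)
    (fun _ hj hint h => R.pos_step hθ i hj hint h) hint hmin hex hm
  have hd' : ∀ j, j₀ ≤ j → j < j₁ → 0 < P.coroot' (nodeIdx b θ i) (y j) := fun j h1 h2 =>
    (R.lt_nodeHeight_iff i (h2.trans_le hF.le)).mp (hd j h1 h2)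
  refine ⟨j₀, j₁, hF, R.flip i ?_ ?_ ?_⟩
  · rintro j rfl hj
    refine (R.up j hj).reflection_left hθ i (hd' _ le_rfl hF.lt) ?_
    by_contra! hcon
    rw [← R.lt_nodeHeight_iff i (by omega), hF.eq] at hcon
    exact absurd (hF.min j (by omega)) (not_le.mpr hcon)
  · intro j h1 h2 hj
    refine (R.sign_le hθ i hj ?_).2 ?_
    · exact not_int_of_between (hF.last _ (by omega) hj.le) (hF.first _ (by omega) h2)
    · rw [Real.sign_of_pos (hd' _ h1 (by omega)), Real.sign_of_pos (hd' _ (by omega) h2)]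
  · rintro j rfl hj
    refine (R.up j hj).reflection_right_of_pos hθ i
      (hd' j (by have := hF.lt; omega) (by omega)) ?_
    obtain ⟨z, hz⟩ := R.exists_sub_eq_intCast' (θ := θ) i (by omega : j < n)
    rw [hF.eq'] at hz
    exact ⟨m + 1 - z, by push_cast; linarith⟩

end Rep

end

end

section

/-! ### Refinement to a grid on which `H_i` takes integral values only at nodes -/

/-- The grid size is divisible by all denominators of nodes, so cells lie in single segments, and by
all nonzero slopes, so integral values of the height fall on grid points. -/
lemma exists_common_denominator (n : ℕ) (τ : ℕ → ℚ) (p : ℕ → ℤ) :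
    ∃ d : ℕ, 0 < d ∧ (∀ j ≤ n, ∃ a : ℤ, τ j * d = a) ∧
      ∀ k < n, p k ≠ 0 → ∃ q : ℤ, (d : ℤ) = p k * q := by
  refine ⟨(∏ j ∈ Finset.range (n + 1), (τ j).den) *
    ∏ k ∈ Finset.range n, (if p k = 0 then 1 else (p k).natAbs), ?_, ?_, ?_⟩
  · refine Nat.mul_pos (Finset.prod_pos fun j _ => (τ j).den_pos) (Finset.prod_pos fun k _ => ?_)
    split_ifs with h
    · exact Nat.one_pos
    · exact Int.natAbs_pos.mpr h
  · intro j hj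
    have hd : (τ j).den ∣ ∏ j ∈ Finset.range (n + 1), (τ j).den :=
      Finset.dvd_prod_of_mem (fun j => (τ j).den) (Finset.mem_range.mpr (by omega))
    obtain ⟨c, hc⟩ := hd.mul_right (∏ k ∈ Finset.range n, (if p k = 0 then 1 else (p k).natAbs))
    refine ⟨(τ j).num * c, ?_⟩
    rw [hc]
    push_cast
    rw [← mul_assoc, Rat.mul_den_eq_num]
  · intro k hk hpk
    have hd : (p k).natAbs ∣ ∏ k ∈ Finset.range n, (if p k = 0 then 1 else (p k).natAbs) := by
      have := Finset.dvd_prod_of_mem (fun k => if p k = 0 then 1 else (p k).natAbs)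
        (Finset.mem_range.mpr hk)
      simpa only [if_neg hpk] using this
    exact Int.natAbs_dvd.mp (Int.natCast_dvd_natCast.mpr
      (hd.mul_left (∏ j ∈ Finset.range (n + 1), (τ j).den)))

lemma isNodes_grid {d : ℕ} (hd : 0 < d) : IsNodes d (fun l => (l : ℚ) / d) := by
  have hd' : (0 : ℚ) < d := by exact_mod_cast hd
  refine ⟨by simp, div_self hd'.ne', fun j _ => ?_⟩
  push_cast
  exact (div_lt_div_iff_of_pos_right hd').mpr (by linarith)

/-- If all nodes have denominator `d`, then each cell of the grid `d⁻¹ ℤ` lies in a segment. -/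
lemma IsNodes.exists_segment {n : ℕ} {τ : ℕ → ℚ} (h : IsNodes n τ) {d : ℕ} (hd : 0 < d)
    (hden : ∀ j ≤ n, ∃ a : ℤ, τ j * d = a) {l : ℕ} (hl : l < d) :
    ∃ k < n, τ k ≤ (l : ℚ) / d ∧ ((l + 1 : ℕ) : ℚ) / d ≤ τ (k + 1) := by
  have hd' : (0 : ℚ) < d := by exact_mod_cast hd
  have h1 : ((l : ℚ) / d) < 1 := (div_lt_one hd').mpr (by exact_mod_cast hl)
  obtain ⟨k, -, hk, h2, h3⟩ := h.exists_mem_Ico (t := (((l : ℚ) / d : ℚ) : ℝ)) (Nat.zero_le n)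
    (by rw [h.zero]; exact_mod_cast (by positivity : (0 : ℚ) ≤ (l : ℚ) / d))
    (by rw [h.last]; exact_mod_cast h1)
  refine ⟨k, hk, by exact_mod_cast h2, ?_⟩
  have h4 : (l : ℚ) / d < τ (k + 1) := by exact_mod_cast h3
  obtain ⟨a, ha⟩ := hden (k + 1) hk
  rw [div_lt_iff₀ hd', ha] at h4
  rw [div_le_iff₀ hd', ha]
  have h5 : (l : ℤ) < a := by exact_mod_cast h4
  exact_mod_cast h5

section

variable [Fintype ι] [P.IsCrystallographic] [P.IsReduced] [P.IsRootSystem]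
  {lam : M} {n : ℕ} {τ : ℕ → ℚ} {y : ℕ → M}

lemma Rep.exists_grid (R : Rep b lam n τ y) {d : ℕ} (hd : 0 < d)
    (hden : ∀ j ≤ n, ∃ a : ℤ, τ j * d = a) :
    ∃ k : ℕ → ℕ, (∀ l < d, k l < n ∧ τ (k l) ≤ (l : ℚ) / d ∧
        ((l + 1 : ℕ) : ℚ) / d ≤ τ (k l + 1)) ∧
      Rep b lam d (fun l => (l : ℚ) / d) (fun l => y (k l)) ∧
      ∀ t ∈ unitInterval, seqFun n τ y t = seqFun d (fun l => (l : ℚ) / d) (fun l => y (k l)) t := by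
  have hd' : (0 : ℚ) < d := by exact_mod_cast hd
  have hseg := fun l (hl : l < d) => R.nodes.exists_segment hd hden hl
  choose! k hk1 hk2 hk3 using hseg
  refine ⟨k, fun l hl => ⟨hk1 l hl, hk2 l hl, hk3 l hl⟩,
    ⟨isNodes_grid hd, fun l hl => R.mem _ (hk1 l hl), fun l hl => ?_⟩, fun t ht => ?_⟩
  · have h1 := hk2 (l + 1) hl
    have h2 := hk3 l (by omega)
    have h3 := hk2 l (by omega)
    have h4 := hk3 (l + 1) hl
    have h5 := hk1 l (by omega)
    have h6 := hk1 (l + 1) hl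
    have h7 : k (l + 1) ≤ k l + 1 := by
      by_contra! hcon
      exact absurd (h1.trans h2) (not_le.mpr (R.nodes.strict hcon h6.le))
    have h8 : k l ≤ k (l + 1) := by
      by_contra! hcon
      have h9 := R.nodes.mono (show k (l + 1) + 1 ≤ k l by omega) h5.le
      have h10 : (l : ℚ) / d < ((l + 1 + 1 : ℕ) : ℚ) / d := by
        refine (div_lt_div_iff_of_pos_right hd').mpr ?_
        push_cast
        linarith
      exact absurd ((h4.trans h9).trans h3) (not_le.mpr h10)
    -- Consecutive cells either lie in one segment, where the trivial path suffices, or meet at an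
    -- original node, where the given path is used.
    rcases h8.eq_or_lt with h9 | h9
    · rw [h9]; exact Relation.ReflTransGen.refl
    · have h10 : k (l + 1) = k l + 1 := by omega
      rw [h10] at h1 h6 ⊢
      have h11 := R.up (k l) h6
      rwa [le_antisymm h1 h2] at h11
  · refine (isNodes_grid hd).eq_seqFun _ _ (R.nodes.seqFun_zero y) (fun l hl t h0 h1 => ?_) ht
    have h2 : (τ (k l) : ℝ) ≤ ((l : ℚ) / d : ℚ) := by exact_mod_cast hk2 l hl
    have h3 : (((((l + 1 : ℕ) : ℚ) / d) : ℚ) : ℝ) ≤ τ (k l + 1) := by exact_mod_cast hk3 l hl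
    rw [R.nodes.seqFun_eq_add (hk1 l hl) y (h2.trans h0) (h1.trans h3),
      R.nodes.seqFun_eq_add (hk1 l hl) y h2 ((h0.trans h1).trans h3)]
    module

/-- With `d = p q` the heights at the ends of the cell are `h + l / q` and `h + (l + 1) / q`. An
integer strictly between them would give an integer strictly between `l` and `l + 1`. -/
lemma not_between {p q h z : ℤ} {d l : ℕ} (hd : (0 : ℝ) < d) (hpq : p ≠ 0 → (d : ℤ) = p * q) :
    ¬ ((h + (l : ℝ) / d * p < z ∧ z < h + ((l + 1 : ℕ) : ℝ) / d * p) ∨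
      (h + ((l + 1 : ℕ) : ℝ) / d * p < z ∧ z < h + (l : ℝ) / d * p)) := by
  have e1 : ∀ m : ℕ, h + (m : ℝ) / d * p < z ↔ m * p < (z - h) * d := by
    intro m
    rw [← lt_sub_iff_add_lt', div_mul_eq_mul_div, div_lt_iff₀ hd]
    norm_cast
  have e2 : ∀ m : ℕ, z < h + (m : ℝ) / d * p ↔ (z - h) * d < m * p := by
    intro m
    rw [← sub_lt_iff_lt_add', div_mul_eq_mul_div, lt_div_iff₀ hd]
    norm_cast
  rw [e1, e2, e1, e2]
  by_cases hp : p = 0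
  · subst hp
    simp only [mul_zero]
    omega
  · rw [hpq hp]
    push_cast
    generalize hu : (z - h) * q = u
    have h1 : (z - h) * (p * q) = p * u := by rw [← hu]; ring
    rw [h1]
    rintro (⟨h2, h3⟩ | ⟨h2, h3⟩)
    · rcases le_or_gt u l with h4 | h4 <;> rcases lt_or_gt_of_ne hp with h5 | h5 <;> nlinarith
    · rcases le_or_gt u l with h4 | h4 <;> rcases lt_or_gt_of_ne hp with h5 | h5 <;> nlinarith

lemma Rep.exists_adapted (R : Rep b lam n τ y) (hlam : IsDominantIntegral b lam) (i : AffNode b) :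
    ∃ n' τ' y', Rep b lam n' τ' y' ∧ seqPath n τ y = seqPath n' τ' y' ∧
      (∀ j < n', ∀ z : ℤ, nodeHeight b θ i n' τ' y' (j + 1) < z →
        nodeHeight b θ i n' τ' y' j ≤ z) ∧
      ∀ j < n', ∀ z : ℤ, nodeHeight b θ i n' τ' y' j < z →
        nodeHeight b θ i n' τ' y' (j + 1) ≤ z := by
  have hp := fun j (hj : j < n) => R.exists_slope_eq_intCast hlam (nodeIdx b θ i) hj
  choose! p hp using hp
  have hh := fun j (hj : j < n) => R.exists_sub_eq_intCast (θ := θ) i hj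
  choose! h hh using hh
  obtain ⟨d, hd, hden, hdiv⟩ := exists_common_denominator n τ p
  obtain ⟨k, hk, R', heq⟩ := R.exists_grid hd hden
  have hd' : (0 : ℝ) < d := by exact_mod_cast hd
  refine ⟨d, _, _, R', funext fun t => heq t t.2, ?_⟩
  have key : ∀ l < d, ∀ m : ℕ, l ≤ m → m ≤ l + 1 →
      nodeHeight b θ i d (fun l => (l : ℚ) / d) (fun l => y (k l)) m =
        h (k l) + (m : ℝ) / d * p (k l) := by
    intro l hl m hlm hml
    obtain ⟨h1, h2, h3⟩ := hk l hl
    have hdq : (0 : ℚ) < d := by exact_mod_cast hd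
    have h4 : (l : ℚ) / d ≤ (m : ℚ) / d :=
      (div_le_div_iff_of_pos_right hdq).mpr (by exact_mod_cast hlm)
    have h5 : (m : ℚ) / d ≤ ((l + 1 : ℕ) : ℚ) / d :=
      (div_le_div_iff_of_pos_right hdq).mpr (by exact_mod_cast hml)
    have h6 : (τ (k l) : ℝ) ≤ ((m : ℚ) / d : ℚ) := by exact_mod_cast h2.trans h4
    have h7 : (((m : ℚ) / d : ℚ) : ℝ) ≤ τ (k l + 1) := by exact_mod_cast h5.trans h3
    rw [nodeHeight, ← heq _ (R'.nodes.mem_Icc (by omega : m ≤ d)),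
      height_seqPath R.nodes i h1 h6 h7, hp _ h1, ← hh _ h1, hp _ h1]
    push_cast
    ring
  have hnb := fun l (hl : l < d) (z : ℤ) =>
    not_between (p := p (k l)) (q := (d : ℤ) / p (k l)) (h := h (k l)) (z := z) (l := l) hd'
      (fun h0 => by
        obtain ⟨q, hq⟩ := hdiv (k l) (hk l hl).1 h0
        rw [hq, Int.mul_ediv_cancel_left _ h0])
  constructor
  · intro l hl z hz
    by_contra! hcon
    rw [key l hl l le_rfl (by omega)] at hcon
    rw [key l hl (l + 1) (by omega) le_rfl] at hz
    exact hnb l hl z (Or.inr ⟨hz, hcon⟩)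
  · intro l hl z hz
    by_contra! hcon
    rw [key l hl l le_rfl (by omega)] at hz
    rw [key l hl (l + 1) (by omega) le_rfl] at hcon
    exact hnb l hl z (Or.inl ⟨hz, hcon⟩)

end

end

section

/-! ### The crystal of piecewise linear paths -/

section IterOpt

variable {B : Type*} {g : B → Option B} {ε : B → ℕ}

/-- Each application of `g` lowers the counter `ε` by exactly one, and `g` stops precisely at zero.
-/
lemma iterOpt_isGreatest (h0 : ∀ x, ε x = 0 → g x = none)
    (h1 : ∀ x, ε x ≠ 0 → ∃ y, g x = some y ∧ ε y + 1 = ε x) (x : B) :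
    IsGreatest {n | (iterOpt g n x).isSome} (ε x) := by
  have hle : ∀ n y, iterOpt g n x = some y → ε y + n = ε x := by
    intro n
    induction n with
    | zero =>
      intro y hy
      rw [iterOpt, Option.some.injEq] at hy
      rw [hy, add_zero]
    | succ n ih =>
      intro y hy
      rw [iterOpt, Option.bind_eq_some_iff] at hy
      obtain ⟨z, hz, hzy⟩ := hy
      have h2 := ih z hz
      by_cases h3 : ε z = 0
      · rw [h0 z h3] at hzy; cases hzy
      · obtain ⟨y', hy', h4⟩ := h1 z h3
        rw [hzy, Option.some.injEq] at hy'
        subst hy'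
        omega
  have hsome : ∀ n ≤ ε x, (iterOpt g n x).isSome := by
    intro n
    induction n with
    | zero => intro _; rfl
    | succ n ih =>
      intro hn
      obtain ⟨z, hz⟩ := Option.isSome_iff_exists.mp (ih (by omega))
      have h2 := hle n z hz
      obtain ⟨y, hy, -⟩ := h1 z (by omega)
      rw [iterOpt, hz, Option.bind_some, hy]
      rfl
  refine ⟨hsome _ le_rfl, fun n hn => ?_⟩
  obtain ⟨y, hy⟩ := Option.isSome_iff_exists.mp hn
  have := hle n y hy
  omega

end IterOpt

section

variable [Fintype ι] [P.IsCrystallographic] [P.IsReduced] [P.IsRootSystem] {lam : M}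

/-- The set of the paths given by `Rep`. -/
def repPaths (b : P.Base) (lam : M) : Set (Path M) :=
  {η | ∃ n τ y, Rep b lam n τ y ∧ η = seqPath n τ y}

lemma seqPath_flip_one {n : ℕ} {τ : ℕ → ℚ} {y : ℕ → M} (h : IsNodes n τ) (i : AffNode b)
    {j₀ j₁ : ℕ} (hj : j₀ ≤ j₁) (hn : j₁ ≤ n) :
    seqPath n τ (flip b θ i j₀ j₁ y) 1 = seqPath n τ y 1 -
      (nodeHeight b θ i n τ y j₁ - nodeHeight b θ i n τ y j₀) • clRoot b θ i := by
  have h1 := seqPath_flip h i (θ := θ) (y := y) hj hn 1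
  rw [min_eq_right (h.mem_Icc hn).2, min_eq_right (h.mem_Icc (hj.trans hn)).2] at h1
  rw [clRoot_eq]
  exact h1

section

variable (hθ : IsHighestRoot b θ) (hlam : IsDominantIntegral b lam) (i : AffNode b) {η : Path M}
  (hη : η ∈ repPaths b lam)
include hη hlam

lemma exists_height_one_eq_intCast : ∃ z : ℤ, height b θ i η 1 = z := by
  obtain ⟨n, τ, y, R, rfl⟩ := hη
  rw [height_one R.nodes]
  exact R.exists_last_eq_intCast hlam i

lemma apply_one_mem_weightLattice (θ : ι) : η 1 ∈ weightLattice b := by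
  intro j hj
  obtain ⟨z, hz⟩ := exists_height_one_eq_intCast (θ := θ) hlam (some ⟨j, hj⟩) hη
  exact ⟨z, by rw [← hz, height, clPairing_eq]; rfl⟩

include hθ

lemma exists_minHeight_eq_neg : ∃ k : ℕ, minHeight b θ i η = -(k : ℝ) := by
  obtain ⟨n, τ, y, R, rfl⟩ := hη
  obtain ⟨z, ⟨j, hj, hz⟩, hmin⟩ := R.exists_min hθ hlam i
  have h0 := hmin 0 (Nat.zero_le n)
  rw [nodeHeight_zero R.nodes] at h0
  have h0' : z ≤ 0 := by exact_mod_cast h0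
  obtain ⟨k, rfl⟩ := Int.exists_eq_neg_ofNat h0'
  exact ⟨k, by rw [minHeight_eq R.nodes i hmin hj hz]; push_cast; rfl⟩

lemma minHeight_le_height_one : minHeight b θ i η ≤ height b θ i η 1 := by
  obtain ⟨n, τ, y, R, rfl⟩ := hη
  obtain ⟨z, ⟨j, hj, hz⟩, hmin⟩ := R.exists_min hθ hlam i
  rw [minHeight_eq R.nodes i hmin hj hz]
  exact le_height R.nodes i hmin 1

/-- On a grid adapted to `i` the operator is a flip between two nodes, and the flipped data are
those with which `f_i` flips back. This yields stability, inversion, the shift of the minimum and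
the weight at once. -/
lemma exists_rootE_eq_some (hm : minHeight b θ i η ≤ -1) :
    ∃ η' ∈ repPaths b lam, rootE b θ i η = some η' ∧ rootF b θ i η' = some η ∧
      minHeight b θ i η' = minHeight b θ i η + 1 ∧ η' 1 = η 1 + clRoot b θ i := by
  obtain ⟨n, τ, y, R, rfl⟩ := hη
  obtain ⟨n, τ, y, R, heq, hint, -⟩ := R.exists_adapted (θ := θ) hlam i
  rw [heq] at hm ⊢
  obtain ⟨z, hex, hmin⟩ := R.exists_min hθ hlam i
  have hz : minHeight b θ i (seqPath n τ y) = z := by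
    obtain ⟨j, hj, hz⟩ := hex
    exact minHeight_eq R.nodes i hmin hj hz
  rw [hz] at hm ⊢
  obtain ⟨j₀, j₁, hE, R'⟩ := R.exists_eData hθ i hint hmin hex (by exact_mod_cast hm)
  have hF := hE.flip R.nodes
  refine ⟨_, ⟨n, τ, _, R', rfl⟩, rootE_seqPath R.nodes i hE hm, ?_,
    minHeight_eq R.nodes i hF.min (hF.lt.le.trans hF.le) hF.eq, ?_⟩
  · rw [rootF_seqPath R.nodes i hF, flip_flip]
  · rw [seqPath_flip_one R.nodes i hE.lt.le hE.le, hE.eq, hE.eq']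
    module

lemma exists_rootF_eq_some (hm : 1 ≤ height b θ i η 1 - minHeight b θ i η) :
    ∃ η' ∈ repPaths b lam, rootF b θ i η = some η' ∧ rootE b θ i η' = some η ∧
      minHeight b θ i η' = minHeight b θ i η - 1 ∧ η' 1 = η 1 - clRoot b θ i := by
  obtain ⟨n, τ, y, R, rfl⟩ := hη
  obtain ⟨n, τ, y, R, heq, -, hint⟩ := R.exists_adapted (θ := θ) hlam i
  rw [heq] at hm ⊢
  obtain ⟨z, hex, hmin⟩ := R.exists_min hθ hlam i
  have hz : minHeight b θ i (seqPath n τ y) = z := by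
    obtain ⟨j, hj, hz⟩ := hex
    exact minHeight_eq R.nodes i hmin hj hz
  rw [hz, height_one R.nodes] at hm
  rw [hz]
  obtain ⟨j₀, j₁, hF, R'⟩ := R.exists_fData hθ i hint hmin hex (by linarith)
  have hE := hF.flip R.nodes
  have h0 : (z : ℝ) ≤ 0 := by
    have := hmin 0 (Nat.zero_le n)
    rwa [nodeHeight_zero R.nodes] at this
  refine ⟨_, ⟨n, τ, _, R', rfl⟩, rootF_seqPath R.nodes i hF, ?_,
    minHeight_eq R.nodes i hE.min hE.le hE.eq, ?_⟩
  · rw [rootE_seqPath R.nodes i hE (by linarith), flip_flip]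
  · rw [seqPath_flip_one R.nodes i hF.lt.le hF.le, hF.eq, hF.eq']
    module

end

lemma rootE_eq_none {i : AffNode b} {η : Path M} (h : ¬ minHeight b θ i η ≤ -1) :
    rootE b θ i η = none := if_neg h

lemma rootF_eq_none {i : AffNode b} {η : Path M}
    (h : ¬ 1 ≤ height b θ i η 1 - minHeight b θ i η) : rootF b θ i η = none := if_neg h

lemma height_one_sub_minHeight {i : AffNode b} {η η' : Path M} (s : ℝ)
    (h1 : η' 1 = η 1 + s • clRoot b θ i) : height b θ i η' 1 = height b θ i η 1 + 2 * s := by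
  rw [height, height, h1, clPairing_eq, clPairing_eq, map_add, map_smul, clRoot_eq]
  have : P.coroot' (nodeIdx b θ i) (P.root (nodeIdx b θ i)) = 2 := by simp
  rw [this, smul_eq_mul]; ring

/-- The paths in `repPaths` form an affine crystal under the root operators. -/
theorem exists_affineCrystal (hθ : IsHighestRoot b θ) (hlam : IsDominantIntegral b lam) :
    ∃ C : AffineCrystal b θ (repPaths b lam), C.IsPathCrystal := by
  have he : ∀ (i : AffNode b) (x : repPaths b lam), ∃ o : Option (repPaths b lam),
      o.map Subtype.val = rootE b θ i x := by
    intro i x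
    by_cases hm : minHeight b θ i (x : Path M) ≤ -1
    · obtain ⟨η', hη', h1, -⟩ := exists_rootE_eq_some hθ hlam i x.2 hm
      exact ⟨some ⟨η', hη'⟩, by rw [h1]; rfl⟩
    · exact ⟨none, (rootE_eq_none hm).symm⟩
  have hf : ∀ (i : AffNode b) (x : repPaths b lam), ∃ o : Option (repPaths b lam),
      o.map Subtype.val = rootF b θ i x := by
    intro i x
    by_cases hm : 1 ≤ height b θ i (x : Path M) 1 - minHeight b θ i (x : Path M)
    · obtain ⟨η', hη', h1, -⟩ := exists_rootF_eq_some hθ hlam i x.2 hm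
      exact ⟨some ⟨η', hη'⟩, by rw [h1]; rfl⟩
    · exact ⟨none, (rootF_eq_none hm).symm⟩
  have hε := fun (i : AffNode b) (x : repPaths b lam) => exists_minHeight_eq_neg hθ hlam i x.2
  have hφ : ∀ (i : AffNode b) (x : repPaths b lam), ∃ k : ℕ,
      height b θ i (x : Path M) 1 - minHeight b θ i (x : Path M) = k := by
    intro i x
    obtain ⟨k, hk⟩ := hε i x
    obtain ⟨z, hz⟩ := exists_height_one_eq_intCast (θ := θ) hlam i x.2
    have h1 := minHeight_le_height_one hθ hlam i x.2
    rw [hk, hz] at h1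
    have h2 : -(k : ℤ) ≤ z := by exact_mod_cast h1
    refine ⟨(z + k).toNat, ?_⟩
    have h3 : ((z + k).toNat : ℤ) = z + k := Int.toNat_of_nonneg (by omega)
    have h4 : (((z + k).toNat : ℕ) : ℝ) = z + k := by exact_mod_cast h3
    rw [h4, hk, hz]; ring
  choose e he using he
  choose f hf using hf
  choose ε hε using hε
  choose φ hφ using hφ
  have he' : ∀ i x y, e i x = some y ↔ rootE b θ i x = some y.1 := by
    intro i x y
    rw [← he, Option.map_eq_some_iff]
    constructor
    · intro h; exact ⟨y, h, rfl⟩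
    · rintro ⟨y', h, h'⟩; rw [h, Subtype.ext h']
  have hf' : ∀ i x y, f i x = some y ↔ rootF b θ i x = some y.1 := by
    intro i x y
    rw [← hf, Option.map_eq_some_iff]
    constructor
    · intro h; exact ⟨y, h, rfl⟩
    · rintro ⟨y', h, h'⟩; rw [h, Subtype.ext h']
  have hne : ∀ i x, e i x ≠ none → minHeight b θ i (x : Path M) ≤ -1 := by
    intro i x h
    by_contra hm
    exact h (by rw [← Option.map_eq_none_iff (f := Subtype.val), he, rootE_eq_none hm])
  have hnf : ∀ i x, f i x ≠ none →
      1 ≤ height b θ i (x : Path M) 1 - minHeight b θ i (x : Path M) := by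
    intro i x h
    by_contra hm
    exact h (by rw [← Option.map_eq_none_iff (f := Subtype.val), hf, rootF_eq_none hm])
  have hse : ∀ i (x : repPaths b lam), minHeight b θ i (x : Path M) ≤ -1 → ∃ y : repPaths b lam, e i x = some y ∧ f i y = some x ∧
      minHeight b θ i (y : Path M) = minHeight b θ i (x : Path M) + 1 ∧
      (y : Path M) 1 = (x : Path M) 1 + clRoot b θ i := by
    intro i x hm
    obtain ⟨η', hη', h1, h2, h3, h4⟩ := exists_rootE_eq_some hθ hlam i x.2 hm
    exact ⟨⟨η', hη'⟩, (he' _ _ _).mpr h1, (hf' _ _ _).mpr h2, h3, h4⟩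
  have hsf : ∀ i (x : repPaths b lam), 1 ≤ height b θ i (x : Path M) 1 - minHeight b θ i (x : Path M) →
      ∃ y : repPaths b lam, f i x = some y ∧ e i y = some x ∧
      minHeight b θ i (y : Path M) = minHeight b θ i (x : Path M) - 1 ∧
      (y : Path M) 1 = (x : Path M) 1 - clRoot b θ i := by
    intro i x hm
    obtain ⟨η', hη', h1, h2, h3, h4⟩ := exists_rootF_eq_some hθ hlam i x.2 hm
    exact ⟨⟨η', hη'⟩, (hf' _ _ _).mpr h1, (he' _ _ _).mpr h2, h3, h4⟩
  refine ⟨⟨fun x => (x : Path M) 1, e, f, ε, φ,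
    fun x => apply_one_mem_weightLattice hlam x.2 θ, ?_, ?_, ?_, ?_, ?_, ?_⟩,
    ⟨fun _ => rfl, he, hf, hε⟩⟩
  · intro i x y hxy
    obtain ⟨y', h1, -, -, h4⟩ := hse i x (hne i x (by rw [hxy]; simp))
    rw [hxy, Option.some.injEq] at h1
    rw [h1, h4]
  · intro i x y hxy
    obtain ⟨y', h1, -, -, h4⟩ := hsf i x (hnf i x (by rw [hxy]; simp))
    rw [hxy, Option.some.injEq] at h1
    rw [h1, h4]
  · intro i x y
    constructor
    · intro hxy
      obtain ⟨y', h1, h2, -⟩ := hsf i x (hnf i x (by rw [hxy]; simp))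
      rw [hxy, Option.some.injEq] at h1
      rw [h1, h2]
    · intro hxy
      obtain ⟨y', h1, h2, -⟩ := hse i y (hne i y (by rw [hxy]; simp))
      rw [hxy, Option.some.injEq] at h1
      rw [h1, h2]
  · intro i x
    refine iterOpt_isGreatest (fun x hx => ?_) (fun x hx => ?_) x
    · by_contra h
      have h1 := hne i x h
      rw [hε i x, hx] at h1
      norm_num at h1
    · have h1 : (1 : ℝ) ≤ ε i x := by exact_mod_cast Nat.one_le_iff_ne_zero.mpr hx
      obtain ⟨y, h2, -, h3, -⟩ := hse i x (by rw [hε i x]; linarith)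
      refine ⟨y, h2, ?_⟩
      rw [hε i x, hε i y] at h3
      have h4 : (ε i y : ℝ) + 1 = ε i x := by linarith
      exact_mod_cast h4
  · intro i x
    refine iterOpt_isGreatest (fun x hx => ?_) (fun x hx => ?_) x
    · by_contra h
      have h1 := hnf i x h
      rw [hφ i x, hx] at h1
      norm_num at h1
    · have h1 : (1 : ℝ) ≤ φ i x := by exact_mod_cast Nat.one_le_iff_ne_zero.mpr hx
      obtain ⟨y, h2, -, h3, h4⟩ := hsf i x (by rw [hφ i x]; exact h1)
      refine ⟨y, h2, ?_⟩
      have h5 := height_one_sub_minHeight (b := b) (θ := θ) (i := i) (η := x.1) (η' := y.1) (-1)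
        (by rw [h4]; module)
      have h6 := hφ i x
      have h7 := hφ i y
      have h8 : (φ i y : ℝ) + 1 = φ i x := by linarith
      exact_mod_cast h8
  · intro i x
    have h1 := hφ i x
    have h2 := hε i x
    change _ = (ε i x : ℝ) + height b θ i (x : Path M) 1
    linarith

end

end

section

/-! ### Reduced piecewise linear paths -/

section Reduced

variable {V : Type*} [AddCommGroup V] [Module ℝ V] {n n' : ℕ} {τ τ' : ℕ → ℚ} {y y' : ℕ → V}

lemma piecewiseLinear_eq_seqPath {s : ℕ} (τ : ℕ → ℚ) (y : ℕ → V) :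
    piecewiseLinear (fun u : Fin (s + 1) => y u) (fun u : Fin (s + 2) => τ u) =
      seqPath (s + 1) τ y := by
  funext t
  simp [piecewiseLinear, seqPath, seqFun, Finset.sum_range]

/-- Just to the right of `τ_j` both descriptions are linear, so their increments determine the same
direction. -/
lemma IsNodes.direction_eq (h : IsNodes n τ) (h' : IsNodes n' τ')
    (heq : ∀ t ∈ unitInterval, seqFun n τ y t = seqFun n' τ' y' t) {j k : ℕ} (hj : j < n)
    (hk : k < n') (h1 : τ j < τ' (k + 1)) (h2 : τ' k ≤ τ j) : y j = y' k := by
  have hj1 := h.strict' (Nat.lt_succ_self j) hj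
  have h1' : (τ j : ℝ) < τ' (k + 1) := by exact_mod_cast h1
  have h2' : (τ' k : ℝ) ≤ τ j := by exact_mod_cast h2
  have hmin : (τ j : ℝ) < min (τ (j + 1) : ℝ) (τ' (k + 1)) := lt_min hj1 h1'
  have hmem : min (τ (j + 1) : ℝ) (τ' (k + 1)) ∈ unitInterval :=
    ⟨(h.mem_Icc hj.le).1.trans hmin.le, (min_le_left _ _).trans (h.mem_Icc hj).2⟩
  have e1 := heq _ hmem
  have e2 := heq _ (h.mem_Icc hj.le)
  rw [h.seqFun_eq_add hj y hmin.le (min_le_left _ _),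
    h'.seqFun_eq_add hk y' (h2'.trans hmin.le) (min_le_right _ _), e2,
    h'.seqFun_eq_add hk y' h2' h1'.le] at e1
  have e3 : (min (τ (j + 1) : ℝ) (τ' (k + 1)) - τ j) • y j =
      (min (τ (j + 1) : ℝ) (τ' (k + 1)) - τ j) • y' k := by
    rw [add_assoc] at e1
    have := add_left_cancel e1
    calc _ = ((τ j - τ' k : ℝ) • y' k + (min (τ (j + 1) : ℝ) (τ' (k + 1)) - τ j) • y j) -
          (τ j - τ' k : ℝ) • y' k := by module
      _ = _ := by rw [this]; module
  exact smul_right_injective V (sub_pos.mpr hmin).ne' e3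

/-- If the first path turned earlier, its directions before and after the turn would both equal the
single direction of the second path there. -/
lemma IsNodes.node_le (h : IsNodes n τ) (h' : IsNodes n' τ')
    (heq : ∀ t ∈ unitInterval, seqFun n τ y t = seqFun n' τ' y' t)
    (hne : ∀ j, j + 1 < n → y j ≠ y (j + 1)) {j : ℕ} (hj : j < n) (hj' : j < n')
    (hτ : τ j = τ' j) : τ' (j + 1) ≤ τ (j + 1) := by
  by_contra! hlt
  have hjn : j + 1 < n := by
    refine lt_of_le_of_ne hj ?_
    rintro rfl
    rw [h.last] at hlt
    have := h'.mono hj' le_rfl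
    rw [h'.last] at this
    exact absurd hlt (not_lt.mpr this)
  have h1 := h.lt j hj
  refine hne j hjn ?_
  rw [h.direction_eq h' heq hj hj' (h1.trans hlt) hτ.ge,
    h.direction_eq h' heq hjn hj' hlt (hτ.ge.trans h1.le)]

lemma IsNodes.node_eq (h : IsNodes n τ) (h' : IsNodes n' τ')
    (heq : ∀ t ∈ unitInterval, seqFun n τ y t = seqFun n' τ' y' t)
    (hne : ∀ j, j + 1 < n → y j ≠ y (j + 1)) (hne' : ∀ j, j + 1 < n' → y' j ≠ y' (j + 1)) (j : ℕ)
    (hj : j ≤ n) (hj' : j ≤ n') : τ j = τ' j := by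
  induction j with
  | zero => rw [h.zero, h'.zero]
  | succ j ih =>
    have h1 := ih (by omega) (by omega)
    exact le_antisymm (h'.node_le h (fun t ht => (heq t ht).symm) hne' hj' hj h1.symm)
      (h.node_le h' heq hne hj hj' h1)

lemma IsNodes.length_le (h : IsNodes n τ) (h' : IsNodes n' τ') (hτ : n ≤ n' → τ n = τ' n) :
    n' ≤ n := by
  by_contra! hlt
  have h1 := h'.strict hlt le_rfl
  rw [← hτ hlt.le, h.last, h'.last] at h1
  exact lt_irrefl _ h1

lemma IsNodes.length_eq (h : IsNodes n τ) (h' : IsNodes n' τ')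
    (heq : ∀ t ∈ unitInterval, seqFun n τ y t = seqFun n' τ' y' t)
    (hne : ∀ j, j + 1 < n → y j ≠ y (j + 1)) (hne' : ∀ j, j + 1 < n' → y' j ≠ y' (j + 1)) :
    n = n' :=
  le_antisymm
    (h'.length_le h fun hle => (h.node_eq h' heq hne hne' n' hle le_rfl).symm)
    (h.length_le h' fun hle => h.node_eq h' heq hne hne' n le_rfl hle)

end Reduced

/-! ### Identification of both sets of paths with `repPaths`, and uniqueness of the pair. -/

section

lemma isNodes_ofNat {s : ℕ} {σ : Fin (s + 2) → ℚ} (hσ : StrictMono σ) (h0 : σ 0 = 0)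
    (h1 : σ (Fin.last (s + 1)) = 1) : IsNodes (s + 1) (fun l => σ (Fin.ofNat (s + 2) l)) := by
  refine ⟨h0, ?_, fun j hj => hσ ?_⟩
  · rw [← h1]; congr 1; ext; simp
  · rw [Fin.lt_def, Fin.val_ofNat, Fin.val_ofNat, Nat.mod_eq_of_lt (by omega),
      Nat.mod_eq_of_lt (by omega)]
    omega

lemma piecewiseLinear_eq_seqPath_ofNat {s : ℕ} (ν : Fin (s + 1) → M) (σ : Fin (s + 2) → ℚ) :
    piecewiseLinear ν σ = seqPath (s + 1) (fun l => σ (Fin.ofNat (s + 2) l))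
      (fun l => ν (Fin.ofNat (s + 1) l)) := by
  rw [← piecewiseLinear_eq_seqPath]
  congr 1 <;> ext u <;> simp

lemma ofNat_eq_succ {s j : ℕ} (hj : j < s) : Fin.ofNat (s + 1) (j + 1) = (⟨j, hj⟩ : Fin s).succ := by
  ext; simp; omega

lemma ofNat_eq_castSucc {s j : ℕ} (hj : j < s) :
    Fin.ofNat (s + 1) j = (⟨j, hj⟩ : Fin s).castSucc := by
  ext; simp; omega

variable [Fintype ι] [P.IsCrystallographic] [P.IsReduced] [P.IsRootSystem]
  {lam : M} {n : ℕ} {τ : ℕ → ℚ} {y : ℕ → M}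

lemma piecewiseLinear_mem_repPaths {s : ℕ} {ν : Fin (s + 1) → M} {σ : Fin (s + 2) → ℚ}
    (hσ : StrictMono σ) (h0 : σ 0 = 0) (h1 : σ (Fin.last (s + 1)) = 1)
    (hmem : ∀ u, ∃ w : P.weylGroup, ν u = w • lam)
    (hup : ∀ u : Fin s, Up b (σ u.succ.castSucc) (ν u.succ) (ν u.castSucc)) :
    piecewiseLinear ν σ ∈ repPaths b lam := by
  refine ⟨_, _, _, ⟨isNodes_ofNat hσ h0 h1, fun j _ => hmem _, fun j hj => ?_⟩,
    piecewiseLinear_eq_seqPath_ofNat ν σ⟩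
  have hj' : j < s := by omega
  have := hup ⟨j, hj'⟩
  rw [ofNat_eq_succ hj', ofNat_eq_castSucc hj', ofNat_eq_castSucc (by omega : j + 1 < s + 1)]
  exact this

/-- Removing a node at which the direction does not change. -/
lemma Rep.remove_node (R : Rep b lam (n + 1) τ y) {j : ℕ} (hj : j < n) (hy : y j = y (j + 1)) :
    ∃ τ' y', Rep b lam n τ' y' ∧ seqPath (n + 1) τ y = seqPath n τ' y' := by
  have hnodes : IsNodes n (fun l => if l ≤ j then τ l else τ (l + 1)) := by
    refine ⟨?_, ?_, fun l hl => ?_⟩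
    · simp only [Nat.zero_le, if_true, R.nodes.zero]
    · simp only [not_le.mpr hj, if_false, R.nodes.last]
    · split_ifs
      · exact R.nodes.strict (by omega) (by omega)
      · exact R.nodes.strict (by omega) (by omega)
      · omega
      · exact R.nodes.strict (by omega) (by omega)
  refine ⟨_, fun l => if l ≤ j then y l else y (l + 1), ⟨hnodes, fun l hl => ?_, fun l hl => ?_⟩,
    funext fun t => hnodes.eq_seqFun _ _ (R.nodes.seqFun_zero y) (fun l hl t h0 h1 => ?_) t.2⟩
  · split_ifs
    · exact R.mem _ (by omega)
    · exact R.mem _ (by omega)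
  · rcases lt_trichotomy l j with h | rfl | h
    · simp only [if_pos h.le, if_pos (show l + 1 ≤ j from h)]
      exact R.up l (by omega)
    · simp only [if_neg (show ¬ l + 1 ≤ l by omega), if_pos le_rfl]
      rw [hy]
      exact R.up (l + 1) (by omega)
    · simp only [if_neg (not_le.mpr h), if_neg (show ¬ l + 1 ≤ j by omega)]
      exact R.up (l + 1) (by omega)
  · rcases lt_trichotomy l j with h | rfl | h
    · simp only [if_pos h.le, if_pos (show l + 1 ≤ j from h)] at h0 h1 ⊢
      exact R.nodes.seqFun_eq_add (by omega) y h0 h1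
    · simp only [if_neg (show ¬ l + 1 ≤ l by omega), if_pos le_rfl] at h0 h1 ⊢
      rcases le_total t (τ (l + 1)) with h2 | h2
      · exact R.nodes.seqFun_eq_add (by omega) y h0 h2
      · rw [R.nodes.seqFun_eq_add (by omega : l + 1 < n + 1) y h2 h1,
          R.nodes.seqFun_eq_add (by omega : l < n + 1) y (R.nodes.mono' (by omega) (by omega))
            le_rfl, ← hy]
        module
    · simp only [if_neg (not_le.mpr h), if_neg (show ¬ l + 1 ≤ j by omega)] at h0 h1 ⊢
      exact R.nodes.seqFun_eq_add (by omega) y h0 h1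

lemma exists_reduced {η : Path M} (hη : η ∈ repPaths b lam) :
    ∃ s τ y, Rep b lam (s + 1) τ y ∧ η = seqPath (s + 1) τ y ∧ ∀ j < s, y j ≠ y (j + 1) := by
  obtain ⟨n, τ, y, R, rfl⟩ := hη
  induction n generalizing τ y with
  | zero => exact absurd R.nodes.pos (lt_irrefl 0)
  | succ n ih =>
    by_cases h : ∀ j < n, y j ≠ y (j + 1)
    · exact ⟨n, τ, y, R, rfl, h⟩
    · push Not at h
      obtain ⟨j, hj, hy⟩ := h
      obtain ⟨τ', y', R', heq⟩ := R.remove_node hj hy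
      rw [heq]
      exact ih τ' y' R'

lemma Rep.strictMono {s : ℕ} (R : Rep b lam (s + 1) τ y) :
    StrictMono (fun u : Fin (s + 2) => τ u) := fun _ v huv =>
  R.nodes.strict huv (by omega)

/-- Merging segments with equal directions makes consecutive directions distinct, hence so are their
minimal representatives, and paths of edges become paths in the parabolic graph. -/
theorem qls_eq_repPaths (hθ : IsHighestRoot b θ) (hlam : IsDominantIntegral b lam) :
    QLS b lam = repPaths b lam := by
  ext η
  constructor
  · rintro ⟨q, rfl⟩
    exact piecewiseLinear_mem_repPaths q.σ_strictMono q.σ_zero q.σ_last (fun u => ⟨_, rfl⟩)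
      fun u => (q.directedPath u).up hθ hlam
  · intro hη
    obtain ⟨s, τ, y, R, rfl, hne⟩ := exists_reduced hη
    have hv : ∀ u : Fin (s + 1), ∃ v ∈ minReps b lam, v • lam = y u := by
      intro u
      obtain ⟨w, hw⟩ := R.mem u u.2
      rw [hw]
      exact exists_mem_minReps b lam w
    choose v hv hvy using hv
    refine ⟨⟨s, v, fun u => τ u, hv, fun u he => hne u u.2 ?_, R.strictMono, R.nodes.zero,
      R.nodes.last, fun u => ?_⟩, ?_⟩
    · have h1 := hvy u.castSucc
      have h2 := hvy u.succ
      rw [he, h2] at h1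
      exact h1.symm
    · refine Up.hasDirectedPath hθ hlam (hv _) (hv _) ?_
      rw [hvy, hvy]
      exact R.up u (by omega)
    · rw [← piecewiseLinear_eq_seqPath]
      unfold QLSPair.toPath
      simp only [hvy]

/-- Lifting the directions to the affine orbit, from the last one to the first one. -/
lemma Rep.exists_lift (hθ : IsHighestRoot b θ) (R : Rep b lam (n + 1) τ y)
    (hne : ∀ j < n, y j ≠ y (j + 1)) (d : ℕ) :
    ∃ ν : ℕ → AffSpace M, ∀ j ≤ n, n ≤ j + d → ν j ∈ orbit b θ lam ∧ (ν j).1 = y j ∧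
      (j < n → HasChain b θ lam (τ (j + 1)) (ν j) (ν (j + 1))) := by
  induction d with
  | zero =>
    obtain ⟨w, hw⟩ := R.mem n (Nat.lt_succ_self n)
    -- The `δ`-component of the last direction is free, since only projections matter; zero is in
    -- the orbit already under the finite Weyl group.
    refine ⟨fun _ => (w • lam, 0, 0), fun j hj hj' => ?_⟩
    obtain rfl : j = n := by omega
    exact ⟨smul_mem_orbit b θ lam w, hw.symm, fun h => absurd h (lt_irrefl _)⟩
  | succ d ih =>
    obtain ⟨ν, hν⟩ := ih
    by_cases hd : d + 1 ≤ n
    · obtain ⟨k, rfl⟩ := Nat.exists_eq_add_of_le' hd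
      obtain ⟨h1, h2, -⟩ := hν (k + 1) (by omega) (by omega)
      obtain ⟨μ, hμ, hμ1, hc⟩ := Up.exists_hasChain hθ h1 (h2 ▸ R.up k (by omega))
        (h2 ▸ (hne k (by omega)).symm)
      refine ⟨fun j => if j = k then μ else ν j, fun j hj hj' => ?_⟩
      by_cases hjk : j = k
      · subst hjk
        simp only [if_true, if_neg (show ¬ j + 1 = j by omega)]
        exact ⟨hμ, hμ1, fun _ => hc⟩
      · simp only [if_neg hjk, if_neg (show ¬ j + 1 = k by omega)]
        exact hν j hj (by omega)
    · exact ⟨ν, fun j hj hj' => hν j hj (by omega)⟩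

/-- Projecting covers gives edges; conversely a reduced path is lifted from its last direction
upwards. The order relations between the lifted directions are implied by the chains. -/
theorem lscl_eq_repPaths (hθ : IsHighestRoot b θ) : LScl b θ lam = repPaths b lam := by
  ext η
  constructor
  · rintro ⟨π, hπ⟩
    have h1 : η = piecewiseLinear (fun u => (π.ν u).1) π.σ := by
      funext t
      rw [hπ t]
      simp [LSPair.toPath, piecewiseLinear, Prod.fst_sum]
    rw [h1]
    refine piecewiseLinear_mem_repPaths π.σ_strictMono π.σ_zero π.σ_last (fun u => ?_)
      fun u => (π.chain u).up hθ
    obtain ⟨w, m, hw⟩ := exists_eq_of_mem_orbit (π.ν_mem u)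
    exact ⟨w, by rw [hw]⟩
  · intro hη
    obtain ⟨s, τ, y, R, rfl, hne⟩ := exists_reduced hη
    obtain ⟨ν, hν⟩ := R.exists_lift hθ hne s
    have hν' := fun j hj => hν j hj (Nat.le_add_left s j)
    refine ⟨⟨s, fun u => ν u, fun u => τ u, fun u => (hν' u (by omega)).1,
      fun u => ((hν' u (by omega)).2.2 u.2).weightLT, R.strictMono, R.nodes.zero,
      R.nodes.last, fun u => (hν' u (by omega)).2.2 u.2⟩, fun t => ?_⟩
    rw [← piecewiseLinear_eq_seqPath]
    simp only [LSPair.toPath, piecewiseLinear, Prod.fst_sum, Prod.smul_fst]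
    exact Finset.sum_congr rfl fun u _ => by rw [(hν' u (by omega)).2.1]

theorem toPath_injective (hθ : IsHighestRoot b θ) (hlam : IsDominantIntegral b lam) :
    Function.Injective (QLSPair.toPath (b := b) (lam := lam)) := by
  intro q q' hqq
  have hne : ∀ q : QLSPair b lam, ∀ j, j + 1 < q.s + 1 →
      q.x (Fin.ofNat (q.s + 1) j) • lam ≠ q.x (Fin.ofNat (q.s + 1) (j + 1)) • lam := by
    intro q j hj he
    have hj' : j < q.s := by omega
    have h1 := minReps_injOn hθ hlam (q.x_mem _) (q.x_mem _) he
    rw [ofNat_eq_succ hj', ofNat_eq_castSucc hj'] at h1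
    exact q.x_ne _ h1
  have hN := fun q : QLSPair b lam => isNodes_ofNat q.σ_strictMono q.σ_zero q.σ_last
  have heq : ∀ t ∈ unitInterval, _ = _ := fun t ht => congrFun
    ((piecewiseLinear_eq_seqPath_ofNat (fun u => q.x u • lam) q.σ).symm.trans
      (hqq.trans (piecewiseLinear_eq_seqPath_ofNat (fun u => q'.x u • lam) q'.σ))) ⟨t, ht⟩
  have hs := (hN q).length_eq (hN q') heq (hne q) (hne q')
  have hτ := (hN q).node_eq (hN q') heq (hne q) (hne q')
  have hy := fun j (hj : j < q.s + 1) (hj' : j < q'.s + 1) =>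
    (hN q).direction_eq (hN q') heq hj hj'
      ((hτ j hj.le hj'.le).trans_lt ((hN q').lt j hj')) (hτ j hj.le hj'.le).ge
  obtain ⟨s, x, σ, hx, _, _, _, _, _⟩ := q
  obtain ⟨s', x', σ', hx', _, _, _, _, _⟩ := q'
  obtain rfl : s = s' := Nat.succ_injective hs
  have hσ : σ = σ' := by
    funext u
    have := hτ u (by simp; omega) (by simp; omega)
    simpa using this
  have hxx : x = x' := by
    funext u
    have := hy u u.2 u.2
    exact minReps_injOn hθ hlam (hx u) (hx' u) (by simpa using this)
  subst hσ hxx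
  rfl

end

end

end LevelZeroLS

end

theorem mainTheorem7 {ι M N : Type*} [Fintype ι]
    [AddCommGroup M] [Module ℝ M] [AddCommGroup N] [Module ℝ N]
    (P : RootPairing ι ℝ M N) [P.IsCrystallographic] [P.IsReduced] [P.IsIrreducible]
    (b : P.Base) (θ : ι) (hθ : LevelZeroLS.IsHighestRoot b θ)
    (lam : M) (hlam : LevelZeroLS.IsDominantIntegral b lam) :
    Function.Injective (LevelZeroLS.QLSPair.toPath (b := b) (lam := lam)) ∧
    LevelZeroLS.QLS b lam = LevelZeroLS.LScl b θ lam ∧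
    ∃ (C : LevelZeroLS.AffineCrystal b θ (LevelZeroLS.QLS b lam))
      (C' : LevelZeroLS.AffineCrystal b θ (LevelZeroLS.LScl b θ lam)),
      C.IsPathCrystal ∧ C'.IsPathCrystal ∧
      ∃ Ψ : C.Iso C', ∀ η : LevelZeroLS.QLS b lam,
        (Ψ.toEquiv η : LevelZeroLS.Path M) = (η : LevelZeroLS.Path M) := by
  -- The existence of a root is what makes the irreducible root pairing a root system.
  have : Nonempty ι := ⟨θ⟩
  refine ⟨LevelZeroLS.toPath_injective hθ hlam, ?_, ?_⟩
  · rw [LevelZeroLS.qls_eq_repPaths hθ hlam, LevelZeroLS.lscl_eq_repPaths hθ]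
  · rw [LevelZeroLS.qls_eq_repPaths hθ hlam, LevelZeroLS.lscl_eq_repPaths hθ]
    -- Both carriers have become the same set, so one crystal serves for both and the isomorphism is
    -- the identity.
    obtain ⟨C, hC⟩ := LevelZeroLS.exists_affineCrystal hθ hlam
    exact ⟨C, C, hC, hC, ⟨Equiv.refl _, fun _ => rfl, fun _ _ => by simp, fun _ _ => by simp,
      fun _ _ => rfl, fun _ _ => rfl⟩, fun _ => rfl⟩
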